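/- Let $\mathcal S_2^1=\{1,2,3,4\}$ be the pseudo-circle, with open sets $\emptyset,\{3\},\{4\},\{3,4\},\{1,3,4\},\{2,3,4\},\{1,2,3,4\}$. Write $\mathbb{LC}$ for the set of its locally closed subsets (including $\emptyset$), and $\mathbb O(Y)$ for the set of relatively open subsets of $Y\in\mathbb{LC}$. Let $\mathcal{NT}$ be the pre-additive category of natural transformations of filtrated K-theory over $\mathcal S_2^1$. Explicitly, its objects are the pairs $Y_j$ with $Y\in\mathbb{LC}$ and $j\in\mathbb Z/2$. It is the universal pre-additive category generated by morphisms $i_U^Y\colon U_j\to Y_j$ ($U$ open in $Y$), $r_Y^C\colon Y_j\to C_j$ ($C$ relatively closed in $Y$) and $\delta_{Y\setminus U}^{U}\colon (Y\setminus U)_j\to U_{j+1}$ ($U$ open in $Y$), for all $Y\in\mathbb{LC}$ and $j\in\mathbb Z/2$, subject to the following relations (in each degree): 1. $i_Y^Y=r_Y^Y=\mathrm{id}_Y$; 2. $i_V^Y i_U^V=i_U^Y$ for $U$ open in $V$ and $V$ open in $Y$; $r_C^D r_Y^C=r_Y^D$ for $C$ closed in $Y$ and $D$ closed in $C$; 3.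 $r_Y^C i_U^Y=i_{U\cap C}^{C}r_U^{U\cap C}$ for $U$ open and $C$ closed in $Y$; 4. $i_U^Yr_Y^U+i_V^Yr_Y^V=\mathrm{id}_Y$ if $Y$ is the disjoint union of $U$ and $V$, both open and closed in $Y$; 5. for $U$ open in $Y$ and $C=Y\setminus U$: $\delta_C^U i_D^C=\delta_D^U$ for $D$ open in $C$; $r_U^W\delta_C^U=\delta_C^W$ for $W$ closed in $U$; and $i_U^V\delta_{Y\setminus U}^U=\delta_{Y\setminus V}^V r_{Y\setminus U}^{Y\setminus V}$ for $U\subseteq V$ with $V$ open in $Y$. An $\mathcal{NT}$-module is an additive functor $M$ from $\mathcal{NT}$ to abelian groups, equivalently a left module over the category ring of $\mathcal{NT}$ (a unital ring, since there are finitely many objects). Its suspension $SM$ is given by $SM(Y_j)=M(Y_{1-j})$, with $i,r,\delta$ acting with shifted degree. The module $M$ is *exact* if for all $Y\in\mathbb{LC}$ and $U\in\mathbb O(Y)$ the cyclic sequence $$M(U_0)\xrightarrow{i}M(Y_0)\xrightarrow{r}M((Y\setminus U)_0)\xrightarrow{\delta}M(U_1)\xrightarrow{i}M(Y_1)\xrightarrow{r}M((Y\setminus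 U)_1)\xrightarrow{\delta}M(U_0)$$ is exact. An exact module $M$ is *real rank zero like* if the maps $\delta\colon M((Y\setminus U)_0)\to M(U_1)$ vanish for all $Y\in\mathbb{LC}$ and $U\in\mathbb O(Y)$. **Proposition.** Let $M$ be an exact, real rank zero like $\mathcal{NT}$-module over $\mathcal S_2^1$. Then $\operatorname{Ext}^2_{\mathcal{NT}}(M,SM)=0$. -/

import Mathlib

open CategoryTheory

universe u

namespace FilteredK

/-! ### Locally closed subsets -/

/-- The set `𝕃ℂ(X)` of locally closed subsets of `X` (including the empty set). -/
def LC (X : Type) [TopologicalSpace X] : Type := {Y : Set X // IsLocallyClosed Y}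

section

variable {X : Type} [TopologicalSpace X]

/-- `U` is a (relatively) open subset of `Y`, i.e. `U ∈ 𝕆(Y)`. -/
def IsOpenIn (U Y : LC X) : Prop := ∃ O : Set X, IsOpen O ∧ U.1 = O ∩ Y.1

/-- `C` is a relatively closed subset of `Y`. -/
def IsClosedIn (C Y : LC X) : Prop := ∃ F : Set X, IsClosed F ∧ C.1 = F ∩ Y.1

/-- `U` is relatively open in `Y` and `C = Y \ U`. -/
def IsExtension (U Y C : LC X) : Prop := IsOpenIn U Y ∧ C.1 = Y.1 \ U.1

/-- The pair `(C, U)` is a boundary pair if `C = Y \ U` for some `Y ∈ 𝕃ℂ(X)` and `U ∈ 𝕆(Y)`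
(necessarily `Y = U ∪ C`). -/
def IsBoundaryPair (C U : LC X) : Prop := ∃ Y : LC X, IsExtension U Y C

theorem IsExtension.isClosedIn {U Y C : LC X} (h : IsExtension U Y C) : IsClosedIn C Y := by
  obtain ⟨⟨O, hO, hU⟩, hC⟩ := h
  refine ⟨Oᶜ, hO.isClosed_compl, ?_⟩
  rw [hC, hU]
  ext x
  simp only [Set.mem_sdiff, Set.mem_inter_iff, Set.mem_compl_iff]
  tauto

theorem IsExtension.isBoundaryPair {U Y C : LC X} (h : IsExtension U Y C) :
    IsBoundaryPair C U := ⟨Y, h⟩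

end

noncomputable instance (X : Type) [TopologicalSpace X] [Finite X] : Fintype (LC X) :=
  haveI : Finite (LC X) := inferInstanceAs (Finite {Y : Set X // IsLocallyClosed Y})
  Fintype.ofFinite _

/-! ### The category `𝒩𝒯`, as a ring -/

/-- Objects of `𝒩𝒯`: pairs `(Y, j)`, written `Y_j`, of a locally closed subset and a degree. -/
abbrev Obj (X : Type) [TopologicalSpace X] : Type := LC X × ZMod 2

/-- The change of degree `Y_j ↦ Y_{1-j}` on objects. -/
def Obj.shift {X : Type} [TopologicalSpace X] (a : Obj X) : Obj X := (a.1, a.2 + 1)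

/-- The generating morphisms: for `Y` locally closed, `U` open in `Y` and `C = Y \ U`, the maps
`i : U_j → Y_j`, `r : Y_j → C_j` and `δ : C_j → U_{j+1}` of the cyclic six term sequences. -/
inductive Gen {X : Type} [TopologicalSpace X] : Obj X → Obj X → Type
  | i {U Y : LC X} (h : IsOpenIn U Y) (j : ZMod 2) : Gen (U, j) (Y, j)
  | r {Y C : LC X} (h : IsClosedIn C Y) (j : ZMod 2) : Gen (Y, j) (C, j)
  | δ {C U : LC X} (h : IsBoundaryPair C U) (j : ZMod 2) : Gen (C, j) (U, j + 1)

/-- Generators of the category ring: the identities of the objects and the generating morphisms. -/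
inductive Letter (X : Type) [TopologicalSpace X] : Type
  | e (a : Obj X) : Letter X
  | of {a b : Obj X} (g : Gen a b) : Letter X

/-- The free ring on the letters. -/
abbrev Free (X : Type) [TopologicalSpace X] : Type := FreeAlgebra ℤ (Letter X)

section

variable {X : Type} [TopologicalSpace X]

namespace Free

/-- The identity of the object `a`. -/
def e (a : Obj X) : Free X := FreeAlgebra.ι ℤ (Letter.e a)

/-- A generating morphism. -/
def of {a b : Obj X} (g : Gen a b) : Free X := FreeAlgebra.ι ℤ (Letter.of g)

/-- The extension map `i_{U_j}^{Y_j}`. -/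
def i {U Y : LC X} (h : IsOpenIn U Y) (j : ZMod 2) : Free X := of (Gen.i h j)

/-- The restriction map `r_{Y_j}^{C_j}`. -/
def r {Y C : LC X} (h : IsClosedIn C Y) (j : ZMod 2) : Free X := of (Gen.r h j)

/-- The boundary map `δ_{C_j}^{U_{j+1}}`. -/
def δ {C U : LC X} (h : IsBoundaryPair C U) (j : ZMod 2) : Free X := of (Gen.δ h j)

end Free

open Free in
/-- The defining relations. A product `f * g` is the composite "first `g`, then `f`". -/
inductive Rel [Finite X] : Free X → Free X → Prop
  -- The ring is the category ring of a pre-additive category with object set `Obj X`.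
  | e_mul_self (a : Obj X) : Rel (e a * e a) (e a)
  | e_mul_e (a b : Obj X) (h : a ≠ b) : Rel (e a * e b) 0
  | sum_e : Rel (∑ a : Obj X, e a) 1
  | mul_source {a b : Obj X} (g : Gen a b) : Rel (of g * e a) (of g)
  | target_mul {a b : Obj X} (g : Gen a b) : Rel (e b * of g) (of g)
  -- Identities and composites of extension maps and of restriction maps.
  | i_self (Y : LC X) (h : IsOpenIn Y Y) (j : ZMod 2) : Rel (i h j) (e (Y, j))
  | r_self (Y : LC X) (h : IsClosedIn Y Y) (j : ZMod 2) : Rel (r h j) (e (Y, j))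
  | i_comp {U V Y : LC X} (hUV : IsOpenIn U V) (hVY : IsOpenIn V Y) (hUY : IsOpenIn U Y)
      (j : ZMod 2) : Rel (i hVY j * i hUV j) (i hUY j)
  | r_comp {Y C D : LC X} (hYC : IsClosedIn C Y) (hCD : IsClosedIn D C) (hYD : IsClosedIn D Y)
      (j : ZMod 2) : Rel (r hCD j * r hYC j) (r hYD j)
  -- Base change: `r_Y^C i_U^Y = i_{U ∩ C}^C r_U^{U ∩ C}`.
  | r_i {U Y C W : LC X} (hU : IsOpenIn U Y) (hC : IsClosedIn C Y) (hW : W.1 = U.1 ∩ C.1)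
      (hWC : IsOpenIn W C) (hWU : IsClosedIn W U) (j : ZMod 2) :
      Rel (r hC j * i hU j) (i hWC j * r hWU j)
  -- Additivity: if `Y` is the topologically disjoint union of `U` and `V`, then
  -- `i_U^Y r_Y^U + i_V^Y r_Y^V` is the identity of `Y`.
  | disjoint_union {U V Y : LC X} (hd : Disjoint U.1 V.1) (hY : Y.1 = U.1 ∪ V.1)
      (hU : IsOpenIn U Y) (hU' : IsClosedIn U Y) (hV : IsOpenIn V Y) (hV' : IsClosedIn V Y)
      (j : ZMod 2) : Rel (i hU j * r hU' j + i hV j * r hV' j) (e (Y, j))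
  -- Naturality of the boundary map: `δ_C^U i_D^C = δ_D^U` for `D` open in `C`.
  | δ_i {C D U : LC X} (hCU : IsBoundaryPair C U) (hDC : IsOpenIn D C) (hDU : IsBoundaryPair D U)
      (j : ZMod 2) : Rel (δ hCU j * i hDC j) (δ hDU j)
  -- `r_U^W δ_C^U = δ_C^W` for `W` closed in `U`.
  | r_δ {C U W : LC X} (hCU : IsBoundaryPair C U) (hWU : IsClosedIn W U)
      (hCW : IsBoundaryPair C W) (j : ZMod 2) : Rel (r hWU (j + 1) * δ hCU j) (δ hCW j)
  -- `i_U^V δ_{Y \ U}^U = δ_{Y \ V}^V r_{Y \ U}^{Y \ V}` for `U ⊆ V` open in `Y`.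
  | i_δ {U V Y C D : LC X} (hU : IsExtension U Y C) (hV : IsExtension V Y D)
      (hUV : IsOpenIn U V) (hDC : IsClosedIn D C) (j : ZMod 2) :
      Rel (i hUV (j + 1) * δ hU.isBoundaryPair j) (δ hV.isBoundaryPair j * r hDC j)

end

/-- The (category ring of the) category `𝒩𝒯` over `X`, given by the generating natural
transformations of the six term exact sequences and their standard relations. For the pseudo-circle
its group of morphisms `Y_j → Z_k` is `KK₀(X; Σᵏ R_Z, Σʲ R_Y)`, where `R_Y` represents the functor
`A ↦ K_*(A(Y))` on separable C⋆-algebras over `X`. -/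
def NT (X : Type) [TopologicalSpace X] [Finite X] : Type := RingQuot (Rel (X := X))

noncomputable instance (X : Type) [TopologicalSpace X] [Finite X] : Ring (NT X) :=
  inferInstanceAs (Ring (RingQuot (Rel (X := X))))

section

variable {X : Type} [TopologicalSpace X] [Finite X]

namespace NT

/-- The quotient map from the free ring. -/
noncomputable def mk : Free X →+* NT X := RingQuot.mkRingHom Rel

theorem mk_rel {x y : Free X} (h : Rel x y) : mk x = mk y := RingQuot.mkRingHom_rel h

/-- The idempotent of the object `a`. -/
noncomputable def e (a : Obj X) : NT X := mk (Free.e a)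

/-- The class of a generating morphism. -/
noncomputable def of {a b : Obj X} (g : Gen a b) : NT X := mk (Free.of g)

theorem target_mul {a b : Obj X} (g : Gen a b) : e b * of g = of g := by
  simpa [e, of] using mk_rel (Rel.target_mul g)

end NT

/-! ### Exact and real rank zero like modules -/

section modules

variable (M : Type u) [AddCommGroup M] [Module (NT X) M]

/-- The group `M(Y_j) = e_{Y_j} M`. -/
def comp (a : Obj X) : AddSubgroup M where
  carrier := {m | NT.e a • m = m}
  zero_mem' := smul_zero _
  add_mem' {x y} hx hy := by
    change NT.e a • (x + y) = x + y
    rw [smul_add, show NT.e a • x = x from hx, show NT.e a • y = y from hy]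
  neg_mem' {x} hx := by
    change NT.e a • (-x) = -x
    rw [smul_neg, show NT.e a • x = x from hx]

/-- The map `M(a) → M(b)` induced by a generating morphism `a → b`. -/
noncomputable def act {a b : Obj X} (g : Gen a b) : comp M a →+ comp M b where
  toFun m := ⟨NT.of g • (m : M), by
    change NT.e b • NT.of g • (m : M) = NT.of g • (m : M)
    rw [← mul_smul, NT.target_mul]⟩
  map_zero' := by ext; simp
  map_add' x y := by ext; simp

/-- `M` is exact: for all `Y ∈ 𝕃ℂ(X)` and `U ∈ 𝕆(Y)`, with `C = Y \ U`, the cyclic sequence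
`M(U_0) → M(Y_0) → M(C_0) → M(U_1) → M(Y_1) → M(C_1) → M(U_0)` is exact. -/
def IsExact : Prop :=
  ∀ (U Y C : LC X) (h : IsExtension U Y C) (j : ZMod 2),
    Function.Exact (act M (Gen.i h.1 j)) (act M (Gen.r h.isClosedIn j)) ∧
    Function.Exact (act M (Gen.r h.isClosedIn j)) (act M (Gen.δ h.isBoundaryPair j)) ∧
    Function.Exact (act M (Gen.δ h.isBoundaryPair j)) (act M (Gen.i h.1 (j + 1)))

/-- `M` is exact and all the boundary maps `M((Y \ U)_0) → M(U_1)` vanish. -/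
def IsRealRankZeroLike : Prop :=
  IsExact (X := X) M ∧
    ∀ (U Y C : LC X) (h : IsExtension U Y C), act M (Gen.δ h.isBoundaryPair 0) = 0

end modules

end

/-! ### Suspension -/

section

variable {X : Type} [TopologicalSpace X]

/-- The change of degree on generating morphisms. -/
def Gen.shift {a b : Obj X} : Gen a b → Gen a.shift b.shift
  | .i h j => .i h (j + 1)
  | .r h j => .r h (j + 1)
  | .δ h j => .δ h (j + 1)

/-- The change of degree on letters. -/
def Letter.shift : Letter X → Letter X
  | .e a => .e a.shift
  | .of g => .of g.shift

/-- The change of degree on the free ring. -/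
def Free.shift : Free X →ₐ[ℤ] Free X :=
  FreeAlgebra.lift ℤ fun l => FreeAlgebra.ι ℤ l.shift

@[simp] theorem Free.shift_e (a : Obj X) : Free.shift (Free.e a) = Free.e a.shift := by
  simp [Free.shift, Free.e, Letter.shift]

@[simp] theorem Free.shift_of {a b : Obj X} (g : Gen a b) :
    Free.shift (Free.of g) = Free.of g.shift := by
  simp [Free.shift, Free.of, Letter.shift]

@[simp] theorem Free.shift_i {U Y : LC X} (h : IsOpenIn U Y) (j : ZMod 2) :
    Free.shift (Free.i h j) = Free.i h (j + 1) := Free.shift_of _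

@[simp] theorem Free.shift_r {Y C : LC X} (h : IsClosedIn C Y) (j : ZMod 2) :
    Free.shift (Free.r h j) = Free.r h (j + 1) := Free.shift_of _

@[simp] theorem Free.shift_δ {C U : LC X} (h : IsBoundaryPair C U) (j : ZMod 2) :
    Free.shift (Free.δ h j) = Free.δ h (j + 1) := Free.shift_of _

theorem Obj.shift_shift (a : Obj X) : a.shift.shift = a := by
  obtain ⟨Y, j⟩ := a
  have h : j + 1 + 1 = j := by revert j; decide
  simp [Obj.shift, h]

/-- The change of degree as a permutation of the objects. -/
def Obj.shiftEquiv : Obj X ≃ Obj X :=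
  ⟨Obj.shift, Obj.shift, Obj.shift_shift, Obj.shift_shift⟩

variable [Finite X]

theorem Rel.shift {x y : Free X} (h : Rel x y) :
    NT.mk (Free.shift x) = NT.mk (Free.shift y) := by
  cases h with
  | e_mul_self a => simpa using NT.mk_rel (Rel.e_mul_self a.shift)
  | e_mul_e a b h =>
    simpa using NT.mk_rel (Rel.e_mul_e a.shift b.shift (Obj.shiftEquiv.injective.ne h))
  | sum_e =>
    have := NT.mk_rel (Rel.sum_e (X := X))
    rw [← Equiv.sum_comp Obj.shiftEquiv] at this
    simpa [Obj.shiftEquiv] using this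
  | mul_source g => simpa using NT.mk_rel (Rel.mul_source g.shift)
  | target_mul g => simpa using NT.mk_rel (Rel.target_mul g.shift)
  | i_self Y h j => simpa [Obj.shift] using NT.mk_rel (Rel.i_self Y h (j + 1))
  | r_self Y h j => simpa [Obj.shift] using NT.mk_rel (Rel.r_self Y h (j + 1))
  | i_comp h₁ h₂ h₃ j => simpa [Obj.shift] using NT.mk_rel (Rel.i_comp h₁ h₂ h₃ (j + 1))
  | r_comp h₁ h₂ h₃ j => simpa [Obj.shift] using NT.mk_rel (Rel.r_comp h₁ h₂ h₃ (j + 1))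
  | r_i h₁ h₂ h₃ h₄ h₅ j =>
    simpa [Obj.shift] using NT.mk_rel (Rel.r_i h₁ h₂ h₃ h₄ h₅ (j + 1))
  | disjoint_union h₁ h₂ h₃ h₄ h₅ h₆ j =>
    simpa [Obj.shift] using NT.mk_rel (Rel.disjoint_union h₁ h₂ h₃ h₄ h₅ h₆ (j + 1))
  | δ_i h₁ h₂ h₃ j => simpa [Obj.shift] using NT.mk_rel (Rel.δ_i h₁ h₂ h₃ (j + 1))
  | r_δ h₁ h₂ h₃ j => simpa [Obj.shift] using NT.mk_rel (Rel.r_δ h₁ h₂ h₃ (j + 1))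
  | i_δ h₁ h₂ h₃ h₄ j =>
    simpa [Obj.shift] using NT.mk_rel (Rel.i_δ h₁ h₂ h₃ h₄ (j + 1))

/-- The ring endomorphism of `𝒩𝒯` (in fact an involution) that changes the degree of all objects
and generating morphisms. -/
noncomputable def NT.shift : NT X →+* NT X :=
  RingQuot.lift ⟨(NT.mk (X := X)).comp (Free.shift (X := X)).toRingHom, fun _ _ h => h.shift⟩

end

/-- The suspension `SM` of an `𝒩𝒯`-module: the same group, on which `𝒩𝒯` acts through the change
of degree, so that `SM(Y_j) = M(Y_{1-j})`. -/
noncomputable def suspension (X : Type) [TopologicalSpace X] [Finite X] :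
    ModuleCat.{u} (NT X) ⥤ ModuleCat.{u} (NT X) :=
  ModuleCat.restrictScalars NT.shift

/-! ### The pseudo-circle -/

/-- The four points `1, 2, 3, 4` of the pseudo-circle `𝒮₂¹`. -/
inductive PseudoCircle : Type
  | p1 | p2 | p3 | p4

namespace PseudoCircle

instance : Finite PseudoCircle :=
  Finite.of_surjective (fun n : Fin 4 => ![p1, p2, p3, p4] n)
    fun x => by cases x <;> [exact ⟨0, rfl⟩; exact ⟨1, rfl⟩; exact ⟨2, rfl⟩; exact ⟨3, rfl⟩]

/-- The topology in which `3` and `4` are open points, and `{1, 3, 4}` and `{2, 3, 4}` are the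
smallest open neighbourhoods of `1` and `2`. -/
instance : TopologicalSpace PseudoCircle where
  IsOpen U := (p1 ∈ U ∨ p2 ∈ U) → (p3 ∈ U ∧ p4 ∈ U)
  isOpen_univ := by simp
  isOpen_inter U V hU hV := by
    simp only [Set.mem_inter_iff]
    tauto
  isOpen_sUnion S hS := by
    simp only [Set.mem_sUnion]
    rintro (⟨U, hU, h⟩ | ⟨U, hU, h⟩)
    · exact ⟨⟨U, hU, (hS U hU (Or.inl h)).1⟩, ⟨U, hU, (hS U hU (Or.inl h)).2⟩⟩
    · exact ⟨⟨U, hU, (hS U hU (Or.inr h)).1⟩, ⟨U, hU, (hS U hU (Or.inr h)).2⟩⟩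

/-- The open sets are `∅, {3}, {4}, {3,4}, {1,3,4}, {2,3,4}, {1,2,3,4}`. -/
theorem isOpen_iff (U : Set PseudoCircle) :
    IsOpen U ↔ U = ∅ ∨ U = {p3} ∨ U = {p4} ∨ U = {p3, p4} ∨ U = {p1, p3, p4} ∨
      U = {p2, p3, p4} ∨ U = {p1, p2, p3, p4} := by
  change ((p1 ∈ U ∨ p2 ∈ U) → (p3 ∈ U ∧ p4 ∈ U)) ↔ _
  have key : ∀ V : Set PseudoCircle, U = V ↔
      ((p1 ∈ U ↔ p1 ∈ V) ∧ (p2 ∈ U ↔ p2 ∈ V) ∧ (p3 ∈ U ↔ p3 ∈ V) ∧ (p4 ∈ U ↔ p4 ∈ V)) := by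
    intro V
    refine ⟨by rintro rfl; simp, fun ⟨h1, h2, h3, h4⟩ => ?_⟩
    ext x
    cases x <;> assumption
  simp only [key]
  simp
  tauto

end PseudoCircle

end FilteredK

/-!
The group `Ext² (M, SM)` is computed from an exact sequence `0 → K → Q → M → 0` with a projective
module `Q`: it vanishes as soon as all extensions of `K` by `SM` split
(`subsingleton_ext_two_of_split`). The proof chooses `Q` such that `K` is as good as possible, and
then constructs the splittings by hand.

*The projective cover.* Since even boundary maps vanish on `M`, elements of even degree lift to, or
are sums of elements from, the open sets other than the whole space. Hence `M` is a quotient of a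
direct sum `Q` of representable modules at all objects of odd degree and at these open sets in even
degree (`exists_projective_cover`). Representable modules are described explicitly. Every morphism
of the category is a linear combination of an extension map after a restriction map and of boundary
maps from closed to open points (`mem_normal`), and this normal form is matched with the homology
of a small two-periodic complex of free groups filtered over the space (`repComplex`,
`bijectiveAt`). It follows that representable modules are exact, that they are finitely generated
free as groups, and that the ones in `Q` have vanishing even boundary maps. Therefore `K` is exact
(as the kernel of a surjection of exact modules), it is a subgroup of a free group, and its even
boundary maps vanish.

*The splitting.* Let `p : E → K` be an extension with kernel `SM`. The kernel is exact and its *odd*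
boundary maps vanish, because the suspension shifts degrees. A section of `p` is a family of
additive sections, one at each object, compatible with a generating set of morphisms; a small
generating set suffices (`Essential.mem`). At a single object, a section that is prescribed on the
image of a morphism out of some other object extends, because by exactness the quotient by this
image embeds in `K` and is thus free (`exists_isSectionAt`).

In odd degree (`exists_sectionFamily_one`), extension maps are injective on `K`, as even boundary
maps vanish there, so that the prescribed values are consistent; and restriction maps are
surjective on the kernel, as odd boundary maps vanish there, so that lifts can be corrected to have
prescribed restrictions. The sections of even degree (`exists_sectionFamily_zero`) are prescribed by
those of odd degree on the images of odd boundary maps. They are extended to the open sets, and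
then induced on their closed subsets, where restriction maps are surjective on `K`. Even boundary
maps impose no condition: they vanish on `K`, and a section in even degree takes values in
restrictions of elements at larger sets, on which they vanish in `E` as well
(`IsSplittable.exists_section`).
-/

namespace FilteredK

/-! ### Subgroups of free abelian groups -/

/-- The group `G` is isomorphic to a subgroup of a free abelian group. -/
def EmbedsInFree (G : Type u) [AddCommGroup G] : Prop :=
  ∃ (ι : Type u) (f : G →+ (ι →₀ ℤ)), Function.Injective f

theorem EmbedsInFree.of_injective {G H : Type u} [AddCommGroup G] [AddCommGroup H]
    (h : EmbedsInFree H) (f : G →+ H) (hf : Function.Injective f) : EmbedsInFree G := by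
  obtain ⟨ι, g, hg⟩ := h
  exact ⟨ι, g.comp f, hg.comp hf⟩

/-- Subgroups of free abelian groups are projective. The group `A` is embedded in a divisible group
`D`; as `D / ker p` is again divisible, hence injective, `f` extends to a map from the free group to
`D / ker p`, which lifts to `D`. The restriction of this lift takes its values in `A`. -/
theorem EmbedsInFree.exists_lift {G : Type*} [AddCommGroup G] (h : EmbedsInFree G)
    {A B : Type*} [AddCommGroup A] [AddCommGroup B] (p : A →+ B) (hp : Function.Surjective p)
    (f : G →+ B) : ∃ g : G →+ A, ∀ x, p (g x) = f x := by
  obtain ⟨ι, i, hi⟩ := h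
  let D := CharacterModule A → AddCircle (1 : ℚ)
  let k : A →+ D :=
    { toFun := fun a c => c a
      map_zero' := funext fun c => map_zero c
      map_add' := fun a b => funext fun c => map_add c a b }
  have hk : Function.Injective k := (injective_iff_map_eq_zero k).2 fun a ha =>
    CharacterModule.eq_zero_of_character_apply fun c => congrFun ha c
  let K : AddSubgroup D := p.ker.map k
  let q : D →+ D ⧸ K := QuotientAddGroup.mk' K
  -- The embedding `B = A / ker p → D / K`.
  have hpk : ∀ a, p a = 0 → q (k a) = 0 := fun a ha =>
    (QuotientAddGroup.eq_zero_iff _).2 ⟨a, ha, rfl⟩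
  let kB : B →+ D ⧸ K :=
    { toFun := fun b => q (k (Function.surjInv hp b))
      map_zero' := hpk _ (Function.surjInv_eq hp 0)
      map_add' := fun b c => by
        rw [← map_add, ← map_add, ← sub_eq_zero, ← map_sub, ← map_sub]
        apply hpk
        rw [map_sub, map_add]
        simp only [Function.surjInv_eq hp, sub_self] }
  have hkB : ∀ a, kB (p a) = q (k a) := fun a => by
    change q (k _) = _
    rw [← sub_eq_zero, ← map_sub, ← map_sub]
    apply hpk
    rw [map_sub, Function.surjInv_eq hp, sub_self]
  let _ : DivisibleBy (D ⧸ K) ℤ := Function.Surjective.divisibleBy q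
    (QuotientAddGroup.mk'_surjective K) fun a n => map_zsmul q n a
  obtain ⟨F, hF⟩ := (Module.Baer.of_divisible (D ⧸ K)).extension_property_addMonoidHom i hi
    (kB.comp f)
  obtain ⟨L, hL⟩ := Module.projective_lifting_property q.toIntLinearMap F.toIntLinearMap
    (QuotientAddGroup.mk'_surjective K)
  have key : ∀ x, ∃ a, k a = L (i x) ∧ p a = f x := fun x => by
    obtain ⟨a, ha⟩ := hp (f x)
    have h1 : q (L (i x)) = q (k a) := by
      rw [← hkB, ha]
      exact (LinearMap.congr_fun hL (i x)).trans (DFunLike.congr_fun hF x)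
    rw [← sub_eq_zero, ← map_sub] at h1
    obtain ⟨c, hc, hc'⟩ := (QuotientAddGroup.eq_zero_iff _).1 h1
    refine ⟨a + c, by rw [map_add, hc']; abel, ?_⟩
    rw [map_add, ha, show p c = 0 from hc, add_zero]
  choose g hg hg' using key
  exact ⟨AddMonoidHom.mk' g fun x y => hk (by rw [map_add, hg, hg, hg, map_add, map_add]), hg'⟩

/-- A section of `p` with prescribed values on the image of `f` exists, if the quotient by this
image, which `h` embeds in `H`, is a subgroup of a free group. -/
theorem exists_section_extending {G B P H : Type*} [AddCommGroup G] [AddCommGroup B]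
    [AddCommGroup P] [AddCommGroup H] (p : G →+ B) (hp : Function.Surjective p)
    (f : P →+ B) (f' : P →+ G) (hf : ∀ x, p (f' x) = f x) (hker : ∀ x, f x = 0 → f' x = 0)
    (h : B →+ H) (hfh : Function.Exact f h) (hH : EmbedsInFree H) :
    ∃ s : B →+ G, (∀ b, p (s b) = b) ∧ ∀ x, s (f x) = f' x := by
  have hr : EmbedsInFree h.range :=
    hH.of_injective h.range.subtype Subtype.val_injective
  obtain ⟨t, ht⟩ := hr.exists_lift h.rangeRestrict h.rangeRestrict_surjective
    (AddMonoidHom.id _)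
  obtain ⟨t', ht'⟩ := hr.exists_lift p hp t
  -- `b - t (h b)` lies in the image of `f`.
  have key : ∀ b, ∃ x, f x = b - t (h.rangeRestrict b) := fun b => by
    refine (hfh _).1 ?_
    have := congrArg Subtype.val (ht (h.rangeRestrict b))
    rw [map_sub, sub_eq_zero]
    exact this.symm
  choose c hc using key
  have hf' : ∀ x y, f x = f y → f' x = f' y := fun x y hxy => by
    rw [← sub_eq_zero, ← map_sub]
    exact hker _ (by rw [map_sub, hxy, sub_self])
  refine ⟨AddMonoidHom.mk' (fun b => t' (h.rangeRestrict b) + f' (c b)) fun a b => ?_,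
    fun b => ?_, fun x => ?_⟩
  · have : f' (c (a + b)) = f' (c a + c b) :=
      hf' _ _ (by rw [map_add, hc, hc, hc, map_add, map_add]; abel)
    rw [this, map_add, map_add, map_add]
    abel
  · change p (_ + _) = b
    rw [map_add, ht', hf, hc]
    abel
  · have h0 : h.rangeRestrict (f x) = 0 := Subtype.ext (hfh.apply_apply_eq_zero x)
    change t' (h.rangeRestrict (f x)) + f' (c (f x)) = f' x
    rw [h0, map_zero, zero_add]
    exact hf' _ _ (by rw [hc, h0, map_zero, sub_zero])

/-! ### Vanishing of extension groups -/

section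

variable {R : Type} [Ring R]

/-- If all extensions of `K` by `N` split, then maps to `N` from a submodule of `P` with quotient
`K` extend to `P`: the extension in question is the push-out. -/
theorem exists_extension_of_split {K N P : Type u} [AddCommGroup K] [Module R K]
    [AddCommGroup N] [Module R N] [AddCommGroup P] [Module R P]
    (hsplit : ∀ (E : Type u) [AddCommGroup E] [Module R E] (i : N →ₗ[R] E) (p : E →ₗ[R] K),
      Function.Injective i → Function.Surjective p → Function.Exact i p →
      ∃ s : K →ₗ[R] E, p ∘ₗ s = LinearMap.id)
    (q : P →ₗ[R] K) (hq : Function.Surjective q) (f : LinearMap.ker q →ₗ[R] N) :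
    ∃ g : P →ₗ[R] N, ∀ x : LinearMap.ker q, g x = f x := by
  let j : LinearMap.ker q →ₗ[R] N × P := (-f).prod (LinearMap.ker q).subtype
  let S := LinearMap.range j
  let i : N →ₗ[R] (N × P) ⧸ S := S.mkQ ∘ₗ LinearMap.inl R N P
  let p : ((N × P) ⧸ S) →ₗ[R] K := S.liftQ (q ∘ₗ LinearMap.snd R N P) (by
    rintro _ ⟨x, rfl⟩
    exact x.2)
  have hi : Function.Injective i := by
    rw [← LinearMap.ker_eq_bot, LinearMap.ker_eq_bot']
    intro n hn
    obtain ⟨x, hx⟩ := (Submodule.Quotient.mk_eq_zero _).1 hn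
    obtain ⟨h1, h2⟩ := Prod.ext_iff.1 hx
    have : x = 0 := Subtype.ext h2
    rw [← show (j x).1 = n from h1, this]
    simp
  have hp : Function.Surjective p := fun k => by
    obtain ⟨x, rfl⟩ := hq k
    exact ⟨S.mkQ (0, x), rfl⟩
  have hip : Function.Exact i p := by
    intro y
    constructor
    · obtain ⟨⟨n, x⟩, rfl⟩ := S.mkQ_surjective y
      intro hx
      have hx' : q x = 0 := hx
      refine ⟨n + f ⟨x, hx'⟩, ?_⟩
      rw [← sub_eq_zero]
      change S.mkQ _ - S.mkQ _ = 0
      rw [← map_sub]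
      refine (Submodule.Quotient.mk_eq_zero _).2 ⟨-⟨x, hx'⟩, ?_⟩
      ext <;> simp [j]
    · rintro ⟨n, rfl⟩
      exact map_zero q
  obtain ⟨s, hs⟩ := hsplit _ i p hi hp hip
  -- `x - s (q x)` lies in the image of `N`.
  let r : P →ₗ[R] (N × P) ⧸ S := S.mkQ ∘ₗ LinearMap.inr R N P - s ∘ₗ q
  have hr : ∀ x, ∃ n, i n = r x := fun x => by
    refine (hip _).1 ?_
    change p (S.mkQ (0, x) - s (q x)) = 0
    rw [map_sub, show p (s (q x)) = q x from LinearMap.congr_fun hs (q x)]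
    exact sub_self _
  choose g hg using hr
  refine ⟨{ toFun := g, map_add' := fun x y => hi ?_, map_smul' := fun a x => hi ?_ },
    fun x => hi ?_⟩
  · rw [map_add, hg, hg, hg, map_add]
  · rw [RingHom.id_apply, map_smul, hg, hg, map_smul]
  · change i (g x) = _
    rw [hg]
    change S.mkQ (0, (x : P)) - s (q x) = S.mkQ (f x, 0)
    rw [show q x = 0 from x.2, map_zero, sub_zero, ← sub_eq_zero, ← map_sub]
    refine (Submodule.Quotient.mk_eq_zero _).2 ⟨x, ?_⟩
    ext <;> simp [j]

open Abelian in
theorem ext_one_eq_zero_of_split {K N : ModuleCat.{u} R}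
    (hsplit : ∀ (E : Type u) [AddCommGroup E] [Module R E] (i : N →ₗ[R] E) (p : E →ₗ[R] K),
      Function.Injective i → Function.Surjective p → Function.Exact i p →
      ∃ s : K →ₗ[R] E, p ∘ₗ s = LinearMap.id) (x : Ext K N 1) : x = 0 := by
  let P : ModuleCat.{u} R := ModuleCat.of R (K →₀ R)
  let q : (K →₀ R) →ₗ[R] K := Finsupp.linearCombination R id
  have hq : Function.Surjective q := Finsupp.linearCombination_id_surjective R K
  let S : ShortComplex (ModuleCat.{u} R) :=
    ShortComplex.mk (X₁ := ModuleCat.of R (LinearMap.ker q)) (X₂ := P) (X₃ := K)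
      (ModuleCat.ofHom (LinearMap.ker q).subtype) (ModuleCat.ofHom q) (by
        ext x : 2
        exact x.2)
  have hS : S.ShortExact :=
    { exact := (ShortComplex.ShortExact.moduleCat_exact_iff_function_exact S).2
        (LinearMap.exact_subtype_ker_map q)
      mono_f := (ModuleCat.mono_iff_injective _).2 Subtype.val_injective
      epi_g := (ModuleCat.epi_iff_surjective _).2 hq }
  have : Projective P := ModuleCat.projective_of_free (Finsupp.basisSingleOne)
  obtain ⟨y, hy⟩ := Ext.contravariant_sequence_exact₃ hS N x
    (Ext.eq_zero_of_projective (P := P) (n := 0) _) (n₀ := 0) rfl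
  obtain ⟨f, rfl⟩ := (Ext.mk₀_bijective _ _).2 y
  obtain ⟨g, hg⟩ := exists_extension_of_split hsplit q hq f.hom
  have hfg : f = S.f ≫ ModuleCat.ofHom (X := P) g := by
    ext x : 2
    exact (hg x).symm
  rw [← hy, hfg, ← Ext.mk₀_comp_mk₀]
  exact hS.extClass_comp_assoc _

open Abelian in
/-- If `M` is a quotient of a projective module, such that all extensions of the kernel by `N`
split, then `Ext² (M, N)` vanishes. -/
theorem subsingleton_ext_two_of_split {M N : ModuleCat.{u} R} {Q : Type u} [AddCommGroup Q]
    [Module R Q] [Module.Projective R Q] (q : Q →ₗ[R] M) (hq : Function.Surjective q)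
    (hsplit : ∀ (E : Type u) [AddCommGroup E] [Module R E] (i : N →ₗ[R] E)
      (p : E →ₗ[R] LinearMap.ker q),
      Function.Injective i → Function.Surjective p → Function.Exact i p →
      ∃ s : LinearMap.ker q →ₗ[R] E, p ∘ₗ s = LinearMap.id) : Subsingleton (Ext M N 2) := by
  let S : ShortComplex (ModuleCat.{u} R) :=
    ShortComplex.mk (X₁ := ModuleCat.of R (LinearMap.ker q)) (X₂ := ModuleCat.of R Q) (X₃ := M)
      (ModuleCat.ofHom (LinearMap.ker q).subtype) (ModuleCat.ofHom q) (by
        ext x : 2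
        exact x.2)
  have hS : S.ShortExact :=
    { exact := (ShortComplex.ShortExact.moduleCat_exact_iff_function_exact S).2
        (LinearMap.exact_subtype_ker_map q)
      mono_f := (ModuleCat.mono_iff_injective _).2 Subtype.val_injective
      epi_g := (ModuleCat.epi_iff_surjective _).2 hq }
  have : Projective (ModuleCat.of R Q) := (IsProjective.iff_projective _).1 inferInstance
  refine subsingleton_of_forall_eq 0 fun x => ?_
  obtain ⟨y, hy⟩ := Ext.contravariant_sequence_exact₃ hS N x
    (Ext.eq_zero_of_projective (P := ModuleCat.of R Q) (n := 1) _) (n₀ := 1) rfl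
  rw [← hy, ext_one_eq_zero_of_split (K := ModuleCat.of R (LinearMap.ker q)) hsplit y,
    Ext.comp_zero]

end

/-! ### Relations in the category ring -/

section

variable {X : Type} [TopologicalSpace X]

theorem IsOpenIn.refl (Y : LC X) : IsOpenIn Y Y := ⟨Set.univ, isOpen_univ, by simp⟩

theorem IsClosedIn.refl (Y : LC X) : IsClosedIn Y Y := ⟨Set.univ, isClosed_univ, by simp⟩

/-- The empty set as a locally closed subset. -/
def emptyLC (X : Type) [TopologicalSpace X] : LC X :=
  ⟨∅, isOpen_empty.isLocallyClosed⟩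

theorem isOpenIn_empty (Y : LC X) : IsOpenIn (emptyLC X) Y := ⟨∅, isOpen_empty, by simp [emptyLC]⟩

theorem isClosedIn_empty (Y : LC X) : IsClosedIn (emptyLC X) Y :=
  ⟨∅, isClosed_empty, by simp [emptyLC]⟩

end

namespace NT

variable {X : Type} [TopologicalSpace X] [Finite X]

theorem e_mul_self (a : Obj X) : e a * e a = e a := by
  simpa [e] using mk_rel (Rel.e_mul_self a)

theorem e_mul_e {a b : Obj X} (h : a ≠ b) : e a * e b = 0 := by
  simpa [e] using mk_rel (Rel.e_mul_e a b h)

theorem sum_e : ∑ a : Obj X, e a = 1 := by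
  simpa [e] using mk_rel (Rel.sum_e (X := X))

theorem mul_source {a b : Obj X} (g : Gen a b) : of g * e a = of g := by
  simpa [e, of] using mk_rel (Rel.mul_source g)

theorem i_self {Y : LC X} (h : IsOpenIn Y Y) (j : ZMod 2) : of (Gen.i h j) = e (Y, j) :=
  mk_rel (Rel.i_self Y h j)

theorem r_self {Y : LC X} (h : IsClosedIn Y Y) (j : ZMod 2) : of (Gen.r h j) = e (Y, j) :=
  mk_rel (Rel.r_self Y h j)

theorem i_comp {U V Y : LC X} (hUV : IsOpenIn U V) (hVY : IsOpenIn V Y) (hUY : IsOpenIn U Y)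
    (j : ZMod 2) : of (Gen.i hVY j) * of (Gen.i hUV j) = of (Gen.i hUY j) := by
  simpa [of, Free.i] using mk_rel (Rel.i_comp hUV hVY hUY j)

theorem r_comp {Y C D : LC X} (hYC : IsClosedIn C Y) (hCD : IsClosedIn D C)
    (hYD : IsClosedIn D Y) (j : ZMod 2) :
    of (Gen.r hCD j) * of (Gen.r hYC j) = of (Gen.r hYD j) := by
  simpa [of, Free.r] using mk_rel (Rel.r_comp hYC hCD hYD j)

theorem r_i {U Y C W : LC X} (hU : IsOpenIn U Y) (hC : IsClosedIn C Y) (hW : W.1 = U.1 ∩ C.1)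
    (hWC : IsOpenIn W C) (hWU : IsClosedIn W U) (j : ZMod 2) :
    of (Gen.r hC j) * of (Gen.i hU j) = of (Gen.i hWC j) * of (Gen.r hWU j) := by
  simpa [of, Free.r, Free.i] using mk_rel (Rel.r_i hU hC hW hWC hWU j)

theorem disjoint_union {U V Y : LC X} (hd : Disjoint U.1 V.1) (hY : Y.1 = U.1 ∪ V.1)
    (hU : IsOpenIn U Y) (hU' : IsClosedIn U Y) (hV : IsOpenIn V Y) (hV' : IsClosedIn V Y)
    (j : ZMod 2) :
    of (Gen.i hU j) * of (Gen.r hU' j) + of (Gen.i hV j) * of (Gen.r hV' j) = e (Y, j) := by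
  simpa [of, e, Free.r, Free.i] using mk_rel (Rel.disjoint_union hd hY hU hU' hV hV' j)

theorem δ_i {C D U : LC X} (hCU : IsBoundaryPair C U) (hDC : IsOpenIn D C)
    (hDU : IsBoundaryPair D U) (j : ZMod 2) :
    of (Gen.δ hCU j) * of (Gen.i hDC j) = of (Gen.δ hDU j) := by
  simpa [of, Free.δ, Free.i] using mk_rel (Rel.δ_i hCU hDC hDU j)

theorem r_δ {C U W : LC X} (hCU : IsBoundaryPair C U) (hWU : IsClosedIn W U)
    (hCW : IsBoundaryPair C W) (j : ZMod 2) :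
    of (Gen.r hWU (j + 1)) * of (Gen.δ hCU j) = of (Gen.δ hCW j) := by
  simpa [of, Free.δ, Free.r] using mk_rel (Rel.r_δ hCU hWU hCW j)

theorem i_δ {U V Y C D : LC X} (hU : IsExtension U Y C) (hV : IsExtension V Y D)
    (hUV : IsOpenIn U V) (hDC : IsClosedIn D C) (j : ZMod 2) :
    of (Gen.i hUV (j + 1)) * of (Gen.δ hU.isBoundaryPair j) =
      of (Gen.δ hV.isBoundaryPair j) * of (Gen.r hDC j) := by
  simpa [of, Free.δ, Free.i, Free.r] using mk_rel (Rel.i_δ hU hV hUV hDC j)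

/-- The empty set is a zero object: it is the disjoint union of itself with itself. -/
theorem e_eq_zero {Y : LC X} (hY : Y.1 = ∅) (j : ZMod 2) : e (Y, j) = 0 := by
  have ho : IsOpenIn Y Y := ⟨Set.univ, isOpen_univ, by simp⟩
  have hc : IsClosedIn Y Y := ⟨Set.univ, isClosed_univ, by simp⟩
  have := disjoint_union (U := Y) (V := Y) (Y := Y) (by simp [hY]) (by simp) ho hc ho hc j
  rwa [i_self, r_self, e_mul_self, add_eq_left] at this

theorem of_eq_zero_of_source {a b : Obj X} (g : Gen a b) (h : e a = 0) : of g = 0 := by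
  rw [← mul_source, h, mul_zero]

theorem of_eq_zero_of_target {a b : Obj X} (g : Gen a b) (h : e b = 0) : of g = 0 := by
  rw [← target_mul, h, zero_mul]

theorem r_mul_i {U Y C : LC X} (h : IsExtension U Y C) (j : ZMod 2) :
    of (Gen.r h.isClosedIn j) * of (Gen.i h.1 j) = 0 := by
  rw [r_i h.1 h.isClosedIn (W := emptyLC X) (by simp [h.2, emptyLC])
    (isOpenIn_empty C) (isClosedIn_empty U), of_eq_zero_of_source _ (e_eq_zero rfl j), zero_mul]

theorem δ_mul_r {U Y C : LC X} (h : IsExtension U Y C) (j : ZMod 2) :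
    of (Gen.δ h.isBoundaryPair j) * of (Gen.r h.isClosedIn j) = 0 := by
  have h0 : IsExtension (emptyLC X) Y Y := ⟨isOpenIn_empty Y, by simp [emptyLC]⟩
  rw [← i_δ h0 h (isOpenIn_empty U), of_eq_zero_of_source _ (e_eq_zero rfl _), zero_mul]

theorem i_mul_δ {U Y C : LC X} (h : IsExtension U Y C) (j : ZMod 2) :
    of (Gen.i h.1 (j + 1)) * of (Gen.δ h.isBoundaryPair j) = 0 := by
  have h0 : IsExtension Y Y (emptyLC X) := ⟨IsOpenIn.refl Y, by simp [emptyLC]⟩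
  rw [i_δ h h0 h.1 (isClosedIn_empty C), of_eq_zero_of_source _ (e_eq_zero rfl _), zero_mul]

/-- The ring is generated by the idempotents of the objects and the generating morphisms. -/
theorem induction {S : Subring (NT X)} (he : ∀ a, e a ∈ S)
    (hof : ∀ {a b : Obj X} (g : Gen a b), of g ∈ S) (x : NT X) : x ∈ S := by
  obtain ⟨y, rfl⟩ := RingQuot.mkRingHom_surjective _ x
  change mk y ∈ S
  induction y using FreeAlgebra.induction with
  | grade0 n => simp [intCast_mem S n]
  | grade1 l =>
    cases l with
    | e a => exact he a
    | of g => exact hof g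
  | mul x y hx hy => rw [map_mul]; exact S.mul_mem hx hy
  | add x y hx hy => rw [map_add]; exact S.add_mem hx hy

end NT

section modules

variable {X : Type} [TopologicalSpace X] [Finite X]
variable (M : Type u) [AddCommGroup M] [Module (NT X) M]

theorem e_smul_mem_comp (a : Obj X) (m : M) : NT.e a • m ∈ comp M a := by
  change NT.e a • NT.e a • m = _
  rw [← mul_smul, NT.e_mul_self]

variable {M}

theorem coe_act {a b : Obj X} (g : Gen a b) (m : comp M a) :
    (act M g m : M) = NT.of g • (m : M) := rfl

theorem sum_e_smul (m : M) : ∑ a : Obj X, NT.e a • m = m := by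
  rw [← Finset.sum_smul, NT.sum_e, one_smul]

end modules

/-! ### Modules from filtered complexes -/

/-- A two-periodic complex of free abelian groups over the space `X`: the basis `I` of the group
is graded by `deg` and decomposed over the points of `X` by `pos`, and the differential maps the
part over an open subset to itself. Chains are arbitrary functions on `I`; the basis will be
finite. -/
structure FilteredComplex (X : Type) [TopologicalSpace X] where
  I : Type
  pos : I → X
  deg : I → ZMod 2
  d : (I → ℤ) →+ (I → ℤ)
  d_d : ∀ g, d (d g) = 0
  d_supp : ∀ (O : Set X) (_ : IsOpen O) (j : ZMod 2) (g : I → ℤ),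
    (∀ i, ¬(pos i ∈ O ∧ deg i = j) → g i = 0) →
      ∀ i, ¬(pos i ∈ O ∧ deg i = j + 1) → d g i = 0

theorem add_one_add_one (j : ZMod 2) : j + 1 + 1 = j := by revert j; decide

namespace FilteredComplex

section

variable {X : Type} [TopologicalSpace X] (A : FilteredComplex X)

/-- The chains of degree `j` over the subset `S`. -/
def Supp (S : Set X) (j : ZMod 2) : AddSubgroup (A.I → ℤ) where
  carrier := {g | ∀ i, ¬(A.pos i ∈ S ∧ A.deg i = j) → g i = 0}
  zero_mem' _ _ := rfl
  add_mem' hx hy i hi := by simp [hx i hi, hy i hi]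
  neg_mem' hx i hi := by simp [hx i hi]

open Classical in
/-- The projection to the part over the subset `S`. -/
noncomputable def π (S : Set X) : (A.I → ℤ) →+ (A.I → ℤ) where
  toFun g i := if A.pos i ∈ S then g i else 0
  map_zero' := by ext; simp
  map_add' x y := by ext i; by_cases h : A.pos i ∈ S <;> simp [h]

theorem π_of_mem {S : Set X} {g : A.I → ℤ} {i : A.I} (h : A.pos i ∈ S) : A.π S g i = g i :=
  if_pos h

theorem π_of_notMem {S : Set X} {g : A.I → ℤ} {i : A.I} (h : A.pos i ∉ S) : A.π S g i = 0 :=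
  if_neg h

variable {A}

theorem supp_mono {S S' : Set X} (h : S ⊆ S') {j : ZMod 2} {g : A.I → ℤ}
    (hg : g ∈ A.Supp S j) : g ∈ A.Supp S' j :=
  fun i hi => hg i fun hi' => hi ⟨h hi'.1, hi'.2⟩

theorem π_mem_supp {S S' : Set X} {j : ZMod 2} {g : A.I → ℤ} (hg : g ∈ A.Supp S j) :
    A.π S' g ∈ A.Supp (S ∩ S') j := fun i hi => by
  by_cases h : A.pos i ∈ S'
  · rw [A.π_of_mem h]
    exact hg i fun hi' => hi ⟨⟨hi'.1, h⟩, hi'.2⟩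
  · exact A.π_of_notMem h

theorem π_mem_supp_univ {S' : Set X} {j : ZMod 2} {g : A.I → ℤ} (hg : g ∈ A.Supp Set.univ j) :
    A.π S' g ∈ A.Supp S' j := by
  simpa using π_mem_supp (S' := S') hg

theorem supp_univ {S : Set X} {j : ZMod 2} {g : A.I → ℤ}
    (hg : g ∈ A.Supp S j) : g ∈ A.Supp Set.univ j := supp_mono (Set.subset_univ S) hg

theorem π_eq_self {S S' : Set X} (h : S ⊆ S') {j : ZMod 2} {g : A.I → ℤ}
    (hg : g ∈ A.Supp S j) : A.π S' g = g := by
  ext i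
  by_cases hi : A.pos i ∈ S'
  · exact A.π_of_mem hi
  · rw [A.π_of_notMem hi, hg i fun hi' => hi (h hi'.1)]

theorem π_eq_zero {S S' : Set X} (h : Disjoint S S') {j : ZMod 2} {g : A.I → ℤ}
    (hg : g ∈ A.Supp S j) : A.π S' g = 0 := by
  ext i
  by_cases hi : A.pos i ∈ S'
  · rw [A.π_of_mem hi, hg i fun hi' => Set.disjoint_left.1 h hi'.1 hi, Pi.zero_apply]
  · exact A.π_of_notMem hi

theorem π_π (S S' : Set X) (g : A.I → ℤ) : A.π S (A.π S' g) = A.π (S' ∩ S) g := by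
  ext i
  by_cases h : A.pos i ∈ S
  · by_cases h' : A.pos i ∈ S'
    · rw [A.π_of_mem h, A.π_of_mem h', A.π_of_mem (show A.pos i ∈ S' ∩ S from ⟨h', h⟩)]
    · rw [A.π_of_mem h, A.π_of_notMem h', A.π_of_notMem fun hi => h' hi.1]
  · rw [A.π_of_notMem h, A.π_of_notMem fun hi => h hi.2]

theorem π_union {S S' : Set X} (h : Disjoint S S') (g : A.I → ℤ) :
    A.π (S ∪ S') g = A.π S g + A.π S' g := by
  ext i
  rw [Pi.add_apply]
  by_cases hi : A.pos i ∈ S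
  · rw [A.π_of_mem hi, A.π_of_mem (Or.inl hi), A.π_of_notMem (Set.disjoint_left.1 h hi), add_zero]
  · by_cases hi' : A.pos i ∈ S'
    · rw [A.π_of_mem hi', A.π_of_mem (Or.inr hi'), A.π_of_notMem hi, zero_add]
    · rw [A.π_of_notMem hi, A.π_of_notMem hi', A.π_of_notMem fun hi'' => hi''.elim hi hi',
        add_zero]

theorem d_mem_supp {O : Set X} (hO : IsOpen O) {j : ZMod 2} {g : A.I → ℤ}
    (hg : g ∈ A.Supp O j) : A.d g ∈ A.Supp O (j + 1) := A.d_supp O hO j g hg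

theorem πd_mem_supp {S S' : Set X} {j : ZMod 2} {g : A.I → ℤ} (hg : g ∈ A.Supp S j) :
    A.π S' (A.d g) ∈ A.Supp S' (j + 1) :=
  π_mem_supp_univ (d_mem_supp isOpen_univ (supp_univ hg))

/-- The restriction to a relatively closed subset is a chain map. -/
theorem π_d_π {C Y : LC X} (h : IsClosedIn C Y) {j : ZMod 2} {g : A.I → ℤ}
    (hg : g ∈ A.Supp Y.1 j) : A.π C.1 (A.d (A.π C.1 g)) = A.π C.1 (A.d g) := by
  obtain ⟨F, hF, hC⟩ := h
  have h1 : g - A.π C.1 g ∈ A.Supp Fᶜ j := fun i hi => by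
    rw [Pi.sub_apply]
    by_cases h : A.pos i ∈ C.1
    · rw [A.π_of_mem h, sub_self]
    · rw [A.π_of_notMem h, sub_zero]
      refine hg i fun hi' => hi ⟨fun hF' => h ?_, hi'.2⟩
      rw [hC]
      exact ⟨hF', hi'.1⟩
  have h2 := π_eq_zero (S' := C.1) (by
    rw [hC]
    exact Set.disjoint_left.2 fun x hx hx' => hx hx'.1) (d_mem_supp hF.isOpen_compl h1)
  rw [map_sub, map_sub, sub_eq_zero] at h2
  exact h2.symm

/-- The inclusion of a relatively open subset is a chain map. -/
theorem π_d_of_isOpenIn {U Y : LC X} (h : IsOpenIn U Y) {j : ZMod 2} {g : A.I → ℤ}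
    (hg : g ∈ A.Supp U.1 j) : A.π Y.1 (A.d g) = A.π U.1 (A.d g) := by
  obtain ⟨O, hO, hU⟩ := h
  have h1 := d_mem_supp hO (supp_mono (by rw [hU]; exact Set.inter_subset_left) hg)
  conv_lhs => rw [← π_eq_self subset_rfl h1, π_π, ← hU]

/-- The differential squares to zero over every locally closed subset. -/
theorem π_d_π_d {Y : LC X} {j : ZMod 2} {g : A.I → ℤ} (hg : g ∈ A.Supp Y.1 j) :
    A.π Y.1 (A.d (A.π Y.1 (A.d g))) = 0 := by
  obtain ⟨O, F, hO, hF, hY⟩ := Y.2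
  let Y' : LC X := ⟨O, hO.isLocallyClosed⟩
  have h1 : IsClosedIn Y Y' := ⟨F, hF, by rw [hY, Set.inter_comm]⟩
  rw [π_d_π h1 (d_mem_supp hO (supp_mono (by rw [hY]; exact Set.inter_subset_left) hg)), A.d_d,
    map_zero]

variable (A)

/-- Cycles of degree `j` over `Y`, for the object `Y_j`. -/
noncomputable def Cycle (a : Obj X) : AddSubgroup (A.I → ℤ) where
  carrier := {g | g ∈ A.Supp a.1.1 a.2 ∧ A.π a.1.1 (A.d g) = 0}
  zero_mem' := ⟨zero_mem _, by simp⟩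
  add_mem' hx hy := ⟨add_mem hx.1 hy.1, by rw [map_add, map_add, hx.2, hy.2, add_zero]⟩
  neg_mem' hx := ⟨neg_mem hx.1, by rw [map_neg, map_neg, hx.2, neg_zero]⟩

/-- Boundaries of degree `j` over `Y`, for the object `Y_j`. -/
noncomputable def Bdry (a : Obj X) : AddSubgroup (A.I → ℤ) :=
  (A.Supp a.1.1 (a.2 + 1)).map ((A.π a.1.1).comp A.d)

/-- The chain map inducing the action of a generating morphism. -/
noncomputable def φ : {a b : Obj X} → Gen a b → (A.I → ℤ) →+ (A.I → ℤ)
  | _, _, .i _ _ => AddMonoidHom.id _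
  | _, _, .r (C := C) _ _ => A.π C.1
  | _, _, .δ (U := U) _ _ => (A.π U.1).comp A.d

variable {A}

theorem bdry_le_cycle (a : Obj X) : A.Bdry a ≤ A.Cycle a := by
  rintro _ ⟨h, hh, rfl⟩
  refine ⟨?_, π_d_π_d hh⟩
  have := πd_mem_supp (S' := a.1.1) hh
  rwa [add_one_add_one] at this

theorem πd_eq_add {U Y C : LC X} (h : IsExtension U Y C) (g : A.I → ℤ) :
    A.π Y.1 g = A.π U.1 g + A.π C.1 g := by
  obtain ⟨⟨O, -, hU⟩, hC⟩ := h
  have h1 : Y.1 = U.1 ∪ C.1 := by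
    rw [hC, Set.union_sdiff_cancel]
    rw [hU]
    exact Set.inter_subset_right
  rw [h1, π_union]
  rw [hC]
  exact Set.disjoint_sdiff_right

theorem _root_.FilteredK.IsOpenIn.subset {U Y : LC X} (h : IsOpenIn U Y) : U.1 ⊆ Y.1 := by
  obtain ⟨O, -, hU⟩ := h
  rw [hU]
  exact Set.inter_subset_right

theorem _root_.FilteredK.IsClosedIn.subset {U Y : LC X} (h : IsClosedIn U Y) : U.1 ⊆ Y.1 := by
  obtain ⟨O, -, hU⟩ := h
  rw [hU]
  exact Set.inter_subset_right

theorem _root_.FilteredK.IsExtension.subset {U Y C : LC X} (h : IsExtension U Y C) :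
    C.1 ⊆ Y.1 := h.isClosedIn.subset

theorem _root_.FilteredK.IsExtension.disjoint {U Y C : LC X} (h : IsExtension U Y C) :
    Disjoint U.1 C.1 := by
  rw [h.2]
  exact Set.disjoint_sdiff_right

/-- The identity `d² = 0` over `Y`, with the middle term decomposed over `U` and `C`. -/
theorem π_d_π_d_add {U Y C : LC X} (h : IsExtension U Y C) {j : ZMod 2} {g : A.I → ℤ}
    (hg : g ∈ A.Supp Y.1 j) :
    A.π U.1 (A.d (A.π U.1 (A.d g))) + A.π U.1 (A.d (A.π C.1 (A.d g))) = 0 := by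
  have h1 := congrArg (A.π U.1) (π_d_π_d hg)
  rw [πd_eq_add h (A.d g), map_add, map_add, map_add, π_π, π_π, map_zero,
    Set.inter_eq_right.2 h.1.subset] at h1
  exact h1

theorem φ_mem_cycle {a b : Obj X} (g : Gen a b) {x : A.I → ℤ} (hx : x ∈ A.Cycle a) :
    A.φ g x ∈ A.Cycle b := by
  cases g with
  | i h j =>
    refine ⟨supp_mono h.subset hx.1, ?_⟩
    exact (π_d_of_isOpenIn h hx.1).trans hx.2
  | r h j =>
    refine ⟨π_mem_supp_univ (supp_univ hx.1), ?_⟩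
    refine (π_d_π h hx.1).trans ?_
    conv_lhs => rw [← Set.inter_eq_right.2 h.subset, ← π_π]
    rw [show A.π _ (A.d x) = 0 from hx.2, map_zero]
  | @δ C U hb j =>
    obtain ⟨Y, hY⟩ := hb
    refine ⟨πd_mem_supp hx.1, ?_⟩
    have h1 := π_d_π_d_add hY (supp_mono hY.subset hx.1)
    rwa [show A.π C.1 (A.d x) = 0 from hx.2, map_zero, map_zero, add_zero] at h1

theorem φ_mem_bdry {a b : Obj X} (g : Gen a b) {x : A.I → ℤ} (hx : x ∈ A.Bdry a) :
    A.φ g x ∈ A.Bdry b := by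
  obtain ⟨y, hy, rfl⟩ := hx
  cases g with
  | i h j => exact ⟨y, supp_mono h.subset hy, π_d_of_isOpenIn h hy⟩
  | r h j =>
    refine ⟨A.π _ y, π_mem_supp_univ (supp_univ hy), ?_⟩
    refine (π_d_π h hy).trans ?_
    change _ = A.π _ (A.π _ _)
    rw [π_π, Set.inter_eq_right.2 h.subset]
  | @δ C U hb j =>
    obtain ⟨Y, hY⟩ := hb
    have h1 := π_d_π_d_add hY (supp_mono hY.subset hy)
    refine ⟨-A.π U.1 (A.d y), neg_mem (πd_mem_supp hy), ?_⟩
    change A.π U.1 (A.d _) = A.π U.1 (A.d _)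
    rw [map_neg, map_neg, neg_eq_iff_add_eq_zero]
    exact h1

theorem supp_of_π_eq_zero {U Y C : LC X} (h : IsExtension U Y C) {j : ZMod 2} {g : A.I → ℤ}
    (hg : g ∈ A.Supp Y.1 j) (h0 : A.π C.1 g = 0) : g ∈ A.Supp U.1 j := by
  have h1 := πd_eq_add h g
  rw [π_eq_self subset_rfl hg, h0, add_zero] at h1
  rw [h1]
  exact π_mem_supp_univ (supp_univ hg)

theorem exact_i_r {U Y C : LC X} (h : IsExtension U Y C) {j : ZMod 2} {x : A.I → ℤ}
    (hx : x ∈ A.Cycle (Y, j)) (h0 : A.π C.1 x ∈ A.Bdry (C, j)) :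
    ∃ y ∈ A.Cycle (U, j), x - y ∈ A.Bdry (Y, j) := by
  obtain ⟨z, hz, hzx⟩ := h0
  have hz' : z ∈ A.Supp Y.1 (j + 1) := supp_mono h.subset hz
  have hb : A.π Y.1 (A.d z) ∈ A.Bdry (Y, j) := ⟨z, hz', rfl⟩
  have hy := sub_mem hx (bdry_le_cycle _ hb)
  have hyU : x - A.π Y.1 (A.d z) ∈ A.Supp U.1 j := by
    refine supp_of_π_eq_zero h hy.1 ?_
    rw [map_sub, π_π, Set.inter_eq_right.2 h.subset, sub_eq_zero]
    exact hzx.symm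
  refine ⟨_, ⟨hyU, ?_⟩, by rwa [sub_sub_cancel]⟩
  exact (π_d_of_isOpenIn h.1 hyU).symm.trans hy.2

theorem exact_r_δ {U Y C : LC X} (h : IsExtension U Y C) {j : ZMod 2} {x : A.I → ℤ}
    (hx : x ∈ A.Cycle (C, j)) (h0 : A.π U.1 (A.d x) ∈ A.Bdry (U, j + 1)) :
    ∃ y ∈ A.Cycle (Y, j), A.π C.1 y = x := by
  obtain ⟨z, hz, hzx⟩ := h0
  have hz' : z ∈ A.Supp U.1 j := by
    have := hz
    rwa [add_one_add_one] at this
  refine ⟨x - z, ⟨sub_mem (supp_mono h.subset hx.1) (supp_mono h.1.subset hz'), ?_⟩, ?_⟩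
  · change A.π Y.1 _ = 0
    rw [map_sub, map_sub, π_d_of_isOpenIn h.1 hz', πd_eq_add h (A.d x),
      show A.π C.1 (A.d x) = 0 from hx.2, add_zero, sub_eq_zero]
    exact hzx.symm
  · rw [map_sub, π_eq_zero h.disjoint hz', sub_zero]
    exact π_eq_self subset_rfl hx.1

theorem exact_δ_i {U Y C : LC X} (h : IsExtension U Y C) {j : ZMod 2} {x : A.I → ℤ}
    (hx : x ∈ A.Cycle (U, j + 1)) (h0 : x ∈ A.Bdry (Y, j + 1)) :
    ∃ y ∈ A.Cycle (C, j), x - A.π U.1 (A.d y) ∈ A.Bdry (U, j + 1) := by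
  obtain ⟨z, hz, hzx⟩ := h0
  have hz' : z ∈ A.Supp Y.1 j := by
    have := hz
    rwa [add_one_add_one] at this
  have hzx' : A.π Y.1 (A.d z) = x := hzx
  have h1 : A.π C.1 (A.d z) = 0 := by
    rw [← Set.inter_eq_right.2 h.subset, ← π_π, hzx', π_eq_zero h.disjoint hx.1]
  have h2 : A.π U.1 (A.d z) = x := by
    rw [← hzx', πd_eq_add h, h1, add_zero]
  refine ⟨A.π C.1 z, ⟨π_mem_supp_univ (supp_univ hz'), ?_⟩,
    ⟨A.π U.1 z, π_mem_supp_univ (supp_univ hz), ?_⟩⟩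
  · exact (π_d_π h.isClosedIn hz').trans h1
  · change A.π U.1 (A.d _) = _
    rw [eq_sub_iff_add_eq, ← map_add, ← map_add, ← πd_eq_add h, π_eq_self subset_rfl hz', h2]

end

end FilteredComplex

/-! ### The homology module of a filtered complex -/

namespace FilteredComplex

section

variable {X : Type} [TopologicalSpace X] (A : FilteredComplex X)

/-- Families of cycles, one for each object. -/
noncomputable def cycles : AddSubgroup (Obj X → A.I → ℤ) := AddSubgroup.pi Set.univ A.Cycle

/-- Families of boundaries, one for each object. -/
noncomputable def boundaries : AddSubgroup (Obj X → A.I → ℤ) := AddSubgroup.pi Set.univ A.Bdry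

variable {A}

theorem mem_cycles {t : Obj X → A.I → ℤ} : t ∈ A.cycles ↔ ∀ a, t a ∈ A.Cycle a := by
  simp [cycles, AddSubgroup.mem_pi]

theorem mem_boundaries {t : Obj X → A.I → ℤ} : t ∈ A.boundaries ↔ ∀ a, t a ∈ A.Bdry a := by
  simp [boundaries, AddSubgroup.mem_pi]

variable (A)

/-- The homology groups of `A` over all locally closed subsets, `⨁ H_j(A(Y))`, as a subquotient of
the group of families of chains. -/
def Homology : Type := A.cycles ⧸ A.boundaries.addSubgroupOf A.cycles

noncomputable instance : AddCommGroup A.Homology :=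
  inferInstanceAs (AddCommGroup (A.cycles ⧸ A.boundaries.addSubgroupOf A.cycles))

/-- The homology class of a family of cycles. -/
noncomputable def homologyClass : A.cycles →+ A.Homology :=
  QuotientAddGroup.mk' (A.boundaries.addSubgroupOf A.cycles)

theorem homologyClass_surjective : Function.Surjective A.homologyClass :=
  QuotientAddGroup.mk'_surjective _

theorem homologyClass_eq_zero {t : A.cycles} :
    A.homologyClass t = 0 ↔ (t : Obj X → A.I → ℤ) ∈ A.boundaries :=
  (QuotientAddGroup.eq_zero_iff _).trans AddSubgroup.mem_addSubgroupOf

theorem homologyClass_eq {t t' : A.cycles} :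
    A.homologyClass t = A.homologyClass t' ↔ (t - t' : Obj X → A.I → ℤ) ∈ A.boundaries := by
  rw [← sub_eq_zero, ← map_sub, homologyClass_eq_zero, AddSubgroup.coe_sub]

open Classical in
/-- The action of a letter on families of chains. -/
noncomputable def letterAct : Letter X → (Obj X → A.I → ℤ) →+ (Obj X → A.I → ℤ)
  | .e a => (AddMonoidHom.single _ a).comp (Pi.evalAddMonoidHom _ a)
  | .of (a := a) (b := b) g =>
    (AddMonoidHom.single _ b).comp ((A.φ g).comp (Pi.evalAddMonoidHom _ a))

variable {A}

open Classical in
theorem letterAct_e (a : Obj X) (t : Obj X → A.I → ℤ) :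
    A.letterAct (.e a) t = Pi.single a (t a) := rfl

open Classical in
theorem letterAct_of {a b : Obj X} (g : Gen a b) (t : Obj X → A.I → ℤ) :
    A.letterAct (.of g) t = Pi.single b (A.φ g (t a)) := rfl

open Classical in
theorem single_mem_cycles {a : Obj X} {x : A.I → ℤ} (hx : x ∈ A.Cycle a) :
    (Pi.single a x : Obj X → A.I → ℤ) ∈ A.cycles := by
  rw [mem_cycles]
  intro b
  by_cases h : b = a
  · subst h
    rwa [Pi.single_eq_same]
  · rw [Pi.single_eq_of_ne h]
    exact zero_mem _

open Classical in
theorem single_mem_boundaries {a : Obj X} {x : A.I → ℤ} :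
    (Pi.single a x : Obj X → A.I → ℤ) ∈ A.boundaries ↔ x ∈ A.Bdry a := by
  rw [mem_boundaries]
  refine ⟨fun h => by simpa using h a, fun hx b => ?_⟩
  by_cases h : b = a
  · subst h
    rwa [Pi.single_eq_same]
  · rw [Pi.single_eq_of_ne h]
    exact zero_mem _

theorem letterAct_mem_cycles (l : Letter X) {t : Obj X → A.I → ℤ} (ht : t ∈ A.cycles) :
    A.letterAct l t ∈ A.cycles := by
  cases l with
  | e a => exact single_mem_cycles (mem_cycles.1 ht a)
  | of g => exact single_mem_cycles (φ_mem_cycle g (mem_cycles.1 ht _))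

theorem letterAct_mem_boundaries (l : Letter X) {t : Obj X → A.I → ℤ}
    (ht : t ∈ A.boundaries) : A.letterAct l t ∈ A.boundaries := by
  cases l with
  | e a => exact single_mem_boundaries.2 (mem_boundaries.1 ht a)
  | of g => exact single_mem_boundaries.2 (φ_mem_bdry g (mem_boundaries.1 ht _))

variable (A)

/-- The action of a letter on families of cycles. -/
noncomputable def letterActCycles (l : Letter X) : A.cycles →+ A.cycles :=
  ((A.letterAct l).comp A.cycles.subtype).codRestrict A.cycles
    fun t => letterAct_mem_cycles l t.2

/-- The action of a letter on homology. -/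
noncomputable def letterEnd (l : Letter X) : AddMonoid.End A.Homology :=
  QuotientAddGroup.map _ _ (A.letterActCycles l) fun _ ht => letterAct_mem_boundaries l ht

theorem coe_letterActCycles (l : Letter X) (t : A.cycles) :
    (A.letterActCycles l t : Obj X → A.I → ℤ) = A.letterAct l t := rfl

/-- The action of the free ring on homology. -/
noncomputable def freeEnd : Free X →ₐ[ℤ] AddMonoid.End A.Homology :=
  FreeAlgebra.lift ℤ A.letterEnd

theorem freeEnd_e (a : Obj X) : A.freeEnd (Free.e a) = A.letterEnd (.e a) :=
  FreeAlgebra.lift_ι_apply _ _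

theorem freeEnd_of {a b : Obj X} (g : Gen a b) :
    A.freeEnd (Free.of g) = A.letterEnd (.of g) :=
  FreeAlgebra.lift_ι_apply _ _

variable {A}

theorem end_ext {f g : AddMonoid.End A.Homology}
    (h : ∀ t, f (A.homologyClass t) = g (A.homologyClass t)) : f = g := by
  refine AddMonoidHom.ext fun w => ?_
  obtain ⟨t, rfl⟩ := A.homologyClass_surjective w
  exact h t

theorem homologyClass_congr {t t' : A.cycles}
    (h : (t : Obj X → A.I → ℤ) = t') : A.homologyClass t = A.homologyClass t' :=
  congrArg _ (Subtype.ext h)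

open Classical in
theorem freeEnd_rel [Finite X] {x y : Free X} (h : Rel x y) : A.freeEnd x = A.freeEnd y := by
  cases h with
  | e_mul_self a =>
    rw [map_mul, freeEnd_e]
    refine end_ext fun t => homologyClass_congr ?_
    simp only [coe_letterActCycles, letterAct_e, Pi.single_eq_same]
  | e_mul_e a b h =>
    rw [map_mul, freeEnd_e, freeEnd_e, map_zero]
    refine end_ext fun t => ?_
    change A.homologyClass _ = 0
    rw [← map_zero A.homologyClass]
    refine homologyClass_congr ?_
    simp only [coe_letterActCycles, letterAct_e, Pi.single_eq_of_ne h, Pi.single_zero]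
    rfl
  | sum_e =>
    rw [map_sum, map_one]
    simp only [freeEnd_e]
    refine end_ext fun t => ?_
    refine (AddMonoidHom.finsetSum_apply _ _ _).trans ?_
    change ∑ a, A.homologyClass (A.letterActCycles (.e a) t) = A.homologyClass t
    rw [← map_sum]
    refine homologyClass_congr ?_
    rw [AddSubgroup.val_finsetSum]
    simp only [coe_letterActCycles, letterAct_e]
    exact Finset.univ_sum_single _
  | mul_source g =>
    rw [map_mul, freeEnd_e, freeEnd_of]
    refine end_ext fun t => homologyClass_congr ?_
    simp only [coe_letterActCycles, letterAct_e, letterAct_of, Pi.single_eq_same]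
  | target_mul g =>
    rw [map_mul, freeEnd_e, freeEnd_of]
    refine end_ext fun t => homologyClass_congr ?_
    simp only [coe_letterActCycles, letterAct_e, letterAct_of, Pi.single_eq_same]
  | i_self Y h j =>
    rw [Free.i, freeEnd_e, freeEnd_of]
    exact end_ext fun t => homologyClass_congr rfl
  | r_self Y h j =>
    rw [Free.r, freeEnd_e, freeEnd_of]
    refine end_ext fun t => homologyClass_congr ?_
    simp only [coe_letterActCycles, letterAct_e, letterAct_of]
    exact congrArg _ (π_eq_self subset_rfl (mem_cycles.1 t.2 (Y, j)).1)
  | i_comp h₁ h₂ h₃ j =>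
    rw [map_mul, Free.i, Free.i, Free.i, freeEnd_of, freeEnd_of, freeEnd_of]
    refine end_ext fun t => homologyClass_congr ?_
    simp only [coe_letterActCycles, letterAct_of, Pi.single_eq_same]
    rfl
  | r_comp h₁ h₂ h₃ j =>
    rw [map_mul, Free.r, Free.r, Free.r, freeEnd_of, freeEnd_of, freeEnd_of]
    refine end_ext fun t => homologyClass_congr ?_
    simp only [coe_letterActCycles, letterAct_of, Pi.single_eq_same]
    refine congrArg _ ((π_π _ _ _).trans ?_)
    rw [Set.inter_eq_right.2 h₂.subset]
    rfl
  | @r_i U Y C W h₁ h₂ h₃ h₄ h₅ j =>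
    rw [map_mul, map_mul, Free.r, Free.r, Free.i, Free.i, freeEnd_of, freeEnd_of, freeEnd_of,
      freeEnd_of]
    refine end_ext fun t => homologyClass_congr ?_
    simp only [coe_letterActCycles, letterAct_of, Pi.single_eq_same]
    refine congrArg _ ?_
    change A.π C.1 _ = A.π W.1 _
    rw [h₃, ← π_π, π_eq_self subset_rfl (mem_cycles.1 t.2 (U, j)).1]
    rfl
  | @disjoint_union U V Y h₁ h₂ h₃ h₄ h₅ h₆ j =>
    rw [map_add, map_mul, map_mul, Free.r, Free.r, Free.i, Free.i, freeEnd_of, freeEnd_of,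
      freeEnd_of, freeEnd_of, freeEnd_e]
    refine end_ext fun t => ?_
    change A.homologyClass _ + A.homologyClass _ = _
    rw [← map_add]
    refine homologyClass_congr ?_
    simp only [AddSubgroup.coe_add, coe_letterActCycles, letterAct_of, letterAct_e,
      Pi.single_eq_same]
    rw [← Pi.single_add]
    refine congrArg _ ?_
    change A.π U.1 _ + A.π V.1 _ = _
    rw [← π_union h₁, ← h₂, π_eq_self subset_rfl (mem_cycles.1 t.2 (Y, j)).1]
  | δ_i h₁ h₂ h₃ j =>
    rw [map_mul, Free.δ, Free.δ, Free.i, freeEnd_of, freeEnd_of, freeEnd_of]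
    refine end_ext fun t => homologyClass_congr ?_
    simp only [coe_letterActCycles, letterAct_of, Pi.single_eq_same]
    rfl
  | @r_δ C U W h₁ h₂ h₃ j =>
    rw [map_mul, Free.δ, Free.δ, Free.r, freeEnd_of, freeEnd_of, freeEnd_of]
    refine end_ext fun t => homologyClass_congr ?_
    simp only [coe_letterActCycles, letterAct_of, Pi.single_eq_same]
    refine congrArg _ ((π_π _ _ _).trans ?_)
    rw [Set.inter_eq_right.2 h₂.subset]
    rfl
  | @i_δ U V Y C D h₁ h₂ h₃ h₄ j =>
    rw [map_mul, map_mul, Free.δ, Free.δ, Free.i, Free.r, freeEnd_of, freeEnd_of, freeEnd_of,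
      freeEnd_of]
    refine end_ext fun t => ?_
    refine A.homologyClass_eq.2 ?_
    simp only [coe_letterActCycles, letterAct_of, Pi.single_eq_same]
    rw [← Pi.single_sub, single_mem_boundaries]
    set x := (t : Obj X → A.I → ℤ) (C, j) with hx
    have hxc : x ∈ A.Cycle (C, j) := mem_cycles.1 t.2 (C, j)
    change A.π U.1 (A.d x) - A.π V.1 (A.d (A.π D.1 x)) ∈ A.Bdry _
    -- The homotopy is given by the part of the chain over `V ∩ C`.
    have hVY : x ∈ A.Supp Y.1 j := supp_mono h₁.subset hxc.1
    have h5 : x = A.π V.1 x + A.π D.1 x := by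
      rw [← πd_eq_add h₂, π_eq_self subset_rfl hVY]
    have h6 : A.π V.1 (A.d x) = A.π U.1 (A.d x) := by
      have h7 := congrArg (A.π V.1) (πd_eq_add h₁ (A.d x))
      rwa [show A.π C.1 (A.d x) = 0 from hxc.2, add_zero, π_π, π_π,
        Set.inter_eq_right.2 h₂.1.subset, Set.inter_eq_left.2 h₃.subset] at h7
    refine ⟨A.π V.1 x, ?_, ?_⟩
    · have := π_mem_supp_univ (S' := V.1) (supp_univ hVY)
      change _ ∈ A.Supp _ (j + 1 + 1)
      rwa [add_one_add_one]
    · change A.π V.1 (A.d (A.π V.1 x)) = _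
      rw [← h6, eq_sub_iff_add_eq, ← map_add, ← map_add, ← h5]

open Classical in
/-- The homology class of a cycle over the locally closed set `Y` of degree `j`, for the object
`Y_j`. -/
noncomputable def cls (a : Obj X) : A.Cycle a →+ A.Homology :=
  A.homologyClass.comp <| ((AddMonoidHom.single _ a).comp (A.Cycle a).subtype).codRestrict A.cycles
    fun x => single_mem_cycles x.2

theorem cls_eq_zero {a : Obj X} {x : A.Cycle a} : cls a x = 0 ↔ (x : A.I → ℤ) ∈ A.Bdry a :=
  A.homologyClass_eq_zero.trans single_mem_boundaries

theorem cls_eq {a : Obj X} {x y : A.Cycle a} :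
    cls a x = cls a y ↔ (x - y : A.I → ℤ) ∈ A.Bdry a := by
  rw [← sub_eq_zero, ← map_sub, cls_eq_zero, AddSubgroup.coe_sub]

variable (A) [Finite X]

/-- The action of the category ring on homology. -/
noncomputable def ntEnd : NT X →+* AddMonoid.End A.Homology :=
  RingQuot.lift ⟨A.freeEnd.toRingHom, fun _ _ h => freeEnd_rel h⟩

theorem ntEnd_mk (x : Free X) : A.ntEnd (NT.mk x) = A.freeEnd x :=
  RingQuot.lift_mkRingHom_apply _ _ _

noncomputable instance : Module (NT X) A.Homology := Module.compHom _ A.ntEnd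

variable {A}

open Classical in
theorem e_smul_homologyClass (a : Obj X) (t : A.cycles) :
    NT.e a • A.homologyClass t =
      A.homologyClass ⟨Pi.single a (t.1 a), single_mem_cycles (mem_cycles.1 t.2 a)⟩ := by
  change A.ntEnd (NT.mk _) _ = _
  rw [ntEnd_mk, freeEnd_e]
  rfl

open Classical in
theorem of_smul_homologyClass {a b : Obj X} (g : Gen a b) (t : A.cycles) :
    NT.of g • A.homologyClass t = A.homologyClass
      ⟨Pi.single b (A.φ g (t.1 a)), single_mem_cycles (φ_mem_cycle g (mem_cycles.1 t.2 a))⟩ := by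
  change A.ntEnd (NT.mk _) _ = _
  rw [ntEnd_mk, freeEnd_of]
  rfl

open Classical in
theorem of_smul_cls {a b : Obj X} (g : Gen a b) (x : A.Cycle a) :
    NT.of g • cls a x = cls b ⟨A.φ g x, φ_mem_cycle g x.2⟩ := by
  refine (of_smul_homologyClass g _).trans (homologyClass_congr ?_)
  change (Pi.single b (A.φ g ((Pi.single a (x : A.I → ℤ) : Obj X → A.I → ℤ) a)) :
    Obj X → A.I → ℤ) = _
  rw [Pi.single_eq_same]
  rfl

open Classical in
theorem e_smul_cls (a : Obj X) (x : A.Cycle a) : NT.e a • cls a x = cls a x := by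
  refine (e_smul_homologyClass a _).trans (homologyClass_congr ?_)
  change (Pi.single a ((Pi.single a (x : A.I → ℤ) : Obj X → A.I → ℤ) a) : Obj X → A.I → ℤ) = _
  rw [Pi.single_eq_same]
  rfl

theorem exists_cls {a : Obj X} {w : A.Homology} (hw : NT.e a • w = w) : ∃ x, cls a x = w := by
  obtain ⟨t, rfl⟩ := A.homologyClass_surjective w
  exact ⟨⟨_, mem_cycles.1 t.2 a⟩, by rw [← hw, e_smul_homologyClass]; rfl⟩

/-- The homology of a filtered complex is an exact module, by the long exact homology sequences. -/
theorem isExact_homology : IsExact (X := X) A.Homology := by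
  intro U Y C h j
  refine ⟨fun w => ⟨fun hw => ?_, ?_⟩, fun w => ⟨fun hw => ?_, ?_⟩, fun w => ⟨fun hw => ?_, ?_⟩⟩
  · obtain ⟨x, hx⟩ := exists_cls w.2
    have h1 := congrArg Subtype.val hw
    rw [coe_act, ← hx, of_smul_cls] at h1
    obtain ⟨y, hy, hxy⟩ := exact_i_r h x.2 (cls_eq_zero.1 h1)
    refine ⟨⟨cls _ ⟨y, hy⟩, e_smul_cls _ _⟩, Subtype.ext ?_⟩
    rw [coe_act, of_smul_cls, ← hx, eq_comm]
    exact cls_eq.2 hxy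
  · rintro ⟨v, rfl⟩
    ext
    rw [coe_act, coe_act, ← mul_smul, NT.r_mul_i h, zero_smul]
    rfl
  · obtain ⟨x, hx⟩ := exists_cls w.2
    have h1 := congrArg Subtype.val hw
    rw [coe_act, ← hx, of_smul_cls] at h1
    obtain ⟨y, hy, hxy⟩ := exact_r_δ h x.2 (cls_eq_zero.1 h1)
    refine ⟨⟨cls _ ⟨y, hy⟩, e_smul_cls _ _⟩, Subtype.ext ?_⟩
    rw [coe_act, of_smul_cls, ← hx]
    exact congrArg _ (Subtype.ext hxy)
  · rintro ⟨v, rfl⟩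
    ext
    rw [coe_act, coe_act, ← mul_smul, NT.δ_mul_r h, zero_smul]
    rfl
  · obtain ⟨x, hx⟩ := exists_cls w.2
    have h1 := congrArg Subtype.val hw
    rw [coe_act, ← hx, of_smul_cls] at h1
    obtain ⟨y, hy, hxy⟩ := exact_δ_i h x.2 (cls_eq_zero.1 h1)
    refine ⟨⟨cls _ ⟨y, hy⟩, e_smul_cls _ _⟩, Subtype.ext ?_⟩
    rw [coe_act, of_smul_cls, ← hx, eq_comm]
    exact cls_eq.2 hxy
  · rintro ⟨v, rfl⟩
    ext
    rw [coe_act, coe_act, ← mul_smul, NT.i_mul_δ h, zero_smul]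
    rfl

end

end FilteredComplex

/-! ### Locally closed subsets of the pseudo-circle -/

namespace PseudoCircle

/-- The closed points `1` and `2`. -/
def clo : Bool → PseudoCircle
  | false => p1
  | true => p2

/-- The open points `3` and `4`. -/
def opn : Bool → PseudoCircle
  | false => p3
  | true => p4

theorem isOpen_iff_forall (U : Set PseudoCircle) :
    IsOpen U ↔ ∀ a, clo a ∈ U → ∀ b, opn b ∈ U := by
  change ((p1 ∈ U ∨ p2 ∈ U) → (p3 ∈ U ∧ p4 ∈ U)) ↔ _
  simp only [Bool.forall_bool, clo, opn]
  tauto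

theorem isClosed_iff_forall (F : Set PseudoCircle) :
    IsClosed F ↔ ∀ b, opn b ∈ F → ∀ a, clo a ∈ F := by
  rw [← isOpen_compl_iff, isOpen_iff_forall]
  simp only [Set.mem_compl_iff]
  constructor
  · exact fun h x hx y => by_contra fun h' => h y h' x hx
  · exact fun h x hx y h' => hx (h y h' x)

theorem set_ext {S S' : Set PseudoCircle} (h : ∀ a, clo a ∈ S ↔ clo a ∈ S')
    (h' : ∀ b, opn b ∈ S ↔ opn b ∈ S') : S = S' := by
  ext x
  cases x
  exacts [h false, h true, h' false, h' true]

theorem isLocallyClosed (S : Set PseudoCircle) : IsLocallyClosed S := by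
  refine ⟨S ∪ Set.range opn, S ∪ Set.range clo, ?_, ?_, ?_⟩
  · rw [isOpen_iff_forall]
    exact fun _ _ b => Or.inr ⟨b, rfl⟩
  · rw [isClosed_iff_forall]
    exact fun _ _ b => Or.inr ⟨b, rfl⟩
  · rw [← Set.union_inter_distrib_left, eq_comm, Set.union_eq_left]
    rintro _ ⟨⟨b, rfl⟩, ⟨a, ha⟩⟩
    cases a <;> cases b <;> simp [clo, opn] at ha

/-- The subset of the pseudo-circle consisting of the closed points in `A` and the open points
in `B`. All subsets are locally closed, and they are all of this form. -/
def lc (A B : Finset Bool) : LC PseudoCircle :=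
  ⟨{x | (∃ a ∈ A, clo a = x) ∨ ∃ b ∈ B, opn b = x}, isLocallyClosed _⟩

@[simp] theorem clo_mem_lc {A B : Finset Bool} {a : Bool} : clo a ∈ (lc A B).1 ↔ a ∈ A := by
  change ((∃ a' ∈ A, clo a' = clo a) ∨ ∃ b ∈ B, opn b = clo a) ↔ _
  cases a <;> simp [clo, opn]

@[simp] theorem opn_mem_lc {A B : Finset Bool} {b : Bool} : opn b ∈ (lc A B).1 ↔ b ∈ B := by
  change ((∃ a' ∈ A, clo a' = opn b) ∨ ∃ b' ∈ B, opn b' = opn b) ↔ _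
  cases b <;> simp [clo, opn]

open Classical in
theorem exists_lc (Y : LC PseudoCircle) : ∃ A B, Y = lc A B :=
  ⟨Finset.univ.filter fun a => clo a ∈ Y.1, Finset.univ.filter fun b => opn b ∈ Y.1,
    Subtype.ext (set_ext (by simp) (by simp))⟩

theorem isOpenIn_lc {A B A' B' : Finset Bool} :
    IsOpenIn (lc A B) (lc A' B') ↔ A ⊆ A' ∧ B ⊆ B' ∧ (A = ∅ ∨ B = B') := by
  constructor
  · rintro ⟨O, hO, h⟩
    rw [isOpen_iff_forall] at hO
    have h1 : ∀ a, a ∈ A ↔ clo a ∈ O ∧ a ∈ A' := fun a => by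
      simpa using Set.ext_iff.1 h (clo a)
    have h2 : ∀ b, b ∈ B ↔ opn b ∈ O ∧ b ∈ B' := fun a => by
      simpa using Set.ext_iff.1 h (opn a)
    refine ⟨fun a ha => ((h1 a).1 ha).2, fun b hb => ((h2 b).1 hb).2, ?_⟩
    refine A.eq_empty_or_nonempty.imp_right ?_
    rintro ⟨a, ha⟩
    ext b
    rw [h2 b, and_iff_right (hO a ((h1 a).1 ha).1 b)]
  · rintro ⟨hA, hB, h⟩
    refine ⟨(lc A (if A = ∅ then B else Finset.univ)).1, ?_, ?_⟩
    · rw [isOpen_iff_forall]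
      intro a ha b
      rw [clo_mem_lc] at ha
      rw [opn_mem_lc, if_neg (Finset.ne_empty_of_mem ha)]
      exact Finset.mem_univ _
    · refine set_ext (fun a => ?_) (fun b => ?_)
      · simpa using @hA a
      · simp only [opn_mem_lc, Set.mem_inter_iff]
        split_ifs with h'
        · exact ⟨fun hb => ⟨hb, hB hb⟩, And.left⟩
        · simp [h.resolve_left h']

theorem isClosedIn_lc {A B A' B' : Finset Bool} :
    IsClosedIn (lc A B) (lc A' B') ↔ A ⊆ A' ∧ B ⊆ B' ∧ (B = ∅ ∨ A = A') := by
  constructor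
  · rintro ⟨O, hO, h⟩
    rw [isClosed_iff_forall] at hO
    have h1 : ∀ a, a ∈ A ↔ clo a ∈ O ∧ a ∈ A' := fun a => by
      simpa using Set.ext_iff.1 h (clo a)
    have h2 : ∀ b, b ∈ B ↔ opn b ∈ O ∧ b ∈ B' := fun a => by
      simpa using Set.ext_iff.1 h (opn a)
    refine ⟨fun a ha => ((h1 a).1 ha).2, fun b hb => ((h2 b).1 hb).2, ?_⟩
    refine B.eq_empty_or_nonempty.imp_right ?_
    rintro ⟨b, hb⟩
    ext a
    rw [h1 a, and_iff_right (hO b ((h2 b).1 hb).1 a)]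
  · rintro ⟨hA, hB, h⟩
    refine ⟨(lc (if B = ∅ then A else Finset.univ) B).1, ?_, ?_⟩
    · rw [isClosed_iff_forall]
      intro a ha b
      rw [opn_mem_lc] at ha
      rw [clo_mem_lc, if_neg (Finset.ne_empty_of_mem ha)]
      exact Finset.mem_univ _
    · refine set_ext (fun a => ?_) (fun b => ?_)
      · simp only [clo_mem_lc, Set.mem_inter_iff]
        split_ifs with h'
        · exact ⟨fun hb => ⟨hb, hA hb⟩, And.left⟩
        · simp [h.resolve_left h']
      · simpa using @hB b

theorem lc_inter {A B A' B' : Finset Bool} :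
    (lc (A ∩ A') (B ∩ B')).1 = (lc A B).1 ∩ (lc A' B').1 :=
  set_ext (by simp) (by simp)

theorem lc_union {A B A' B' : Finset Bool} :
    (lc (A ∪ A') (B ∪ B')).1 = (lc A B).1 ∪ (lc A' B').1 :=
  set_ext (by simp) (by simp)

theorem disjoint_lc {A B A' B' : Finset Bool} :
    Disjoint (lc A B).1 (lc A' B').1 ↔ Disjoint A A' ∧ Disjoint B B' := by
  simp only [Set.disjoint_left, Finset.disjoint_left]
  constructor
  · exact fun h => ⟨fun a => by simpa using @h (clo a), fun b => by simpa using @h (opn b)⟩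
  · rintro ⟨h, h'⟩ x
    cases x
    · exact fun h1 h2 => h (clo_mem_lc.1 h1) (clo_mem_lc (a := false).1 h2)
    · exact fun h1 h2 => h (clo_mem_lc.1 h1) (clo_mem_lc (a := true).1 h2)
    · exact fun h1 h2 => h' (opn_mem_lc.1 h1) (opn_mem_lc (b := false).1 h2)
    · exact fun h1 h2 => h' (opn_mem_lc.1 h1) (opn_mem_lc (b := true).1 h2)

theorem lc_injective {A B A' B' : Finset Bool} (h : lc A B = lc A' B') : A = A' ∧ B = B' := by
  constructor
  · ext a
    rw [← clo_mem_lc (A := A) (B := B), h, clo_mem_lc]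
  · ext a
    rw [← opn_mem_lc (A := A) (B := B), h, opn_mem_lc]

theorem lc_empty : (lc ∅ ∅).1 = ∅ := set_ext (by simp) (by simp)

theorem isExtension_lc {A B A' B' A'' B'' : Finset Bool} :
    IsExtension (lc A B) (lc A' B') (lc A'' B'') ↔
      (A ⊆ A' ∧ B ⊆ B' ∧ (A = ∅ ∨ B = B')) ∧ A'' = A' \ A ∧ B'' = B' \ B := by
  rw [IsExtension, isOpenIn_lc]
  refine and_congr_right fun _ => ?_
  constructor
  · intro h
    constructor
    · ext a
      simpa using Set.ext_iff.1 h (clo a)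
    · ext a
      simpa using Set.ext_iff.1 h (opn a)
  · rintro ⟨rfl, rfl⟩
    exact set_ext (by simp) (by simp)

theorem isBoundaryPair_lc {A B A' B' : Finset Bool} :
    IsBoundaryPair (lc A B) (lc A' B') ↔
      Disjoint A A' ∧ Disjoint B B' ∧ (A' = ∅ ∨ B = ∅) := by
  constructor
  · rintro ⟨Y, hY⟩
    obtain ⟨C, D, rfl⟩ := exists_lc Y
    obtain ⟨⟨-, -, h⟩, rfl, rfl⟩ := isExtension_lc.1 hY
    exact ⟨Finset.sdiff_disjoint, Finset.sdiff_disjoint,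
      h.imp_right fun h => by rw [h, Finset.sdiff_self]⟩
  · rintro ⟨hA, hB, h⟩
    refine ⟨lc (A' ∪ A) (B' ∪ B), isExtension_lc.2 ⟨⟨Finset.subset_union_left,
      Finset.subset_union_left, h.imp_right fun h => by rw [h, Finset.union_empty]⟩, ?_, ?_⟩⟩
    · rw [Finset.union_sdiff_cancel_left hA.symm]
    · rw [Finset.union_sdiff_cancel_left hB.symm]

end PseudoCircle

/-! ### Normal forms of morphisms -/

namespace PseudoCircle

theorem isOpenIn_opn (A B : Finset Bool) : IsOpenIn (lc ∅ B) (lc A B) :=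
  isOpenIn_lc.2 ⟨Finset.empty_subset _, subset_rfl, Or.inl rfl⟩

theorem isClosedIn_clo (A B : Finset Bool) : IsClosedIn (lc A ∅) (lc A B) :=
  isClosedIn_lc.2 ⟨subset_rfl, Finset.empty_subset _, Or.inl rfl⟩

theorem isBoundaryPair_clo_opn (A B : Finset Bool) : IsBoundaryPair (lc A ∅) (lc ∅ B) :=
  isBoundaryPair_lc.2 ⟨Finset.disjoint_empty_right _, Finset.disjoint_empty_left _, Or.inl rfl⟩

theorem isOpenIn_clo {A A' : Finset Bool} (h : A ⊆ A') : IsOpenIn (lc A ∅) (lc A' ∅) :=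
  isOpenIn_lc.2 ⟨h, subset_rfl, Or.inr rfl⟩

theorem isClosedIn_clo_of_subset {A A' : Finset Bool} (h : A ⊆ A') :
    IsClosedIn (lc A ∅) (lc A' ∅) :=
  isClosedIn_lc.2 ⟨h, subset_rfl, Or.inl rfl⟩

theorem isOpenIn_opn_of_subset {B B' : Finset Bool} (h : B ⊆ B') :
    IsOpenIn (lc ∅ B) (lc ∅ B') :=
  isOpenIn_lc.2 ⟨subset_rfl, h, Or.inl rfl⟩

theorem isClosedIn_opn {B B' : Finset Bool} (h : B ⊆ B') : IsClosedIn (lc ∅ B) (lc ∅ B') :=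
  isClosedIn_lc.2 ⟨subset_rfl, h, Or.inr rfl⟩

open NT

theorem r_mul_i_clo {A A' : Finset Bool} (h : A ⊆ A') (j : ZMod 2) :
    of (Gen.r (isClosedIn_clo_of_subset h) j) * of (Gen.i (isOpenIn_clo h) j) =
      e (lc A ∅, j) := by
  rw [r_i (isOpenIn_clo h) (isClosedIn_clo_of_subset h) (W := lc A ∅) (by simp)
    (.refl _) (.refl _), i_self, r_self, e_mul_self]

theorem r_mul_i_opn {B B' : Finset Bool} (h : B ⊆ B') (j : ZMod 2) :
    of (Gen.r (isClosedIn_opn h) j) * of (Gen.i (isOpenIn_opn_of_subset h) j) =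
      e (lc ∅ B, j) := by
  rw [r_i (isOpenIn_opn_of_subset h) (isClosedIn_opn h) (W := lc ∅ B) (by simp)
    (.refl _) (.refl _), i_self, r_self, e_mul_self]

/-- All boundary maps factor through the boundary maps from sets of closed points to sets of open
points. -/
theorem δ_eq {A B A' B' : Finset Bool} (h : IsBoundaryPair (lc A B) (lc A' B')) (j : ZMod 2) :
    of (Gen.δ h j) = of (Gen.i (isOpenIn_opn A' B') (j + 1)) *
      of (Gen.δ (isBoundaryPair_clo_opn A B') j) * of (Gen.r (isClosedIn_clo A B) j) := by
  obtain ⟨hA, hB, rfl | rfl⟩ := isBoundaryPair_lc.1 h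
  · have hU : IsExtension (lc ∅ B') (lc A (B' ∪ B)) (lc A B) :=
      isExtension_lc.2 ⟨⟨Finset.empty_subset _, Finset.subset_union_left, Or.inl rfl⟩,
        Finset.sdiff_empty.symm, (Finset.union_sdiff_cancel_left hB.symm).symm⟩
    have hV : IsExtension (lc ∅ (B' ∪ B)) (lc A (B' ∪ B)) (lc A ∅) :=
      isExtension_lc.2 ⟨⟨Finset.empty_subset _, subset_rfl, Or.inl rfl⟩,
        Finset.sdiff_empty.symm, (Finset.sdiff_self _).symm⟩
    have hs : B' ⊆ B' ∪ B := Finset.subset_union_left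
    have h1 := congrArg (of (Gen.r (isClosedIn_opn hs) (j + 1)) * ·)
      (i_δ hU hV (isOpenIn_opn_of_subset hs) (isClosedIn_clo A B) j)
    simp only [← mul_assoc] at h1
    rw [r_mul_i_opn hs, NT.target_mul, r_δ _ _ (isBoundaryPair_clo_opn A B')] at h1
    rw [i_self, NT.target_mul]
    exact h1
  · have hU : IsExtension (lc ∅ B') (lc (A' ∪ A) B') (lc (A' ∪ A) ∅) :=
      isExtension_lc.2 ⟨⟨Finset.empty_subset _, subset_rfl, Or.inl rfl⟩,
        Finset.sdiff_empty.symm, (Finset.sdiff_self _).symm⟩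
    have hV : IsExtension (lc A' B') (lc (A' ∪ A) B') (lc A ∅) :=
      isExtension_lc.2 ⟨⟨Finset.subset_union_left, subset_rfl, Or.inr rfl⟩,
        (Finset.union_sdiff_cancel_left hA.symm).symm, (Finset.sdiff_self _).symm⟩
    have hs : A ⊆ A' ∪ A := Finset.subset_union_right
    have h1 := congrArg (· * of (Gen.i (isOpenIn_clo hs) j))
      (i_δ hU hV (isOpenIn_opn A' B') (isClosedIn_clo_of_subset hs) j)
    simp only [mul_assoc] at h1
    rw [r_mul_i_clo hs, NT.mul_source, δ_i _ _ (isBoundaryPair_clo_opn A B')] at h1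
    rw [r_self, mul_assoc, NT.mul_source]
    exact h1.symm

/-- Morphisms of degree `0` from `Y_k` to `Z_k` in normal form: first restrict to a common
subset, then extend. -/
noncomputable def normal₀ (Y Z : LC PseudoCircle) (k : ZMod 2) : AddSubgroup (NT PseudoCircle) :=
  AddSubgroup.closure {y | ∃ (W : LC PseudoCircle) (hi : IsOpenIn W Z) (hr : IsClosedIn W Y),
    y = of (Gen.i hi k) * of (Gen.r hr k)}

/-- Morphisms of degree `1` from `Y_k` to `Z_{k+1}` in normal form: boundary maps between a set of
closed points in `Y` and a set of open points in `Z`. -/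
noncomputable def normal₁ (Y Z : LC PseudoCircle) (k : ZMod 2) : AddSubgroup (NT PseudoCircle) :=
  AddSubgroup.closure {y | ∃ (A B : Finset Bool) (hi : IsOpenIn (lc ∅ B) Z)
    (hr : IsClosedIn (lc A ∅) Y), y = of (Gen.i hi (k + 1)) *
      of (Gen.δ (isBoundaryPair_clo_opn A B) k) * of (Gen.r hr k)}

theorem closure_induction_mul {S : Set (NT PseudoCircle)} {T : AddSubgroup (NT PseudoCircle)}
    {x : NT PseudoCircle} (h : ∀ y ∈ S, x * y ∈ T) {y : NT PseudoCircle}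
    (hy : y ∈ AddSubgroup.closure S) : x * y ∈ T := by
  induction hy using AddSubgroup.closure_induction with
  | mem y hy => exact h y hy
  | zero => rw [mul_zero]; exact zero_mem _
  | add y z _ _ hy hz => rw [mul_add]; exact add_mem hy hz
  | neg y _ hy => rw [mul_neg]; exact neg_mem hy

theorem i_mul_normal₀ {Y Z Z' : LC PseudoCircle} {k : ZMod 2} (h : IsOpenIn Z Z')
    {y : NT PseudoCircle} (hy : y ∈ normal₀ Y Z k) : of (Gen.i h k) * y ∈ normal₀ Y Z' k := by
  refine closure_induction_mul ?_ hy
  rintro _ ⟨W, hi, hr, rfl⟩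
  obtain ⟨O, hO, hZ⟩ := id h
  obtain ⟨O', hO', hW⟩ := id hi
  have hi' : IsOpenIn W Z' := ⟨O' ∩ O, hO'.inter hO, by rw [hW, hZ, Set.inter_assoc]⟩
  rw [← mul_assoc, i_comp hi h hi']
  exact AddSubgroup.subset_closure ⟨W, hi', hr, rfl⟩

theorem i_mul_normal₁ {Y Z Z' : LC PseudoCircle} {k : ZMod 2} (h : IsOpenIn Z Z')
    {y : NT PseudoCircle} (hy : y ∈ normal₁ Y Z k) :
    of (Gen.i h (k + 1)) * y ∈ normal₁ Y Z' k := by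
  refine closure_induction_mul ?_ hy
  rintro _ ⟨A, B, hi, hr, rfl⟩
  obtain ⟨O, hO, hZ⟩ := id h
  obtain ⟨O', hO', hW⟩ := id hi
  have hi' : IsOpenIn (lc ∅ B) Z' := ⟨O' ∩ O, hO'.inter hO, by rw [hW, hZ, Set.inter_assoc]⟩
  rw [← mul_assoc, ← mul_assoc, i_comp hi h hi']
  exact AddSubgroup.subset_closure ⟨A, B, hi', hr, rfl⟩

theorem r_mul_normal₀ {Y Z Z' : LC PseudoCircle} {k : ZMod 2} (h : IsClosedIn Z' Z)
    {y : NT PseudoCircle} (hy : y ∈ normal₀ Y Z k) : of (Gen.r h k) * y ∈ normal₀ Y Z' k := by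
  refine closure_induction_mul ?_ hy
  rintro _ ⟨W, hi, hr, rfl⟩
  obtain ⟨F, hF, hZ⟩ := id h
  obtain ⟨O, hO, hW⟩ := id hi
  obtain ⟨F', hF', hW'⟩ := id hr
  let V : LC PseudoCircle := ⟨W.1 ∩ Z'.1, isLocallyClosed _⟩
  have h1 : IsOpenIn V Z' := ⟨O, hO, by
    change W.1 ∩ Z'.1 = _
    rw [hW, Set.inter_assoc, Set.inter_eq_right.2 h.subset]⟩
  have h2 : IsClosedIn V W := ⟨F, hF, by
    change W.1 ∩ Z'.1 = _
    rw [hZ, Set.inter_left_comm, Set.inter_eq_left.2 hi.subset]⟩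
  have h3 : IsClosedIn V Y := ⟨F ∩ F', hF.inter hF', by
    rw [Set.inter_assoc, ← hW']
    obtain ⟨F'', -, h''⟩ := id h2
    change W.1 ∩ Z'.1 = _
    rw [hZ, Set.inter_left_comm, Set.inter_eq_left.2 hi.subset]⟩
  rw [← mul_assoc, r_i hi h rfl h1 h2, mul_assoc, r_comp hr h2 h3]
  exact AddSubgroup.subset_closure ⟨V, h1, h3, rfl⟩

theorem r_mul_normal₁ {Y Z Z' : LC PseudoCircle} {k : ZMod 2} (h : IsClosedIn Z' Z)
    {y : NT PseudoCircle} (hy : y ∈ normal₁ Y Z k) :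
    of (Gen.r h (k + 1)) * y ∈ normal₁ Y Z' k := by
  refine closure_induction_mul ?_ hy
  rintro _ ⟨A, B, hi, hr, rfl⟩
  obtain ⟨C, D, rfl⟩ := exists_lc Z
  obtain ⟨C', D', rfl⟩ := exists_lc Z'
  obtain ⟨-, h2, -⟩ := isOpenIn_lc.1 hi
  obtain ⟨-, h3, -⟩ := isClosedIn_lc.1 h
  have h4 : IsOpenIn (lc ∅ (B ∩ D')) (lc C' D') :=
    isOpenIn_lc.2 ⟨Finset.empty_subset _, Finset.inter_subset_right, Or.inl rfl⟩
  rw [← mul_assoc, ← mul_assoc, r_i hi h (W := lc ∅ (B ∩ D'))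
    (by rw [← lc_inter, Finset.empty_inter]) h4 (isClosedIn_opn Finset.inter_subset_left),
    mul_assoc (of (Gen.i _ _)), r_δ _ _ (isBoundaryPair_clo_opn A (B ∩ D'))]
  exact AddSubgroup.subset_closure ⟨A, B ∩ D', h4, hr, rfl⟩

theorem δ_mul_normal₀ {Y Z Z' : LC PseudoCircle} {k : ZMod 2} (h : IsBoundaryPair Z Z')
    {y : NT PseudoCircle} (hy : y ∈ normal₀ Y Z k) : of (Gen.δ h k) * y ∈ normal₁ Y Z' k := by
  refine closure_induction_mul ?_ hy
  rintro _ ⟨W, hi, hr, rfl⟩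
  obtain ⟨C, D, rfl⟩ := exists_lc Z
  obtain ⟨C', D', rfl⟩ := exists_lc Z'
  obtain ⟨A, B, rfl⟩ := exists_lc W
  obtain ⟨A', B', rfl⟩ := exists_lc Y
  obtain ⟨h1, h2, h3⟩ := isBoundaryPair_lc.1 h
  obtain ⟨h4, h5, -⟩ := isOpenIn_lc.1 hi
  obtain ⟨h6, h7, -⟩ := isClosedIn_lc.1 hr
  have h8 : IsBoundaryPair (lc A B) (lc C' D') := isBoundaryPair_lc.2
    ⟨h1.mono_left h4, h2.mono_left h5,
      h3.imp_right fun h' => Finset.subset_empty.1 (h5.trans_eq h')⟩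
  have h9 : IsClosedIn (lc A ∅) (lc A' B') :=
    isClosedIn_lc.2 ⟨h6, Finset.empty_subset _, Or.inl rfl⟩
  rw [← mul_assoc, δ_i h hi h8, δ_eq, mul_assoc, r_comp hr (isClosedIn_clo A B) h9]
  exact AddSubgroup.subset_closure ⟨A, D', isOpenIn_opn _ _, h9, rfl⟩

/-- Composites of two boundary maps vanish. -/
theorem δ_mul_normal₁ {Y Z Z' : LC PseudoCircle} {k : ZMod 2} (h : IsBoundaryPair Z Z')
    {y : NT PseudoCircle} (hy : y ∈ normal₁ Y Z k) : of (Gen.δ h (k + 1)) * y = 0 := by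
  have := closure_induction_mul (T := ⊥) (x := of (Gen.δ h (k + 1))) ?_ hy
  · exact this
  rintro _ ⟨A, B, hi, hr, rfl⟩
  obtain ⟨C, D, rfl⟩ := exists_lc Z
  obtain ⟨C', D', rfl⟩ := exists_lc Z'
  obtain ⟨h1, h2, h3⟩ := isBoundaryPair_lc.1 h
  obtain ⟨h4, h5, -⟩ := isOpenIn_lc.1 hi
  have h8 : IsBoundaryPair (lc ∅ B) (lc C' D') := isBoundaryPair_lc.2
    ⟨h1.mono_left h4, h2.mono_left h5,
      h3.imp_right fun h' => Finset.subset_empty.1 (h5.trans_eq h')⟩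
  rw [← mul_assoc, ← mul_assoc, δ_i h hi h8, δ_eq,
    of_eq_zero_of_target (Gen.r _ _) (e_eq_zero lc_empty _)]
  simp

theorem ne_add_one (k : ZMod 2) : k ≠ k + 1 := by revert k; decide

theorem eq_or_eq_add_one (j k : ZMod 2) : j = k ∨ j = k + 1 := by revert j k; decide

/-- Every morphism is a linear combination of morphisms in normal form. -/
theorem mem_normal (Y : LC PseudoCircle) (k : ZMod 2) (x : NT PseudoCircle)
    (Z : LC PseudoCircle) : e (Z, k) * (x * e (Y, k)) ∈ normal₀ Y Z k ∧
      e (Z, k + 1) * (x * e (Y, k)) ∈ normal₁ Y Z k := by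
  let T : AddSubgroup (NT PseudoCircle) :=
    { carrier := {y | ∀ Z, e (Z, k) * y ∈ normal₀ Y Z k ∧ e (Z, k + 1) * y ∈ normal₁ Y Z k}
      zero_mem' := fun Z => by simp [zero_mem]
      add_mem' := fun hx hy Z => by
        rw [mul_add, mul_add]
        exact ⟨add_mem (hx Z).1 (hy Z).1, add_mem (hx Z).2 (hy Z).2⟩
      neg_mem' := fun hx Z => by
        rw [mul_neg, mul_neg]
        exact ⟨neg_mem (hx Z).1, neg_mem (hx Z).2⟩ }
  let S : Subring (NT PseudoCircle) :=
    { carrier := {x | ∀ y ∈ T, x * y ∈ T}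
      mul_mem' := fun {a b} ha hb y hy => by rw [mul_assoc]; exact ha _ (hb y hy)
      one_mem' := fun y hy => by rwa [one_mul]
      add_mem' := fun {a b} ha hb y hy => by rw [add_mul]; exact add_mem (ha y hy) (hb y hy)
      zero_mem' := fun y _ => by rw [zero_mul]; exact zero_mem _
      neg_mem' := fun {a} ha y hy => by rw [neg_mul]; exact neg_mem (ha y hy) }
  have hS : x ∈ S := by
    -- It suffices to check the component at the target.
    have key : ∀ (b : Obj PseudoCircle) (z : NT PseudoCircle), e b * z = z →
        (b.2 = k → z ∈ normal₀ Y b.1 k) → (b.2 = k + 1 → z ∈ normal₁ Y b.1 k) → z ∈ T := by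
      rintro ⟨Z', j⟩ z hz h0 h1 Z
      rw [← hz, ← mul_assoc, ← mul_assoc]
      constructor
      · by_cases h : (Z, k) = (Z', j)
        · obtain ⟨rfl, rfl⟩ := Prod.ext_iff.1 h
          rw [e_mul_self, hz]
          exact h0 rfl
        · rw [e_mul_e h, zero_mul]
          exact zero_mem _
      · by_cases h : (Z, k + 1) = (Z', j)
        · obtain ⟨rfl, rfl⟩ := Prod.ext_iff.1 h
          rw [e_mul_self, hz]
          exact h1 rfl
        · rw [e_mul_e h, zero_mul]
          exact zero_mem _
    refine NT.induction (fun b y hy => ?_) (fun {a b} g y hy => ?_) x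
    · refine key b _ (by rw [← mul_assoc, e_mul_self]) ?_ ?_
      · intro h
        rw [← Prod.mk.eta (p := b), h]
        exact (hy _).1
      · intro h
        rw [← Prod.mk.eta (p := b), h]
        exact (hy _).2
    · refine key b _ (by rw [← mul_assoc, NT.target_mul]) ?_ ?_
      · intro h
        rw [← mul_source, mul_assoc]
        cases g with
        | i hi j => obtain rfl : j = k := h; exact i_mul_normal₀ hi (hy _).1
        | r hr j => obtain rfl : j = k := h; exact r_mul_normal₀ hr (hy _).1
        | δ hb j =>
          obtain rfl : j = k + 1 := (eq_or_eq_add_one j k).resolve_left fun h' =>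
            ne_add_one k (by rw [← h'] at h ⊢; exact h.symm)
          rw [δ_mul_normal₁ hb (hy _).2]
          exact zero_mem _
      · intro h
        rw [← mul_source, mul_assoc]
        cases g with
        | i hi j => obtain rfl : j = k + 1 := h; exact i_mul_normal₁ hi (hy _).2
        | r hr j => obtain rfl : j = k + 1 := h; exact r_mul_normal₁ hr (hy _).2
        | δ hb j =>
          obtain rfl : j = k := add_right_cancel h
          exact δ_mul_normal₀ hb (hy _).1
  refine hS (e (Y, k)) (fun Z => ⟨?_, ?_⟩) Z
  · by_cases h : Z = Y
    · subst h
      rw [e_mul_self]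
      exact AddSubgroup.subset_closure
        ⟨Z, .refl Z, .refl Z, by rw [i_self, r_self, e_mul_self]⟩
    · rw [e_mul_e (fun h' => h (Prod.ext_iff.1 h').1)]
      exact zero_mem _
  · rw [e_mul_e (fun h' => ne_add_one k (Prod.ext_iff.1 h').2.symm)]
    exact zero_mem _

end PseudoCircle

/-! ### The complexes of representable modules -/

section

variable {X : Type} [TopologicalSpace X] [Finite X]

open FilteredComplex in
/-- A criterion for the bijectivity of the map `x ↦ x • w` from the morphisms `a → c` to the
component at `c` of the homology of `A`: the morphisms are spanned by a family `f`, the cycles by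
the family `v` corresponding to `f`, and all relations modulo boundaries between the latter hold
between the former. -/
theorem bijective_component (A : FilteredComplex X) {a c : Obj X} {w : A.Homology}
    {S : AddSubgroup (NT X)} (hS : ∀ x, NT.e c * (x * NT.e a) ∈ S) {P : Type} [Fintype P]
    (f : P → NT X) (v : P → A.Cycle c) (hf : S ≤ AddSubgroup.closure (Set.range f))
    (hfa : ∀ p, f p * NT.e a = f p) (hfv : ∀ p, f p • w = cls c (v p))
    (hv : ∀ x : A.Cycle c, ∃ n : P → ℤ, x = ∑ p, n p • v p)
    (hrel : ∀ n : P → ℤ, ((∑ p, n p • v p : A.Cycle c) : A.I → ℤ) ∈ A.Bdry c →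
      ∑ p, n p • f p = 0) :
    (∀ x, x * NT.e a = x → NT.e c * x = x → x • w = 0 → x = 0) ∧
      ∀ y, NT.e c • y = y → ∃ x, x * NT.e a = x ∧ x • w = y := by
  have hw : ∀ n : P → ℤ, (∑ p, n p • f p) • w = cls c (∑ p, n p • v p) := fun n => by
    rw [Finset.sum_smul, map_sum]
    refine Finset.sum_congr rfl fun p _ => ?_
    rw [map_zsmul, ← hfv, smul_assoc]
  constructor
  · intro x hxa hxc hx
    have hxS : x ∈ AddSubgroup.closure (Set.range f) := hf (by rw [← hxc, ← hxa]; exact hS x)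
    have : ∃ n : P → ℤ, x = ∑ p, n p • f p := by
      clear hx hxa hxc
      classical
      induction hxS using AddSubgroup.closure_induction with
      | mem y hy =>
        obtain ⟨p, rfl⟩ := hy
        exact ⟨Pi.single p 1, by simp [Pi.single_apply, ite_smul]⟩
      | zero => exact ⟨0, by simp⟩
      | add y z _ _ hy hz =>
        obtain ⟨n, rfl⟩ := hy
        obtain ⟨m, rfl⟩ := hz
        exact ⟨n + m, by simp [add_smul, Finset.sum_add_distrib]⟩
      | neg y _ hy =>
        obtain ⟨n, rfl⟩ := hy
        exact ⟨-n, by simp⟩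
    obtain ⟨n, rfl⟩ := this
    rw [hw, cls_eq_zero] at hx
    exact hrel n hx
  · intro y hy
    obtain ⟨x, rfl⟩ := exists_cls hy
    obtain ⟨n, rfl⟩ := hv x
    refine ⟨∑ p, n p • f p, ?_, hw n⟩
    rw [Finset.sum_mul]
    exact Finset.sum_congr rfl fun p _ => by rw [smul_mul_assoc, hfa]

end

namespace PseudoCircle

open NT

theorem i_mul_r_eq_add {Y Z W W₁ W₂ : LC PseudoCircle} (hd : Disjoint W₁.1 W₂.1)
    (hW : W.1 = W₁.1 ∪ W₂.1) (h₁ : IsOpenIn W₁ W) (h₁' : IsClosedIn W₁ W) (h₂ : IsOpenIn W₂ W)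
    (h₂' : IsClosedIn W₂ W) (hi : IsOpenIn W Z) (hr : IsClosedIn W Y) (hi₁ : IsOpenIn W₁ Z)
    (hr₁ : IsClosedIn W₁ Y) (hi₂ : IsOpenIn W₂ Z) (hr₂ : IsClosedIn W₂ Y) (k : ZMod 2) :
    of (Gen.i hi k) * of (Gen.r hr k) =
      of (Gen.i hi₁ k) * of (Gen.r hr₁ k) + of (Gen.i hi₂ k) * of (Gen.r hr₂ k) := by
  rw [← mul_source (Gen.i hi k), ← disjoint_union hd hW h₁ h₁' h₂ h₂', mul_add, add_mul,
    ← mul_assoc, ← mul_assoc, i_comp, i_comp, mul_assoc, mul_assoc, r_comp, r_comp]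

/-- The morphisms from `Y = lc A B` to `Z = lc A' B'` given by the boundary map from the part of
`C` in `Y` to the part of `U` in `Z`. -/
noncomputable def path (A B A' B' : Finset Bool) (k : ZMod 2) (C U : Finset Bool) :
    NT PseudoCircle :=
  of (Gen.i (isOpenIn_lc.2 ⟨Finset.empty_subset A', Finset.inter_subset_left (s₁ := B') (s₂ := U),
    Or.inl rfl⟩) (k + 1)) * of (Gen.δ (isBoundaryPair_clo_opn (A ∩ C) (B' ∩ U)) k) *
  of (Gen.r (isClosedIn_lc.2 ⟨Finset.inter_subset_left (s₁ := A) (s₂ := C),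
    Finset.empty_subset B, Or.inl rfl⟩) k)

section path

variable {A B A' B' : Finset Bool} {k : ZMod 2} {C U : Finset Bool}

theorem path_mul_e : path A B A' B' k C U * e (lc A B, k) = path A B A' B' k C U := by
  rw [path, mul_assoc, mul_source]

theorem path_eq {hi : IsOpenIn (lc ∅ U) (lc A' B')} {hr : IsClosedIn (lc C ∅) (lc A B)} :
    path A B A' B' k C U = of (Gen.i hi (k + 1)) *
      of (Gen.δ (isBoundaryPair_clo_opn C U) k) * of (Gen.r hr k) := by
  have h1 : A ∩ C = C := Finset.inter_eq_right.2 (isClosedIn_lc.1 hr).1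
  have h2 : B' ∩ U = U := Finset.inter_eq_right.2 (isOpenIn_lc.1 hi).2.1
  have key : ∀ (C' U' : Finset Bool) (hi' : IsOpenIn (lc ∅ U') (lc A' B'))
      (hr' : IsClosedIn (lc C' ∅) (lc A B)), C' = C → U' = U → of (Gen.i hi' (k + 1)) *
        of (Gen.δ (isBoundaryPair_clo_opn C' U') k) * of (Gen.r hr' k) = of (Gen.i hi (k + 1)) *
        of (Gen.δ (isBoundaryPair_clo_opn C U) k) * of (Gen.r hr k) := by
    rintro _ _ _ _ rfl rfl
    rfl
  exact key _ _ _ _ h1 h2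

theorem path_eq_zero_left (h : A ∩ C = ∅) : path A B A' B' k C U = 0 := by
  rw [path, of_eq_zero_of_target (Gen.r _ _) (e_eq_zero (by rw [h, lc_empty]) k), mul_zero]

theorem path_eq_zero_right (h : B' ∩ U = ∅) : path A B A' B' k C U = 0 := by
  rw [path, of_eq_zero_of_source (Gen.i _ _) (e_eq_zero (by rw [h, lc_empty]) _), zero_mul,
    zero_mul]

theorem path_union_left {C' : Finset Bool} (h : Disjoint C C') :
    path A B A' B' k (C ∪ C') U = path A B A' B' k C U + path A B A' B' k C' U := by
  have h1 : A ∩ C ⊆ A ∩ (C ∪ C') := Finset.inter_subset_inter_left Finset.subset_union_left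
  have h2 : A ∩ C' ⊆ A ∩ (C ∪ C') := Finset.inter_subset_inter_left Finset.subset_union_right
  have h3 := disjoint_union (X := PseudoCircle)
    (disjoint_lc.2 ⟨h.mono (Finset.inter_subset_right (s₁ := A))
      (Finset.inter_subset_right (s₁ := A)), Finset.disjoint_empty_left ∅⟩)
    (by rw [← lc_union, ← Finset.inter_union_distrib_left, Finset.empty_union])
    (isOpenIn_clo h1) (isClosedIn_clo_of_subset h1)
    (isOpenIn_clo h2) (isClosedIn_clo_of_subset h2) k
  rw [path, ← mul_source (Gen.δ _ _), ← h3]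
  have hr (C : Finset Bool) : IsClosedIn (lc (A ∩ C) ∅) (lc A B) :=
    isClosedIn_lc.2 ⟨Finset.inter_subset_left, Finset.empty_subset _, Or.inl rfl⟩
  simp only [mul_add, add_mul, mul_assoc]
  rw [r_comp _ _ (hr C), r_comp _ _ (hr C'), ← mul_assoc (of (Gen.δ _ _)),
    ← mul_assoc (of (Gen.δ _ _)),
    δ_i _ _ (isBoundaryPair_clo_opn _ _), δ_i _ _ (isBoundaryPair_clo_opn _ _), path, path,
    mul_assoc, mul_assoc]

theorem path_union_right {U' : Finset Bool} (h : Disjoint U U') :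
    path A B A' B' k C (U ∪ U') = path A B A' B' k C U + path A B A' B' k C U' := by
  have h1 : B' ∩ U ⊆ B' ∩ (U ∪ U') := Finset.inter_subset_inter_left Finset.subset_union_left
  have h2 : B' ∩ U' ⊆ B' ∩ (U ∪ U') := Finset.inter_subset_inter_left Finset.subset_union_right
  have h3 := disjoint_union (X := PseudoCircle)
    (disjoint_lc.2 ⟨Finset.disjoint_empty_left ∅, h.mono (Finset.inter_subset_right (s₁ := B'))
      (Finset.inter_subset_right (s₁ := B'))⟩)
    (by rw [← lc_union, ← Finset.inter_union_distrib_left, Finset.empty_union])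
    (isOpenIn_opn_of_subset h1) (isClosedIn_opn h1)
    (isOpenIn_opn_of_subset h2) (isClosedIn_opn h2) (k + 1)
  rw [path, ← NT.target_mul (Gen.δ _ _), ← h3]
  have hi (U : Finset Bool) : IsOpenIn (lc ∅ (B' ∩ U)) (lc A' B') :=
    isOpenIn_lc.2 ⟨Finset.empty_subset _, Finset.inter_subset_left, Or.inl rfl⟩
  simp only [mul_add, add_mul, ← mul_assoc]
  rw [i_comp _ _ (hi U), i_comp _ _ (hi U'),
    mul_assoc (of (Gen.i (hi U) _)) (of (Gen.r _ _)) (of (Gen.δ _ _)),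
    mul_assoc (of (Gen.i (hi U') _)) (of (Gen.r _ _)) (of (Gen.δ _ _)),
    r_δ _ _ (isBoundaryPair_clo_opn _ _), r_δ _ _ (isBoundaryPair_clo_opn _ _), path, path]

theorem path_eq_sum_left : path A B A' B' k C U = ∑ a ∈ C, path A B A' B' k {a} U := by
  induction C using Finset.induction_on with
  | empty => rw [path_eq_zero_left (Finset.inter_empty _), Finset.sum_empty]
  | insert a C ha ih =>
    rw [Finset.sum_insert ha, ← ih, Finset.insert_eq,
      path_union_left (Finset.disjoint_singleton_left.2 ha)]

theorem path_eq_sum_right : path A B A' B' k C U = ∑ b ∈ U, path A B A' B' k C {b} := by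
  induction U using Finset.induction_on with
  | empty => rw [path_eq_zero_right (Finset.inter_empty _), Finset.sum_empty]
  | insert a C ha ih =>
    rw [Finset.sum_insert ha, ← ih, Finset.insert_eq,
      path_union_right (Finset.disjoint_singleton_left.2 ha)]

/-- The boundary map from a closed point in `Z` to the open points of `Z` vanishes in `Z`. -/
theorem path_opn_eq_zero {a : Bool} (ha : a ∈ A') : path A B A' B' k {a} B' = 0 := by
  by_cases ha' : a ∈ A
  · have h1 : IsExtension (lc ∅ B') (lc {a} B') (lc {a} ∅) := isExtension_lc.2 (by simp)
    have h2 : IsOpenIn (lc {a} B') (lc A' B') := isOpenIn_lc.2 (by simpa)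
    rw [path_eq (hi := isOpenIn_opn A' B') (hr := isClosedIn_lc.2 (by simpa)),
      ← i_comp h1.1 h2, mul_assoc (of (Gen.i _ _)), i_mul_δ h1, mul_zero, zero_mul]
  · exact path_eq_zero_left (Finset.inter_singleton_of_notMem ha')

/-- The boundary map from the closed points of `Y` to an open point in `Y` vanishes on `Y`. -/
theorem path_clo_eq_zero {b : Bool} (hb : b ∈ B) : path A B A' B' k A {b} = 0 := by
  by_cases hb' : b ∈ B'
  · have h1 : IsExtension (lc ∅ {b}) (lc A {b}) (lc A ∅) := isExtension_lc.2 (by simp)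
    have h2 : IsClosedIn (lc A {b}) (lc A B) := isClosedIn_lc.2 (by simpa)
    rw [path_eq (hr := isClosedIn_clo A B) (hi := isOpenIn_lc.2 (by simpa)),
      ← r_comp h2 h1.isClosedIn, mul_assoc, ← mul_assoc (of (Gen.δ _ _)), δ_mul_r h1, zero_mul,
      mul_zero]
  · exact path_eq_zero_right (Finset.inter_singleton_of_notMem hb')

end path

/-- The filtered complex whose homology is the module represented by the object `(lc A B)_k`. It has
generators of degree `k` at all points of `lc A B`, and a generator of degree `k + 1` at each open
point `b` for each closed point `a` in `A`. The latter corresponds to the boundary map from `a` to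
`b`, and the differential encodes that these sum up to zero in the two situations of
`path_opn_eq_zero` and `path_clo_eq_zero`. -/
abbrev repComplex (A B : Finset Bool) (k : ZMod 2) : FilteredComplex PseudoCircle where
  I := A ⊕ B ⊕ A × Bool
  pos
    | .inl a => clo a
    | .inr (.inl b) => opn b
    | .inr (.inr p) => opn p.2
  deg
    | .inl _ => k
    | .inr (.inl _) => k
    | .inr (.inr _) => k + 1
  d :=
    { toFun := fun g i => match i with
        | .inl _ => 0
        | .inr (.inl _) => 0
        | .inr (.inr p) => g (.inl p.1) - if h : p.2 ∈ B then g (.inr (.inl ⟨p.2, h⟩)) else 0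
      map_zero' := by
        ext i
        rcases i with a | b | p <;> simp
      map_add' := fun x y => by
        ext i
        rcases i with a | b | p
        · simp
        · simp
        · by_cases h : p.2 ∈ B
          · simp [h]; ring
          · simp [h] }
  d_d g := by
    ext i
    rcases i with a | b | p <;> simp
  d_supp O hO j g hg i hi := by
    rw [isOpen_iff_forall] at hO
    rcases i with a | b | p
    · rfl
    · rfl
    · have hp : ¬(opn p.2 ∈ O ∧ k = j) := fun h => hi ⟨h.1, congrArg (· + 1) h.2⟩
      have h1 : g (.inl p.1) = 0 := hg _ fun h => hp ⟨hO _ h.1 _, h.2⟩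
      change g (.inl p.1) - _ = (0 : ℤ)
      rw [h1]
      split_ifs with hb
      · have h2 : g (.inr (.inl ⟨p.2, hb⟩)) = 0 := hg _ hp
        rw [h2, sub_zero]
      · exact sub_zero _

section repComplex

open FilteredComplex

variable {A B : Finset Bool} {k : ZMod 2}

theorem repComplex_d_inl (g : (repComplex A B k).I → ℤ) (a : A) :
    (repComplex A B k).d g (.inl a) = 0 := rfl

theorem repComplex_d_inr_inl (g : (repComplex A B k).I → ℤ) (b : B) :
    (repComplex A B k).d g (.inr (.inl b)) = 0 := rfl

theorem repComplex_d_inr_inr (g : (repComplex A B k).I → ℤ) (p : A × Bool) :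
    (repComplex A B k).d g (.inr (.inr p)) =
      g (.inl p.1) - if h : p.2 ∈ B then g (.inr (.inl ⟨p.2, h⟩)) else 0 := rfl

theorem repComplex_d_eq_zero {g : (repComplex A B k).I → ℤ} {S : Set PseudoCircle}
    (hg : g ∈ (repComplex A B k).Supp S (k + 1)) : (repComplex A B k).d g = 0 := by
  ext i
  rcases i with a | b | p
  · rfl
  · rfl
  · have h1 : g (.inl p.1) = 0 := hg _ fun h => ne_add_one k h.2
    change g (.inl p.1) - _ = (0 : ℤ)
    rw [h1]
    split_ifs with h
    · have h2 : g (.inr (.inl ⟨p.2, h⟩)) = 0 := hg _ fun h => ne_add_one k h.2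
      rw [h2, sub_zero]
    · exact sub_zero _

theorem repComplex_bdry_eq_zero {Z : LC PseudoCircle} {g : (repComplex A B k).I → ℤ}
    (hg : g ∈ (repComplex A B k).Bdry (Z, k)) : g = 0 := by
  obtain ⟨h, hh, rfl⟩ := hg
  change (repComplex A B k).π _ ((repComplex A B k).d h) = 0
  rw [repComplex_d_eq_zero hh, map_zero]

variable (A B k)

/-- The sum of all generators of degree `k`. -/
def repUnit : (repComplex A B k).I → ℤ
  | .inl _ => 1
  | .inr (.inl _) => 1
  | .inr (.inr _) => 0

theorem repUnit_mem_cycle : repUnit A B k ∈ (repComplex A B k).Cycle (lc A B, k) := by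
  constructor
  · intro i hi
    rcases i with a | b | p
    · exact absurd ⟨clo_mem_lc.2 a.2, rfl⟩ hi
    · exact absurd ⟨opn_mem_lc.2 b.2, rfl⟩ hi
    · rfl
  · ext i
    by_cases hi : (repComplex A B k).pos i ∈ (lc A B).1
    · rw [π_of_mem _ hi]
      rcases i with a | b | p
      · rfl
      · rfl
      · have hb : p.2 ∈ B := opn_mem_lc.1 hi
        rw [repComplex_d_inr_inr, dif_pos hb]
        exact sub_self (1 : ℤ)
    · exact π_of_notMem _ hi

/-- The module represented by `(lc A B)_k`. -/
abbrev Rep : Type := (repComplex A B k).Homology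

/-- The universal element of the representable module. -/
noncomputable def repGen : Rep A B k := cls (lc A B, k) ⟨_, repUnit_mem_cycle A B k⟩

end repComplex

end PseudoCircle

/-! ### Representability by filtered complexes -/

namespace PseudoCircle

open NT FilteredComplex

section

variable {A B A' B' : Finset Bool} {k : ZMod 2}

theorem π_repUnit_mem_cycle {W : LC PseudoCircle} (hi : IsOpenIn W (lc A' B'))
    (hr : IsClosedIn W (lc A B)) :
    (repComplex A B k).π W.1 (repUnit A B k) ∈ (repComplex A B k).Cycle (lc A' B', k) :=
  φ_mem_cycle (Gen.i hi k) (φ_mem_cycle (Gen.r hr k) (repUnit_mem_cycle A B k))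

theorem normal₀_smul_repGen {W : LC PseudoCircle} (hi : IsOpenIn W (lc A' B'))
    (hr : IsClosedIn W (lc A B)) :
    (of (Gen.i hi k) * of (Gen.r hr k)) • repGen A B k =
      cls (lc A' B', k) ⟨_, π_repUnit_mem_cycle hi hr⟩ := by
  rw [mul_smul, repGen, of_smul_cls, of_smul_cls]
  rfl

/-- The conclusion of `bijective_component` for representable modules. -/
def BijectiveAt (A B : Finset Bool) (k : ZMod 2) (c : Obj PseudoCircle) : Prop :=
  (∀ x, x * e (lc A B, k) = x → e c * x = x → x • repGen A B k = 0 → x = 0) ∧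
    ∀ y : Rep A B k, e c • y = y → ∃ x, x * e (lc A B, k) = x ∧ x • repGen A B k = y

open Classical in
theorem single_mem_cycle {Z : LC PseudoCircle} {a : A} {b : Bool} (hb : opn b ∈ Z.1) :
    (Pi.single (.inr (.inr (a, b))) 1 : (repComplex A B k).I → ℤ) ∈
      (repComplex A B k).Cycle (Z, k + 1) := by
  have h : (Pi.single (.inr (.inr (a, b))) 1 : (repComplex A B k).I → ℤ) ∈
      (repComplex A B k).Supp Z.1 (k + 1) := fun i hi => by
    refine Pi.single_eq_of_ne ?_ _
    rintro rfl
    exact hi ⟨hb, rfl⟩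
  refine ⟨h, ?_⟩
  rw [repComplex_d_eq_zero h, map_zero]

open Classical in
theorem path_smul_repGen {a : A} {b : Bool} (hb : b ∈ B') :
    path A B A' B' k {a.1} {b} • repGen A B k =
      cls (lc A' B', k + 1) ⟨_, single_mem_cycle (a := a) (opn_mem_lc.2 hb)⟩ := by
  have hi : IsOpenIn (lc ∅ {b}) (lc A' B') := isOpenIn_lc.2 (by simpa)
  have hr : IsClosedIn (lc {a.1} ∅) (lc A B) := isClosedIn_lc.2 (by simp)
  rw [path_eq (hi := hi) (hr := hr), mul_smul, mul_smul, repGen, of_smul_cls, of_smul_cls,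
    of_smul_cls]
  refine congrArg _ (Subtype.ext ?_)
  change (repComplex A B k).π (lc ∅ {b}).1 ((repComplex A B k).d
    ((repComplex A B k).π (lc {a.1} ∅).1 (repUnit A B k))) = Pi.single _ _
  ext i
  by_cases h : (repComplex A B k).pos i ∈ (lc ∅ {b}).1
  · rw [π_of_mem _ h]
    rcases i with a' | b' | ⟨a', b'⟩
    · rw [repComplex_d_inl, Pi.single_eq_of_ne]
      exact Sum.inl_ne_inr
    · rw [repComplex_d_inr_inl, Pi.single_eq_of_ne]
      exact Sum.inr_injective.ne Sum.inl_ne_inr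
    · obtain rfl : b' = b := by simpa using opn_mem_lc.1 h
      have h1 : (if h : b' ∈ B then (repComplex A B k).π (lc {a.1} ∅).1 (repUnit A B k)
          (.inr (.inl ⟨b', h⟩)) else 0) = 0 := by
        split_ifs
        · exact π_of_notMem _ fun h => by simpa using opn_mem_lc.1 h
        · rfl
      rw [repComplex_d_inr_inr, h1, sub_zero]
      by_cases haa : a' = a
      · subst haa
        rw [Pi.single_eq_same]
        exact π_of_mem _ (clo_mem_lc.2 (by simp))
      · rw [Pi.single_eq_of_ne (by simpa using haa)]
        refine π_of_notMem _ fun h => haa (Subtype.ext ?_)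
        simpa using clo_mem_lc.1 h
  · rw [π_of_notMem _ h, Pi.single_eq_of_ne]
    rintro rfl
    exact h (opn_mem_lc.2 (by simp))

open Classical in
theorem bijectiveAt_one : BijectiveAt A B k (lc A' B', k + 1) := by
  refine bijective_component _ (fun x => (mem_normal _ _ x _).2) (P := A × B')
    (fun p => path A B A' B' k {p.1.1} {p.2.1})
    (fun p => ⟨_, single_mem_cycle (a := p.1) (opn_mem_lc.2 p.2.2)⟩) ?_ (fun p => path_mul_e)
    (fun p => path_smul_repGen p.2.2) ?_ ?_
  · refine (AddSubgroup.closure_le _).2 ?_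
    rintro _ ⟨C, U, hi, hr, rfl⟩
    rw [← path_eq, path_eq_sum_left]
    refine sum_mem fun a ha => ?_
    rw [path_eq_sum_right]
    refine sum_mem fun b hb => AddSubgroup.subset_closure ?_
    exact ⟨(⟨a, (isClosedIn_lc.1 hr).1 ha⟩, ⟨b, (isOpenIn_lc.1 hi).2.1 hb⟩), rfl⟩
  · rintro ⟨x, hx, -⟩
    refine ⟨fun p => x (.inr (.inr (p.1, p.2))), Subtype.ext ?_⟩
    rw [AddSubgroup.val_finsetSum]
    ext i
    rw [Finset.sum_apply]
    simp only [AddSubgroup.coe_zsmul, Pi.smul_apply, smul_eq_mul]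
    rcases i with a | b | ⟨a, b⟩
    · rw [Finset.sum_eq_zero fun p _ => by rw [Pi.single_eq_of_ne (by simp), mul_zero]]
      exact hx _ fun h => ne_add_one k h.2
    · rw [Finset.sum_eq_zero fun p _ => by rw [Pi.single_eq_of_ne (by simp), mul_zero]]
      exact hx _ fun h => ne_add_one k h.2
    · by_cases hb : b ∈ B'
      · rw [Finset.sum_eq_single (a, ⟨b, hb⟩), Pi.single_eq_same, mul_one]
        · rintro ⟨a', b'⟩ - hne
          rw [Pi.single_eq_of_ne, mul_zero]
          rintro h
          simp only [Sum.inr.injEq, Prod.mk.injEq] at h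
          exact hne (Prod.ext h.1.symm (Subtype.ext h.2.symm))
        · simp
      · rw [Finset.sum_eq_zero fun p _ => ?_]
        · exact hx _ fun h => hb (opn_mem_lc.1 h.1)
        · rw [Pi.single_eq_of_ne, mul_zero]
          intro h
          simp only [Sum.inr.injEq, Prod.mk.injEq] at h
          exact hb (h.2 ▸ p.2.2)
  · intro n hn
    obtain ⟨h, hh, hhn⟩ := hn
    -- The coefficients are given by the differential of `h`.
    have h1 : ∀ p : A × B', n p = h (.inl p.1) -
        if hb : p.2.1 ∈ B then h (.inr (.inl ⟨p.2.1, hb⟩)) else 0 := by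
      intro p
      have h2 := congrFun hhn (.inr (.inr (p.1, p.2.1)))
      change (repComplex A B k).π _ ((repComplex A B k).d h) _ = _ at h2
      rw [π_of_mem _ (opn_mem_lc.2 p.2.2), repComplex_d_inr_inr, AddSubgroup.val_finsetSum,
        Finset.sum_apply, Finset.sum_eq_single p] at h2
      · simp only [AddSubgroup.coe_zsmul, Pi.smul_apply, smul_eq_mul, Pi.single_eq_same,
          mul_one] at h2
        exact h2.symm
      · rintro ⟨a', b'⟩ - hne
        simp only [AddSubgroup.coe_zsmul, Pi.smul_apply, smul_eq_mul]
        rw [Pi.single_eq_of_ne, mul_zero]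
        rintro h
        simp only [Sum.inr.injEq, Prod.mk.injEq] at h
        exact hne (Prod.ext h.1.symm (Subtype.ext h.2.symm))
      · simp
    simp only [h1, sub_smul, Finset.sum_sub_distrib]
    rw [Fintype.sum_prod_type, Fintype.sum_prod_type_right, sub_eq_zero]
    trans 0
    · refine Finset.sum_eq_zero fun a _ => ?_
      change ∑ b : B', h (.inl a) • path A B A' B' k {a.1} {b.1} = 0
      rw [← Finset.smul_sum, Finset.sum_coe_sort B' fun b => path A B A' B' k {a.1} {b},
        ← path_eq_sum_right]
      by_cases ha : a.1 ∈ A'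
      · rw [path_opn_eq_zero ha, smul_zero]
      · rw [show h (.inl a) = 0 from hh _ fun h => ha (clo_mem_lc.1 h.1), zero_smul]
    · refine (Finset.sum_eq_zero fun b _ => ?_).symm
      change ∑ a : A, (if hb : b.1 ∈ B then h (.inr (.inl ⟨b.1, hb⟩)) else 0) •
        path A B A' B' k {a.1} {b.1} = 0
      rw [← Finset.smul_sum, Finset.sum_coe_sort A fun a => path A B A' B' k {a} {b.1},
        ← path_eq_sum_left]
      by_cases hb : b.1 ∈ B
      · rw [path_clo_eq_zero hb, smul_zero]
      · rw [dif_neg hb, zero_smul]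

theorem isOpenIn_singleton_clo {a : Bool} (ha : a ∈ A') : IsOpenIn (lc {a} ∅) (lc A' ∅) :=
  isOpenIn_lc.2 (by simpa)

theorem isClosedIn_singleton_clo {a : Bool} (ha : a ∈ A) : IsClosedIn (lc {a} ∅) (lc A B) :=
  isClosedIn_lc.2 (by simpa)

theorem isOpenIn_singleton_opn {b : Bool} (hb : b ∈ B') : IsOpenIn (lc ∅ {b}) (lc A' B') :=
  isOpenIn_lc.2 (by simpa)

theorem isClosedIn_singleton_opn {b : Bool} (hb : b ∈ B) : IsClosedIn (lc ∅ {b}) (lc ∅ B) :=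
  isClosedIn_lc.2 (by simpa)

open Classical in
theorem bijectiveAt_zero_of_clo : BijectiveAt A B k (lc A' ∅, k) := by
  refine bijective_component _ (fun x => (mem_normal _ _ x _).1) (P := (A ∩ A' : Finset Bool))
    (fun p => of (Gen.i (isOpenIn_singleton_clo (Finset.mem_inter.1 p.2).2) k) *
      of (Gen.r (isClosedIn_singleton_clo (Finset.mem_inter.1 p.2).1) k))
    (fun p => ⟨_, π_repUnit_mem_cycle (isOpenIn_singleton_clo (Finset.mem_inter.1 p.2).2)
      (isClosedIn_singleton_clo (Finset.mem_inter.1 p.2).1)⟩) ?_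
    (fun p => by rw [mul_assoc, mul_source])
    (fun p => normal₀_smul_repGen _ _) ?_ ?_
  · refine (AddSubgroup.closure_le _).2 ?_
    rintro _ ⟨W, hi, hr, rfl⟩
    obtain ⟨C, D, rfl⟩ := exists_lc W
    obtain rfl : D = ∅ := Finset.subset_empty.1 (isOpenIn_lc.1 hi).2.1
    have hC := (isOpenIn_lc.1 hi).1
    have hC' := (isClosedIn_lc.1 hr).1
    induction C using Finset.induction_on with
    | empty =>
      rw [of_eq_zero_of_source _ (e_eq_zero lc_empty k), zero_mul]
      exact zero_mem _
    | insert a C ha ih =>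
      have h1 : C ⊆ insert a C := Finset.subset_insert a C
      have h2 : {a} ⊆ insert a C := Finset.singleton_subset_iff.2 (Finset.mem_insert_self a C)
      have hi₂ := isOpenIn_clo (h1.trans hC)
      have hr₂ : IsClosedIn (lc C ∅) (lc A B) := isClosedIn_lc.2
        ⟨h1.trans hC', Finset.empty_subset _, Or.inl rfl⟩
      rw [i_mul_r_eq_add (disjoint_lc.2 ⟨Finset.disjoint_singleton_left.2 ha,
        Finset.disjoint_empty_left ∅⟩) (by rw [← lc_union, Finset.insert_eq, Finset.empty_union])
        (isOpenIn_clo h2) (isClosedIn_clo_of_subset h2) (isOpenIn_clo h1)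
        (isClosedIn_clo_of_subset h1) hi hr
        (isOpenIn_singleton_clo (hC (Finset.mem_insert_self a C)))
        (isClosedIn_singleton_clo (hC' (Finset.mem_insert_self a C))) hi₂ hr₂]
      exact add_mem (AddSubgroup.subset_closure ⟨⟨a, Finset.mem_inter.2
        ⟨hC' (Finset.mem_insert_self a C), hC (Finset.mem_insert_self a C)⟩⟩, rfl⟩)
        (ih hi₂ hr₂ (h1.trans hC) (h1.trans hC'))
  · rintro ⟨x, hx, -⟩
    refine ⟨fun p => x (.inl ⟨p, (Finset.mem_inter.1 p.2).1⟩), Subtype.ext ?_⟩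
    rw [AddSubgroup.val_finsetSum]
    ext i
    rw [Finset.sum_apply]
    simp only [AddSubgroup.coe_zsmul, Pi.smul_apply, smul_eq_mul]
    rcases i with a | b | p
    · by_cases ha : a.1 ∈ A'
      · rw [Finset.sum_eq_single ⟨a, Finset.mem_inter.2 ⟨a.2, ha⟩⟩,
          π_of_mem _ (clo_mem_lc.2 (Finset.mem_singleton_self _))]
        · exact (mul_one (x (.inl a))).symm
        · rintro a' - hne
          rw [π_of_notMem, mul_zero]
          exact fun h => hne (Subtype.ext (Finset.mem_singleton.1 (clo_mem_lc.1 h)).symm)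
        · simp
      · rw [Finset.sum_eq_zero fun p _ => ?_]
        · exact hx _ fun h => ha (clo_mem_lc.1 h.1)
        · rw [π_of_notMem, mul_zero]
          intro h
          have := Finset.mem_singleton.1 (clo_mem_lc.1 h)
          exact ha (this ▸ (Finset.mem_inter.1 p.2).2)
    · rw [Finset.sum_eq_zero fun p _ => ?_]
      · exact hx _ fun h => by simpa using opn_mem_lc.1 h.1
      · rw [π_of_notMem, mul_zero]
        exact fun h => by simpa using opn_mem_lc.1 h
    · rw [Finset.sum_eq_zero fun p _ => ?_]
      · exact hx _ fun h => ne_add_one k h.2.symm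
      · rw [π_of_notMem, mul_zero]
        exact fun h => by simpa using opn_mem_lc.1 h
  · intro n hn
    refine Finset.sum_eq_zero fun p _ => ?_
    have h1 := congrFun (repComplex_bdry_eq_zero hn) (.inl ⟨p, (Finset.mem_inter.1 p.2).1⟩)
    rw [AddSubgroup.val_finsetSum, Finset.sum_apply, Finset.sum_eq_single p] at h1
    · simp only [AddSubgroup.coe_zsmul, Pi.smul_apply, smul_eq_mul] at h1
      rw [π_of_mem _ (clo_mem_lc.2 (Finset.mem_singleton_self _))] at h1
      rw [show n p = 0 from (mul_one (n p)).symm.trans h1, zero_smul]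
    · rintro a' - hne
      simp only [AddSubgroup.coe_zsmul, Pi.smul_apply, smul_eq_mul]
      rw [π_of_notMem, mul_zero]
      exact fun h => hne (Subtype.ext (Finset.mem_singleton.1 (clo_mem_lc.1 h)).symm)
    · simp

open Classical in
theorem bijectiveAt_zero_of_opn : BijectiveAt ∅ B k (lc A' B', k) := by
  refine bijective_component _ (fun x => (mem_normal _ _ x _).1) (P := (B ∩ B' : Finset Bool))
    (fun p => of (Gen.i (isOpenIn_singleton_opn (Finset.mem_inter.1 p.2).2) k) *
      of (Gen.r (isClosedIn_singleton_opn (Finset.mem_inter.1 p.2).1) k))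
    (fun p => ⟨_, π_repUnit_mem_cycle (isOpenIn_singleton_opn (Finset.mem_inter.1 p.2).2)
      (isClosedIn_singleton_opn (Finset.mem_inter.1 p.2).1)⟩) ?_
    (fun p => by rw [mul_assoc, mul_source])
    (fun p => normal₀_smul_repGen _ _) ?_ ?_
  · refine (AddSubgroup.closure_le _).2 ?_
    rintro _ ⟨W, hi, hr, rfl⟩
    obtain ⟨D, C, rfl⟩ := exists_lc W
    obtain rfl : D = ∅ := Finset.subset_empty.1 (isClosedIn_lc.1 hr).1
    have hC := (isOpenIn_lc.1 hi).2.1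
    have hC' := (isClosedIn_lc.1 hr).2.1
    induction C using Finset.induction_on with
    | empty =>
      rw [of_eq_zero_of_source _ (e_eq_zero lc_empty k), zero_mul]
      exact zero_mem _
    | insert a C ha ih =>
      have h1 : C ⊆ insert a C := Finset.subset_insert a C
      have h2 : {a} ⊆ insert a C := Finset.singleton_subset_iff.2 (Finset.mem_insert_self a C)
      have hr₂ := isClosedIn_opn (h1.trans hC')
      have hi₂ : IsOpenIn (lc ∅ C) (lc A' B') := isOpenIn_lc.2
        ⟨Finset.empty_subset _, h1.trans hC, Or.inl rfl⟩
      rw [i_mul_r_eq_add (disjoint_lc.2 ⟨Finset.disjoint_empty_left ∅,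
        Finset.disjoint_singleton_left.2 ha⟩)
        (by rw [← lc_union, Finset.insert_eq, Finset.empty_union])
        (isOpenIn_opn_of_subset h2) (isClosedIn_opn h2) (isOpenIn_opn_of_subset h1)
        (isClosedIn_opn h1) hi hr
        (isOpenIn_singleton_opn (hC (Finset.mem_insert_self a C)))
        (isClosedIn_singleton_opn (hC' (Finset.mem_insert_self a C))) hi₂ hr₂]
      exact add_mem (AddSubgroup.subset_closure ⟨⟨a, Finset.mem_inter.2
        ⟨hC' (Finset.mem_insert_self a C), hC (Finset.mem_insert_self a C)⟩⟩, rfl⟩)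
        (ih hi₂ hr₂ (h1.trans hC) (h1.trans hC'))
  · rintro ⟨x, hx, -⟩
    refine ⟨fun p => x (.inr (.inl ⟨p, (Finset.mem_inter.1 p.2).1⟩)), Subtype.ext ?_⟩
    rw [AddSubgroup.val_finsetSum]
    ext i
    rw [Finset.sum_apply]
    simp only [AddSubgroup.coe_zsmul, Pi.smul_apply, smul_eq_mul]
    rcases i with a | b | p
    · exact absurd a.2 (Finset.notMem_empty _)
    · by_cases hb : b.1 ∈ B'
      · rw [Finset.sum_eq_single ⟨b, Finset.mem_inter.2 ⟨b.2, hb⟩⟩,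
          π_of_mem _ (opn_mem_lc.2 (Finset.mem_singleton_self _))]
        · exact (mul_one (x (.inr (.inl b)))).symm
        · rintro b' - hne
          rw [π_of_notMem, mul_zero]
          exact fun h => hne (Subtype.ext (Finset.mem_singleton.1 (opn_mem_lc.1 h)).symm)
        · simp
      · rw [Finset.sum_eq_zero fun p _ => ?_]
        · exact hx _ fun h => hb (opn_mem_lc.1 h.1)
        · rw [π_of_notMem, mul_zero]
          intro h
          have := Finset.mem_singleton.1 (opn_mem_lc.1 h)
          exact hb (this ▸ (Finset.mem_inter.1 p.2).2)
    · exact absurd p.1.2 (Finset.notMem_empty _)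
  · intro n hn
    refine Finset.sum_eq_zero fun p _ => ?_
    have h1 := congrFun (repComplex_bdry_eq_zero hn)
      (.inr (.inl ⟨p, (Finset.mem_inter.1 p.2).1⟩))
    rw [AddSubgroup.val_finsetSum, Finset.sum_apply, Finset.sum_eq_single p] at h1
    · simp only [AddSubgroup.coe_zsmul, Pi.smul_apply, smul_eq_mul] at h1
      rw [π_of_mem _ (opn_mem_lc.2 (Finset.mem_singleton_self _))] at h1
      rw [show n p = 0 from (mul_one (n p)).symm.trans h1, zero_smul]
    · rintro a' - hne
      simp only [AddSubgroup.coe_zsmul, Pi.smul_apply, smul_eq_mul]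
      rw [π_of_notMem, mul_zero]
      exact fun h => hne (Subtype.ext (Finset.mem_singleton.1 (opn_mem_lc.1 h)).symm)
    · simp

/-- The cycle condition: the coefficient of a closed point in `A` agrees with that of an open point
in `B'`. -/
theorem cycle_apply {x : (repComplex A B k).I → ℤ}
    (hx : x ∈ (repComplex A B k).Cycle (lc A' B', k)) (a : A) {b : Bool} (hb : b ∈ B') :
    x (.inl a) = if h : b ∈ B then x (.inr (.inl ⟨b, h⟩)) else 0 := by
  have h1 := congrFun hx.2 (.inr (.inr (a, b)))
  rw [π_of_mem _ (opn_mem_lc.2 hb), repComplex_d_inr_inr] at h1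
  exact sub_eq_zero.1 h1

theorem subset_of_isOpenIn_of_isClosedIn (hA : A.Nonempty) (hB : B'.Nonempty) {C D : Finset Bool}
    (hi : IsOpenIn (lc C D) (lc A' B')) (hr : IsClosedIn (lc C D) (lc A B)) :
    (C = ∅ ∧ D = ∅) ∨ (C = A ∧ D = B' ∧ A ⊆ A' ∧ B' ⊆ B) := by
  obtain ⟨h1, h2, h3⟩ := isOpenIn_lc.1 hi
  obtain ⟨h4, h5, h6⟩ := isClosedIn_lc.1 hr
  rcases h3 with rfl | rfl
  · rcases h6 with rfl | rfl
    · exact Or.inl ⟨rfl, rfl⟩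
    · exact absurd rfl hA.ne_empty
  · rcases h6 with rfl | rfl
    · exact absurd rfl hB.ne_empty
    · exact Or.inr ⟨rfl, rfl, h1, h5⟩

theorem bijectiveAt_zero_of_nonempty (hA : A.Nonempty) (hB : B'.Nonempty) :
    BijectiveAt A B k (lc A' B', k) := by
  obtain ⟨a₀, ha₀⟩ := hA
  obtain ⟨b₀, hb₀⟩ := hB
  by_cases hAB : A ⊆ A' ∧ B' ⊆ B
  · have hi : IsOpenIn (lc A B') (lc A' B') := isOpenIn_lc.2 ⟨hAB.1, subset_rfl, Or.inr rfl⟩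
    have hr : IsClosedIn (lc A B') (lc A B) := isClosedIn_lc.2 ⟨subset_rfl, hAB.2, Or.inr rfl⟩
    refine bijective_component _ (fun x => (mem_normal _ _ x _).1) (P := Unit)
      (fun _ => of (Gen.i hi k) * of (Gen.r hr k)) (fun _ => ⟨_, π_repUnit_mem_cycle hi hr⟩) ?_
      (fun p => by rw [mul_assoc, mul_source]) (fun _ => normal₀_smul_repGen _ _) ?_ ?_
    · refine (AddSubgroup.closure_le _).2 ?_
      rintro _ ⟨W, hi, hr, rfl⟩
      obtain ⟨C, D, rfl⟩ := exists_lc W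
      obtain ⟨rfl, rfl⟩ | ⟨rfl, rfl, -⟩ :=
        subset_of_isOpenIn_of_isClosedIn ⟨a₀, ha₀⟩ ⟨b₀, hb₀⟩ hi hr
      · rw [of_eq_zero_of_source _ (e_eq_zero lc_empty k), zero_mul]
        exact zero_mem _
      · exact AddSubgroup.subset_closure ⟨(), rfl⟩
    · rintro ⟨x, hx⟩
      refine ⟨fun _ => x (.inl ⟨a₀, ha₀⟩), Subtype.ext ?_⟩
      rw [Fintype.sum_unique, AddSubgroup.coe_zsmul]
      have h1 : ∀ b (hb : b ∈ B') (a : A), x (.inl a) = x (.inr (.inl ⟨b, hAB.2 hb⟩)) :=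
        fun b hb a => by rw [cycle_apply hx a hb, dif_pos]
      ext i
      rw [Pi.smul_apply, smul_eq_mul]
      rcases i with a | b | p
      · change x (.inl a) = x (.inl ⟨a₀, ha₀⟩) *
          (repComplex A B k).π (lc A B').1 (repUnit A B k) (.inl a)
        rw [π_of_mem _ (clo_mem_lc.2 a.2), h1 b₀ hb₀, h1 b₀ hb₀]
        exact (mul_one _).symm
      · change x (.inr (.inl b)) = x (.inl ⟨a₀, ha₀⟩) *
          (repComplex A B k).π (lc A B').1 (repUnit A B k) (.inr (.inl b))
        by_cases hb : b.1 ∈ B'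
        · rw [π_of_mem _ (opn_mem_lc.2 hb), h1 b.1 hb]
          exact (mul_one _).symm
        · rw [π_of_notMem _ fun h => hb (opn_mem_lc.1 h), mul_zero]
          exact hx.1 _ fun h => hb (opn_mem_lc.1 h.1)
      · change x (.inr (.inr p)) = x (.inl ⟨a₀, ha₀⟩) *
          (repComplex A B k).π (lc A B').1 (repUnit A B k) (.inr (.inr p))
        rw [show x (.inr (.inr p)) = 0 from hx.1 _ fun h => ne_add_one k h.2.symm]
        by_cases hb : p.2 ∈ B'
        · rw [π_of_mem _ (opn_mem_lc.2 hb)]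
          exact (mul_zero _).symm
        · rw [π_of_notMem _ fun h => hb (opn_mem_lc.1 h), mul_zero]
    · intro n hn
      have h1 := congrFun (repComplex_bdry_eq_zero hn) (.inl ⟨a₀, ha₀⟩)
      rw [Fintype.sum_unique] at h1
      change n default * (repComplex A B k).π (lc A B').1 (repUnit A B k) (.inl ⟨a₀, ha₀⟩) = 0 at h1
      rw [π_of_mem _ (clo_mem_lc.2 ha₀)] at h1
      rw [Fintype.sum_unique, show n default = 0 from (mul_one _).symm.trans h1, zero_smul]
  · refine bijective_component _ (fun x => (mem_normal _ _ x _).1) (P := Empty)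
      Empty.elim (fun p => p.elim) ?_ (fun p => p.elim) (fun p => p.elim) ?_ (fun n _ => by simp)
    · refine (AddSubgroup.closure_le _).2 ?_
      rintro _ ⟨W, hi, hr, rfl⟩
      obtain ⟨C, D, rfl⟩ := exists_lc W
      obtain ⟨rfl, rfl⟩ | ⟨-, -, h⟩ :=
        subset_of_isOpenIn_of_isClosedIn ⟨a₀, ha₀⟩ ⟨b₀, hb₀⟩ hi hr
      · rw [of_eq_zero_of_source _ (e_eq_zero lc_empty k), zero_mul]
        exact zero_mem _
      · exact absurd h hAB
    · rintro ⟨x, hx⟩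
      refine ⟨Empty.elim, Subtype.ext ?_⟩
      rw [Finset.univ_eq_empty, Finset.sum_empty]
      -- Some coefficient vanishes, and all coefficients agree.
      have h1 : ∀ a : A, x (.inl a) = 0 := by
        rcases not_and_or.1 hAB with h | h
        · obtain ⟨a, ha, ha'⟩ := Finset.not_subset.1 h
          have h2 : x (.inl ⟨a, ha⟩) = 0 := hx.1 _ fun h => ha' (clo_mem_lc.1 h.1)
          intro a'
          rw [cycle_apply hx a' hb₀, ← cycle_apply hx ⟨a, ha⟩ hb₀, h2]
        · obtain ⟨b, hb, hb'⟩ := Finset.not_subset.1 h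
          intro a
          rw [cycle_apply hx a hb, dif_neg hb']
      ext i
      rcases i with a | b | p
      · exact h1 a
      · by_cases hb : b.1 ∈ B'
        · have h2 := cycle_apply hx ⟨a₀, ha₀⟩ hb
          rw [h1, dif_pos b.2] at h2
          exact h2.symm
        · exact hx.1 _ fun h => hb (opn_mem_lc.1 h.1)
      · exact hx.1 _ fun h => ne_add_one k h.2.symm

theorem bijectiveAt (c : Obj PseudoCircle) : BijectiveAt A B k c := by
  obtain ⟨Z, j⟩ := c
  obtain ⟨A', B', rfl⟩ := exists_lc Z
  obtain rfl | rfl := eq_or_eq_add_one j k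
  · rcases B'.eq_empty_or_nonempty with rfl | hB
    · exact bijectiveAt_zero_of_clo
    · rcases A.eq_empty_or_nonempty with rfl | hA
      · exact bijectiveAt_zero_of_opn
      · exact bijectiveAt_zero_of_nonempty hA hB
  · exact bijectiveAt_one

theorem eq_zero_of_smul_repGen {x : NT PseudoCircle} (hx : x * e (lc A B, k) = x)
    (h : x • repGen A B k = 0) : x = 0 := by
  rw [← one_mul x, ← sum_e, Finset.sum_mul]
  refine Finset.sum_eq_zero fun c _ => (bijectiveAt (A := A) (B := B) (k := k) c).1 _ ?_ ?_ ?_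
  · rw [mul_assoc, hx]
  · rw [← mul_assoc, e_mul_self]
  · rw [mul_smul, h, smul_zero]

theorem exists_smul_repGen (y : Rep A B k) :
    ∃ x, x * e (lc A B, k) = x ∧ x • repGen A B k = y := by
  have h : ∀ c, ∃ x, x * e (lc A B, k) = x ∧ x • repGen A B k = e c • y := fun c =>
    (bijectiveAt c).2 _ (by rw [← mul_smul, e_mul_self])
  choose x hx hx' using h
  refine ⟨∑ c, x c, ?_, ?_⟩
  · rw [Finset.sum_mul]
    exact Finset.sum_congr rfl fun c _ => hx c
  · rw [Finset.sum_smul, ← sum_e_smul (X := PseudoCircle) y]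
    exact Finset.sum_congr rfl fun c _ => hx' c

end

end PseudoCircle

/-! ### Projectivity and freeness of representable modules -/

namespace PseudoCircle

open NT FilteredComplex

section

variable (A B : Finset Bool) (k : ZMod 2)

theorem e_smul_repGen : e (lc A B, k) • repGen A B k = repGen A B k := e_smul_cls _ _

/-- The inverse of the isomorphism `x ↦ x • repGen A B k` from the left ideal generated by the
idempotent of `(lc A B)_k` to the representable module. -/
noncomputable def repSection : Rep A B k →ₗ[NT PseudoCircle] NT PseudoCircle where
  toFun y := (exists_smul_repGen y).choose
  map_add' y z := by
    obtain ⟨h1, h1'⟩ := (exists_smul_repGen y).choose_spec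
    obtain ⟨h2, h2'⟩ := (exists_smul_repGen z).choose_spec
    obtain ⟨h3, h3'⟩ := (exists_smul_repGen (y + z)).choose_spec
    rw [← sub_eq_zero]
    refine eq_zero_of_smul_repGen (A := A) (B := B) (k := k) ?_ ?_
    · rw [sub_mul, add_mul, h1, h2, h3]
    · rw [sub_smul, add_smul, h1', h2', h3', sub_self]
  map_smul' a y := by
    obtain ⟨h1, h1'⟩ := (exists_smul_repGen y).choose_spec
    obtain ⟨h3, h3'⟩ := (exists_smul_repGen (a • y)).choose_spec
    rw [← sub_eq_zero, RingHom.id_apply, smul_eq_mul]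
    refine eq_zero_of_smul_repGen (A := A) (B := B) (k := k) ?_ ?_
    · rw [sub_mul, mul_assoc, h1, h3]
    · rw [sub_smul, mul_smul, h1', h3', sub_self]

theorem repSection_smul (y : Rep A B k) : repSection A B k y • repGen A B k = y :=
  (exists_smul_repGen y).choose_spec.2

theorem repSection_repGen : repSection A B k (repGen A B k) = e (lc A B, k) := by
  rw [← sub_eq_zero]
  refine eq_zero_of_smul_repGen (A := A) (B := B) (k := k) ?_ ?_
  · rw [sub_mul, e_mul_self]
    exact congrArg (· - _) (exists_smul_repGen (repGen A B k)).choose_spec.1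
  · rw [sub_smul, repSection_smul, e_smul_repGen, sub_self]

instance : Module.Projective (NT PseudoCircle) (Rep A B k) :=
  Module.Projective.of_split (repSection A B k)
    (LinearMap.toSpanSingleton _ _ (repGen A B k))
    (LinearMap.ext fun y => repSection_smul A B k y)

/-- The Yoneda lemma. -/
theorem exists_hom_repGen {M : Type u} [AddCommGroup M] [Module (NT PseudoCircle) M] {m : M}
    (hm : e (lc A B, k) • m = m) :
    ∃ f : Rep A B k →ₗ[NT PseudoCircle] M, f (repGen A B k) = m :=
  ⟨LinearMap.toSpanSingleton _ _ m ∘ₗ repSection A B k, by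
    rw [LinearMap.comp_apply, repSection_repGen, LinearMap.toSpanSingleton_apply, hm]⟩

variable {A B k}

/-- The group of boundaries is a saturated subgroup of the group of cycles, so that homology is
torsion-free. -/
theorem mem_bdry_of_zsmul_mem {a : Obj PseudoCircle} {g : (repComplex A B k).I → ℤ}
    (hg : g ∈ (repComplex A B k).Cycle a) {n : ℤ} (hn : n ≠ 0)
    (h : n • g ∈ (repComplex A B k).Bdry a) : g ∈ (repComplex A B k).Bdry a := by
  obtain ⟨Z, j⟩ := a
  obtain ⟨A', B', rfl⟩ := exists_lc Z
  obtain rfl | rfl := eq_or_eq_add_one j k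
  · have h1 := repComplex_bdry_eq_zero h
    rw [(smul_eq_zero_iff_right hn).1 h1]
    exact zero_mem _
  obtain ⟨x, hx, hxg⟩ := h
  by_cases hg0 : g = 0
  · rw [hg0]
    exact zero_mem _
  -- Only the generators of degree `k + 1` over `B'` contribute.
  have hsupp : ∀ i, g i ≠ 0 → ∃ (a : A) (b : Bool), b ∈ B' ∧ i = .inr (.inr (a, b)) := by
    intro i hi
    rcases i with a | b | ⟨a, b⟩
    · exact absurd (hg.1 (.inl a) fun h => ne_add_one k h.2) hi
    · exact absurd (hg.1 (.inr (.inl b)) fun h => ne_add_one k h.2) hi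
    · refine ⟨a, b, ?_, rfl⟩
      by_contra hb
      exact hi (hg.1 _ fun h => hb (opn_mem_lc.1 h.1))
  obtain ⟨i, hi⟩ := Function.ne_iff.1 hg0
  obtain ⟨a₀, b₀, hb₀, rfl⟩ := hsupp i hi
  clear hi
  let y : Bool → ℤ := fun b => if h : b ∈ B then x (.inr (.inl ⟨b, h⟩)) else 0
  have key : ∀ (a : A) (b : Bool), b ∈ B' → n * g (.inr (.inr (a, b))) = x (.inl a) - y b := by
    intro a b hb
    have h1 := congrFun hxg (.inr (.inr (a, b)))
    change (repComplex A B k).π _ ((repComplex A B k).d x) _ = n * g _ at h1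
    rw [π_of_mem _ (opn_mem_lc.2 hb), repComplex_d_inr_inr] at h1
    exact h1.symm
  -- All coefficients of `x` are congruent to each other modulo `n`, and hence to some `t` such that
  -- the boundary remains unchanged if `t` is subtracted from them.
  obtain ⟨t, ht, ht'⟩ : ∃ t : ℤ, (t = 0 ∨ A ⊆ A' ∧ B' ⊆ B) ∧
      ((∃ a, x (.inl a) = t) ∨ ∃ b ∈ B', y b = t) := by
    by_cases hAB : A ⊆ A' ∧ B' ⊆ B
    · exact ⟨_, Or.inr hAB, Or.inl ⟨a₀, rfl⟩⟩
    · refine ⟨0, Or.inl rfl, ?_⟩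
      rcases not_and_or.1 hAB with h | h
      · obtain ⟨a, ha, ha'⟩ := Finset.not_subset.1 h
        exact Or.inl ⟨⟨a, ha⟩, hx _ fun h => ha' (clo_mem_lc.1 h.1)⟩
      · obtain ⟨b, hb, hb'⟩ := Finset.not_subset.1 h
        exact Or.inr ⟨b, hb, dif_neg hb'⟩
  have hta : ∀ a, n ∣ x (.inl a) - t := by
    intro a
    rcases ht' with ⟨a', rfl⟩ | ⟨b', hb', rfl⟩
    · exact ⟨g (.inr (.inr (a, b₀))) - g (.inr (.inr (a', b₀))), by
        rw [mul_sub, key _ _ hb₀, key _ _ hb₀, sub_sub_sub_cancel_right]⟩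
    · exact ⟨_, (key a b' hb').symm⟩
  have htb : ∀ b ∈ B', n ∣ y b - t := by
    intro b hb
    obtain ⟨c, hc⟩ := hta a₀
    refine ⟨c - g (.inr (.inr (a₀, b))), ?_⟩
    rw [mul_sub, ← hc, key _ _ hb]
    ring
  choose u hu using hta
  choose v hv using htb
  refine ⟨fun i => match i with
    | .inl a => u a
    | .inr (.inl b) => if h : b.1 ∈ B' then v b.1 h else 0
    | .inr (.inr _) => 0, fun i hi => ?_, ?_⟩
  · rcases i with a | b | p
    · have ha : a.1 ∉ A' := fun h => hi ⟨clo_mem_lc.2 h, (add_one_add_one k).symm⟩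
      have ht0 : t = 0 := ht.resolve_right fun h => ha (h.1 a.2)
      have hxa : x (.inl a) = 0 := hx _ fun h => ha (clo_mem_lc.1 h.1)
      have := hu a
      rw [hxa, ht0, sub_zero] at this
      exact (mul_eq_zero.1 this.symm).resolve_left hn
    · exact dif_neg fun h => hi ⟨opn_mem_lc.2 h, (add_one_add_one k).symm⟩
    · rfl
  · ext i
    change (repComplex A B k).π _ ((repComplex A B k).d _) _ = _
    by_cases hi : (repComplex A B k).pos i ∈ (lc A' B').1
    · rw [π_of_mem _ hi]
      rcases i with a | b | ⟨a, b⟩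
      · exact (hg.1 (.inl a) fun h => ne_add_one k h.2).symm
      · exact (hg.1 (.inr (.inl b)) fun h => ne_add_one k h.2).symm
      · have hb : b ∈ B' := opn_mem_lc.1 hi
        rw [repComplex_d_inr_inr]
        refine mul_left_cancel₀ hn ?_
        rw [key _ _ hb, mul_sub]
        change n * u a - n * (if h : b ∈ B then if h : b ∈ B' then v b h else 0 else 0) = _
        rw [← hu]
        by_cases hbB : b ∈ B
        · rw [dif_pos hbB, dif_pos hb, ← hv]
          ring
        · have ht0 : t = 0 := ht.resolve_right fun h => hbB (h.2 hb)
          rw [dif_neg hbB, show y b = 0 from dif_neg hbB, ht0]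
          ring
    · rw [π_of_notMem _ hi]
      exact (hg.1 _ fun h => hi h.1).symm

theorem embedsInFree_rep : EmbedsInFree (Rep A B k) := by
  have h1 : Module.IsTorsionFree ℤ (Rep A B k) := by
    refine .of_smul_eq_zero fun n w h => or_iff_not_imp_left.2 fun hn => ?_
    obtain ⟨t, rfl⟩ := homologyClass_surjective _ w
    rw [← map_zsmul, homologyClass_eq_zero, mem_boundaries] at h
    rw [homologyClass_eq_zero, mem_boundaries]
    exact fun a => mem_bdry_of_zsmul_mem (mem_cycles.1 t.2 a) hn (h a)
  have h2 : Module.Finite ℤ (repComplex A B k).cycles :=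
    inferInstanceAs (Module.Finite ℤ (AddSubgroup.toIntSubmodule (repComplex A B k).cycles))
  have h3 : Module.Finite ℤ (Rep A B k) :=
    Module.Finite.of_surjective (repComplex A B k).homologyClass.toIntLinearMap
      (homologyClass_surjective _)
  let b := Module.Free.chooseBasis ℤ (Rep A B k)
  exact ⟨_, b.repr.toLinearMap.toAddMonoidHom, b.repr.injective⟩

/-- The objects `(lc A B)_k` that are used in projective covers: all objects of odd degree, and in
even degree the open sets other than the whole space. The boundary maps of the modules they
represent vanish in even degree. -/
def IsAllowed (A B : Finset Bool) (k : ZMod 2) : Prop :=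
  k = 1 ∨ k = 0 ∧ A ≠ Finset.univ ∧ (A = ∅ ∨ B = Finset.univ)

theorem δ_smul_rep (h : IsAllowed A B k) {C U : LC PseudoCircle} (hb : IsBoundaryPair C U)
    (y : Rep A B k) : of (Gen.δ hb 0) • y = 0 := by
  rw [← mul_source, mul_smul]
  obtain ⟨x, hx⟩ := exists_cls (e_smul_mem_comp (Rep A B k) (C, 0) y)
  rw [← hx, of_smul_cls, cls_eq_zero]
  change (repComplex A B k).π U.1 ((repComplex A B k).d x) ∈ _
  rcases h with rfl | ⟨rfl, h1, h2⟩
  · have hx : (repComplex A B 1).d x = 0 := repComplex_d_eq_zero (S := C.1) x.2.1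
    rw [hx, map_zero]
    exact zero_mem _
  · have hA : ∀ a a' : A, a = a' := by
      obtain ⟨c, hc⟩ : ∃ c, c ∉ A := by
        by_contra! h
        exact h1 (Finset.eq_univ_iff_forall.2 h)
      have h3 : ∀ a : A, a.1 = !c := fun a => Bool.eq_not.2 fun h => hc (h ▸ a.2)
      exact fun a a' => Subtype.ext ((h3 a).trans (h3 a').symm)
    -- The elements `opn b` of `B` bound all cycles of odd degree.
    set z := (repComplex A B 0).d x with hz
    refine ⟨(repComplex A B 0).π U.1 fun i => match i with
      | .inl _ => 0
      | .inr (.inl b) => -∑ a : A, z (.inr (.inr (a, b.1)))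
      | .inr (.inr _) => 0, ?_, ?_⟩
    · refine π_mem_supp_univ fun i hi => ?_
      rcases i with a | b | p
      · rfl
      · exact absurd ⟨trivial, (add_one_add_one 0).symm⟩ hi
      · rfl
    · change (repComplex A B 0).π U.1 ((repComplex A B 0).d _) = _
      ext i
      by_cases hi : (repComplex A B 0).pos i ∈ U.1
      · rw [π_of_mem _ hi, π_of_mem _ hi]
        rcases i with a | b | ⟨a, b⟩
        · rfl
        · rfl
        · have hbB : b ∈ B := by
            rcases h2 with rfl | rfl
            · exact absurd a.2 (Finset.notMem_empty _)
            · exact Finset.mem_univ b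
          have h3 : (repComplex A B 0).pos (.inr (.inl ⟨b, hbB⟩)) ∈ U.1 := hi
          rw [repComplex_d_inr_inr, dif_pos hbB, π_of_mem _ h3]
          change _ - -∑ a' : A, z (.inr (.inr (a', b))) = _
          rw [Finset.sum_eq_single a]
          · by_cases ha : (repComplex A B 0).pos (.inl a) ∈ U.1
            · rw [π_of_mem _ ha]
              ring
            · rw [π_of_notMem _ ha]
              ring
          · exact fun a' _ hne => absurd (hA _ _) hne
          · simp
      · rw [π_of_notMem _ hi, π_of_notMem _ hi]

end

end PseudoCircle

/-! ### Exactness in terms of elements -/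

section

variable {X : Type} [TopologicalSpace X] [Finite X]

section

variable {M : Type*} [AddCommGroup M] [Module (NT X) M]

theorem isExact_of_forall
    (h₁ : ∀ (U Y C : LC X) (h : IsExtension U Y C) (j : ZMod 2) (m : M), NT.e (Y, j) • m = m →
      NT.of (Gen.r h.isClosedIn j) • m = 0 → ∃ u : M, NT.of (Gen.i h.1 j) • u = m)
    (h₂ : ∀ (U Y C : LC X) (h : IsExtension U Y C) (j : ZMod 2) (m : M), NT.e (C, j) • m = m →
      NT.of (Gen.δ h.isBoundaryPair j) • m = 0 → ∃ u : M, NT.of (Gen.r h.isClosedIn j) • u = m)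
    (h₃ : ∀ (U Y C : LC X) (h : IsExtension U Y C) (j : ZMod 2) (m : M),
      NT.e (U, j + 1) • m = m → NT.of (Gen.i h.1 (j + 1)) • m = 0 →
      ∃ u : M, NT.of (Gen.δ h.isBoundaryPair j) • u = m) : IsExact (X := X) M := by
  have key : ∀ {a b c : Obj X} (f : Gen a b) (g : Gen b c), NT.of g * NT.of f = 0 →
      (∀ m : M, NT.e b • m = m → NT.of g • m = 0 → ∃ u : M, NT.of f • u = m) →
      Function.Exact (act M f) (act M g) := by
    intro a b c f g hgf h m
    constructor
    · intro hm
      obtain ⟨u, hu⟩ := h m m.2 (congrArg Subtype.val hm)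
      exact ⟨⟨_, e_smul_mem_comp M a u⟩, Subtype.ext (by
        rw [coe_act, ← mul_smul, NT.mul_source, hu])⟩
    · rintro ⟨u, rfl⟩
      ext
      rw [coe_act, coe_act, ← mul_smul, hgf, zero_smul]
      rfl
  exact fun U Y C h j => ⟨key _ _ (NT.r_mul_i h j) (h₁ U Y C h j),
    key _ _ (NT.δ_mul_r h j) (h₂ U Y C h j), key _ _ (NT.i_mul_δ h j) (h₃ U Y C h j)⟩

theorem exists_smul_of_exact {a b c : Obj X} {f : Gen a b} {g : Gen b c}
    (h : Function.Exact (act M f) (act M g)) {m : M} (hm : NT.e b • m = m)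
    (hgm : NT.of g • m = 0) : ∃ u : M, NT.e a • u = u ∧ NT.of f • u = m := by
  obtain ⟨u, hu⟩ := (h ⟨m, hm⟩).1 (Subtype.ext hgm)
  exact ⟨u, u.2, congrArg Subtype.val hu⟩

theorem IsExact.exists_i (hM : IsExact (X := X) M) {U Y C : LC X} (h : IsExtension U Y C)
    {j : ZMod 2} {m : M} (hm : NT.e (Y, j) • m = m) (h0 : NT.of (Gen.r h.isClosedIn j) • m = 0) :
    ∃ u : M, NT.e (U, j) • u = u ∧ NT.of (Gen.i h.1 j) • u = m :=
  exists_smul_of_exact (hM U Y C h j).1 hm h0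

theorem IsExact.exists_r (hM : IsExact (X := X) M) {U Y C : LC X} (h : IsExtension U Y C)
    {j : ZMod 2} {m : M} (hm : NT.e (C, j) • m = m)
    (h0 : NT.of (Gen.δ h.isBoundaryPair j) • m = 0) :
    ∃ u : M, NT.e (Y, j) • u = u ∧ NT.of (Gen.r h.isClosedIn j) • u = m :=
  exists_smul_of_exact (hM U Y C h j).2.1 hm h0

theorem IsExact.exists_δ (hM : IsExact (X := X) M) {U Y C : LC X} (h : IsExtension U Y C)
    {j : ZMod 2} {m : M} (hm : NT.e (U, j + 1) • m = m)
    (h0 : NT.of (Gen.i h.1 (j + 1)) • m = 0) :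
    ∃ u : M, NT.e (C, j) • u = u ∧ NT.of (Gen.δ h.isBoundaryPair j) • u = m :=
  exists_smul_of_exact (hM U Y C h j).2.2 hm h0

theorem IsRealRankZeroLike.δ_smul (hM : IsRealRankZeroLike (X := X) M) {C U : LC X}
    (h : IsBoundaryPair C U) (m : M) :
    NT.of (Gen.δ h 0) • m = 0 := by
  obtain ⟨Y, hY⟩ := id h
  rw [← NT.mul_source, mul_smul]
  exact congrArg Subtype.val (DFunLike.congr_fun (hM.2 U Y C hY)
    ⟨_, e_smul_mem_comp M (C, 0) m⟩)

end

/-! ### Direct sums and kernels of exact modules -/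

theorem exists_smul_dfinsupp {R ι : Type*} [Ring R] {P : ι → Type*} [∀ p, AddCommGroup (P p)]
    [∀ p, Module R (P p)] {x y z : R}
    (h : ∀ (p : ι) (m : P p), x • m = m → y • m = 0 → ∃ u : P p, z • u = m)
    (m : Π₀ p, P p) (hx : x • m = m) (hy : y • m = 0) : ∃ u : Π₀ p, P p, z • u = m := by
  classical
  choose! u hu using fun p => h p (m p) (DFunLike.congr_fun hx p) (DFunLike.congr_fun hy p)
  refine ⟨∑ p ∈ m.support, DFinsupp.single p (u p), ?_⟩
  rw [Finset.smul_sum]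
  conv_rhs => rw [← DFinsupp.sum_single (f := m)]
  exact Finset.sum_congr rfl fun p _ => by rw [← DFinsupp.single_smul, hu]

theorem isExact_dfinsupp {ι : Type*} {P : ι → Type*} [∀ p, AddCommGroup (P p)]
    [∀ p, Module (NT X) (P p)] (h : ∀ p, IsExact (X := X) (P p)) :
    IsExact (X := X) (Π₀ p, P p) :=
  isExact_of_forall
    (fun _ _ _ hU _ => exists_smul_dfinsupp fun p _ hm h0 =>
      ((h p).exists_i hU hm h0).imp fun _ => And.right)
    (fun _ _ _ hU _ => exists_smul_dfinsupp fun p _ hm h0 =>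
      ((h p).exists_r hU hm h0).imp fun _ => And.right)
    (fun _ _ _ hU _ => exists_smul_dfinsupp fun p _ hm h0 =>
      ((h p).exists_δ hU hm h0).imp fun _ => And.right)

/-- One step of the diagram chase that shows the exactness of the kernel of `q`: exactness at the
same place in the source and one step further in the target suffices. -/
theorem exists_smul_ker {R Q M : Type*} [Ring R] [AddCommGroup Q] [Module R Q] [AddCommGroup M]
    [Module R M] {q : Q →ₗ[R] M} (hq : Function.Surjective q) {a b x y z : R}
    (hQ : ∀ m : Q, a • m = m → x • m = 0 → ∃ u, b • u = u ∧ y • u = m)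
    (hM : ∀ m : M, b • m = m → y • m = 0 → ∃ u, z • u = m) (hyz : y * z = 0)
    (m : LinearMap.ker q) (ha : a • m = m) (hx : x • m = 0) :
    ∃ u : LinearMap.ker q, y • u = m := by
  obtain ⟨u, hu, hum⟩ := hQ m (congrArg Subtype.val ha) (congrArg Subtype.val hx)
  obtain ⟨v, hv⟩ := hM (q u) (by rw [← map_smul, hu]) (by rw [← map_smul, hum]; exact m.2)
  obtain ⟨w, rfl⟩ := hq v
  refine ⟨⟨u - z • w, ?_⟩, Subtype.ext ?_⟩
  · rw [LinearMap.mem_ker, map_sub, map_smul, hv, sub_self]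
  · change y • (u - z • w) = m
    rw [smul_sub, hum, ← mul_smul, hyz, zero_smul, sub_zero]

/-- The kernel of a surjection between exact modules is exact. -/
theorem isExact_ker {Q M : Type*} [AddCommGroup Q] [Module (NT X) Q] [AddCommGroup M]
    [Module (NT X) M] (hQ : IsExact (X := X) Q) (hM : IsExact (X := X) M) {q : Q →ₗ[NT X] M}
    (hq : Function.Surjective q) : IsExact (X := X) (LinearMap.ker q) := by
  refine isExact_of_forall (fun U Y C h j => ?_) (fun U Y C h j => ?_) fun U Y C h j => ?_
  · obtain ⟨j, rfl⟩ : ∃ j', j = j' + 1 := ⟨j + 1, (add_one_add_one j).symm⟩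
    exact exists_smul_ker hq (fun m => hQ.exists_i h)
      (fun m hm h0 => (hM.exists_δ h hm h0).imp fun _ => And.right) (NT.i_mul_δ h j)
  · exact exists_smul_ker hq (fun m => hQ.exists_r h)
      (fun m hm h0 => (hM.exists_i h hm h0).imp fun _ => And.right) (NT.r_mul_i h j)
  · exact exists_smul_ker hq (fun m => hQ.exists_δ h)
      (fun m hm h0 => (hM.exists_r h hm h0).imp fun _ => And.right) (NT.δ_mul_r h j)

theorem embedsInFree_dfinsupp {ι : Type u} {P : ι → Type} [∀ p, AddCommGroup (P p)]
    (h : ∀ p, EmbedsInFree (P p)) : EmbedsInFree (Π₀ p, P p) := by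
  classical
  choose κ f hf using h
  refine ⟨Σ p, κ p, sigmaFinsuppAddEquivDFinsupp.symm.toAddMonoidHom.comp
    (DFinsupp.mapRange.addMonoidHom f), sigmaFinsuppAddEquivDFinsupp.symm.injective.comp ?_⟩
  exact (DFinsupp.mapRange_injective _ fun p => map_zero (f p)).2 hf

end

/-! ### A projective cover with vanishing even boundary maps -/

namespace PseudoCircle

open NT

section

variable {M : Type u} [AddCommGroup M] [Module (NT PseudoCircle) M]

/-- A real rank zero like module is generated by its elements at allowed objects. -/
theorem eq_top_of_isAllowed (hM : IsRealRankZeroLike (X := PseudoCircle) M)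
    {S : Submodule (NT PseudoCircle) M}
    (hS : ∀ A B k, IsAllowed A B k → ∀ m : M, e (lc A B, k) • m = m → m ∈ S) : S = ⊤ := by
  -- Elements at `lc A B` lift to the open set `lc A univ`, since the boundary map vanishes.
  have h1 : ∀ A B, A ≠ Finset.univ → ∀ m : M, e (lc A B, 0) • m = m → m ∈ S := by
    intro A B hA m hm
    have h : IsExtension (lc ∅ Bᶜ) (lc A Finset.univ) (lc A B) :=
      isExtension_lc.2 ⟨⟨Finset.empty_subset _, Finset.subset_univ _, Or.inl rfl⟩,
        Finset.sdiff_empty.symm, by rw [← Finset.compl_eq_univ_sdiff, compl_compl]⟩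
    obtain ⟨n, hn, rfl⟩ := hM.1.exists_r h hm (hM.δ_smul _ m)
    exact S.smul_mem _ (hS _ _ _ (Or.inr ⟨rfl, hA, Or.inr rfl⟩) n hn)
  have h2 : ∀ A B (m : M), e (lc A B, 0) • m = m → m ∈ S := by
    intro A B m hm
    -- Elements at `lc univ B` are sums of elements at `lc {false} B` and `lc {true} B`.
    by_cases hA : A = Finset.univ
    · subst hA
      have hU : IsExtension (lc {true} B) (lc Finset.univ B) (lc {false} ∅) :=
        isExtension_lc.2 ⟨⟨by simp, by simp, by simp⟩, by decide, by simp⟩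
      have hV : IsExtension (lc ∅ B) (lc {false} B) (lc {false} ∅) := isExtension_lc.2 (by simp)
      have hi : IsOpenIn (lc {false} B) (lc Finset.univ B) := isOpenIn_lc.2 (by simp)
      obtain ⟨n, hn, hnm⟩ := hM.1.exists_r hV
        (m := of (Gen.r hU.isClosedIn 0) • m) (by rw [← mul_smul, NT.target_mul]) (hM.δ_smul _ _)
      have h3 : of (Gen.r hU.isClosedIn 0) • (m - of (Gen.i hi 0) • n) = 0 := by
        rw [smul_sub, ← mul_smul (of _) (of _), r_i hi hU.isClosedIn (W := lc {false} ∅)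
          (by rw [← lc_inter]; simp) (IsOpenIn.refl _) hV.isClosedIn, i_self, NT.target_mul, hnm,
          sub_self]
      obtain ⟨l, hl, hlm⟩ := hM.1.exists_i hU
        (by rw [smul_sub, hm, ← mul_smul, NT.target_mul]) h3
      rw [← sub_add_cancel m (of (Gen.i hi 0) • n), ← hlm]
      exact add_mem (S.smul_mem _ (h1 _ _ (by decide) l hl))
        (S.smul_mem _ (h1 _ _ (by decide) n hn))
    · exact h1 A B hA m hm
  refine Submodule.eq_top_iff'.2 fun m => ?_
  rw [← sum_e_smul (X := PseudoCircle) m]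
  refine S.sum_mem fun c _ => ?_
  obtain ⟨Z, j⟩ := c
  obtain ⟨A, B, rfl⟩ := exists_lc Z
  have hm : e (lc A B, j) • e (lc A B, j) • m = e (lc A B, j) • m :=
    e_smul_mem_comp M _ m
  obtain rfl | rfl := eq_or_eq_add_one j 0
  · exact h2 A B _ hm
  · exact hS A B _ (Or.inl rfl) _ hm

/-- A real rank zero like module is a quotient of a direct sum of representable modules at allowed
objects. The kernel has the properties stated. -/
theorem exists_projective_cover (hM : IsRealRankZeroLike (X := PseudoCircle) M) :
    ∃ (Q : Type u) (_ : AddCommGroup Q) (_ : Module (NT PseudoCircle) Q)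
      (q : Q →ₗ[NT PseudoCircle] M), Module.Projective (NT PseudoCircle) Q ∧
      Function.Surjective q ∧ IsExact (X := PseudoCircle) (LinearMap.ker q) ∧
      EmbedsInFree (LinearMap.ker q) ∧ ∀ {C U : LC PseudoCircle} (h : IsBoundaryPair C U)
        (m : LinearMap.ker q), of (Gen.δ h 0) • m = 0 := by
  classical
  let ι : Type u := {p : (Finset Bool × Finset Bool × ZMod 2) × M //
    IsAllowed p.1.1 p.1.2.1 p.1.2.2 ∧ e (lc p.1.1 p.1.2.1, p.1.2.2) • p.2 = p.2}
  let P : ι → Type := fun p => Rep p.1.1.1 p.1.1.2.1 p.1.1.2.2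
  have hf := fun p : ι => exists_hom_repGen _ _ _ p.2.2
  choose f hf using hf
  let q : (Π₀ p, P p) →ₗ[NT PseudoCircle] M := DFinsupp.lsum ℕ f
  have hq : Function.Surjective q := by
    rw [← LinearMap.range_eq_top]
    refine eq_top_of_isAllowed hM fun A B k h m hm => ?_
    refine ⟨DFinsupp.single (⟨((A, B, k), m), h, hm⟩ : ι) (repGen A B k), ?_⟩
    exact (DFinsupp.lsum_single ℕ f _ _).trans (hf ⟨((A, B, k), m), h, hm⟩)
  refine ⟨Π₀ p, P p, inferInstance, inferInstance, q, inferInstance, hq,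
    isExact_ker (isExact_dfinsupp fun p => FilteredComplex.isExact_homology) hM.1 hq,
    (embedsInFree_dfinsupp fun p => embedsInFree_rep).of_injective
      (LinearMap.ker q).subtype.toAddMonoidHom Subtype.val_injective, fun h m => Subtype.ext ?_⟩
  exact DFinsupp.ext fun p => δ_smul_rep p.2.1 h _

end

end PseudoCircle

namespace PseudoCircle

open NT

/-! ### A smaller set of generators -/

theorem finset_bool_cases (A : Finset Bool) : A = ∅ ∨ (∃ x, A = {x}) ∨ A = Finset.univ := by
  revert A
  decide

/-- The property `P` holds for the generating morphisms listed. Together with the identities, these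
generate all morphisms. In the names, `opn` and `clo` refer to the discrete subspaces of all open
and of all closed points, `hull` to the smallest neighbourhood of a closed point and the closure of
an open point, `edge` to the sets `lc {x} {b}`, and `univ` to the whole space. -/
structure Essential (P : ∀ {a b : Obj PseudoCircle}, Gen a b → Prop) : Prop where
  i_opn : ∀ b j (h : IsOpenIn (lc ∅ {b}) (lc ∅ Finset.univ)), P (Gen.i h j)
  r_opn : ∀ b j (h : IsClosedIn (lc ∅ {b}) (lc ∅ Finset.univ)), P (Gen.r h j)
  i_clo : ∀ x j (h : IsOpenIn (lc {x} ∅) (lc Finset.univ ∅)), P (Gen.i h j)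
  r_clo : ∀ x j (h : IsClosedIn (lc {x} ∅) (lc Finset.univ ∅)), P (Gen.r h j)
  i_hull : ∀ x j (h : IsOpenIn (lc ∅ Finset.univ) (lc {x} Finset.univ)), P (Gen.i h j)
  i_univ : ∀ x j (h : IsOpenIn (lc {x} Finset.univ) (lc Finset.univ Finset.univ)), P (Gen.i h j)
  i_edge : ∀ x b j (h : IsOpenIn (lc {x} {b}) (lc Finset.univ {b})), P (Gen.i h j)
  r_edge : ∀ x b j (h : IsClosedIn (lc {x} {b}) (lc {x} Finset.univ)), P (Gen.r h j)
  r_univ : ∀ b j (h : IsClosedIn (lc Finset.univ {b}) (lc Finset.univ Finset.univ)), P (Gen.r h j)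
  r_hull : ∀ b j (h : IsClosedIn (lc Finset.univ ∅) (lc Finset.univ {b})), P (Gen.r h j)
  δ : ∀ j (h : IsBoundaryPair (lc Finset.univ ∅) (lc ∅ Finset.univ)), P (Gen.δ h j)

theorem eq_inter_lc {A B A' B' A'' B'' : Finset Bool} (h : A'' = A ∩ A') (h' : B'' = B ∩ B') :
    (lc A'' B'').1 = (lc A B).1 ∩ (lc A' B').1 := by
  rw [← lc_inter, h, h']

section

variable {S : Subring (NT PseudoCircle)}

theorem Essential.i_opn_mem (hS : Essential fun g => of g ∈ S) (he : ∀ a, e a ∈ S)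
    {B B' : Finset Bool} (h : B ⊆ B') (j : ZMod 2) :
    of (Gen.i (isOpenIn_opn_of_subset h) j) ∈ S := by
  have h1 : ∀ B, of (Gen.i (isOpenIn_opn_of_subset (Finset.subset_univ B)) j) ∈ S := fun B => by
    obtain rfl | ⟨b, rfl⟩ | rfl := finset_bool_cases B
    · rw [of_eq_zero_of_source _ (e_eq_zero lc_empty j)]
      exact S.zero_mem
    · exact hS.i_opn _ _ _
    · rw [i_self]
      exact he _
  have h2 : of (Gen.r (isClosedIn_opn (Finset.subset_univ B')) j) ∈ S := by
    obtain rfl | ⟨b, rfl⟩ | rfl := finset_bool_cases B'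
    · rw [of_eq_zero_of_target _ (e_eq_zero lc_empty j)]
      exact S.zero_mem
    · exact hS.r_opn _ _ _
    · rw [r_self]
      exact he _
  have h3 := r_i (isOpenIn_opn_of_subset (Finset.subset_univ B))
    (isClosedIn_opn (Finset.subset_univ B'))
    (eq_inter_lc (A'' := ∅) rfl (Finset.inter_eq_left.2 h).symm) (isOpenIn_opn_of_subset h)
    (isClosedIn_opn subset_rfl) j
  rw [r_self, mul_source] at h3
  rw [← h3]
  exact S.mul_mem h2 (h1 B)

theorem Essential.r_opn_mem (hS : Essential fun g => of g ∈ S) (he : ∀ a, e a ∈ S)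
    (B : Finset Bool) (j : ZMod 2) :
    of (Gen.r (isClosedIn_opn (Finset.subset_univ B)) j) ∈ S := by
  obtain rfl | ⟨b, rfl⟩ | rfl := finset_bool_cases B
  · rw [of_eq_zero_of_target _ (e_eq_zero lc_empty j)]
    exact S.zero_mem
  · exact hS.r_opn _ _ _
  · rw [r_self]
    exact he _

theorem Essential.clo_mem (hS : Essential fun g => of g ∈ S) (he : ∀ a, e a ∈ S)
    {A A' : Finset Bool} (h : A ⊆ A') (j : ZMod 2) :
    of (Gen.i (isOpenIn_clo h) j) ∈ S ∧ of (Gen.r (isClosedIn_clo_of_subset h) j) ∈ S := by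
  have h1 : ∀ A, of (Gen.i (isOpenIn_clo (Finset.subset_univ A)) j) ∈ S ∧
      of (Gen.r (isClosedIn_clo_of_subset (Finset.subset_univ A)) j) ∈ S := fun A => by
    obtain rfl | ⟨x, rfl⟩ | rfl := finset_bool_cases A
    · rw [of_eq_zero_of_source (Gen.i _ _) (e_eq_zero lc_empty j),
        of_eq_zero_of_target (Gen.r _ _) (e_eq_zero lc_empty j)]
      exact ⟨S.zero_mem, S.zero_mem⟩
    · exact ⟨hS.i_clo _ _ _, hS.r_clo _ _ _⟩
    · rw [i_self, r_self]
      exact ⟨he _, he _⟩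
  constructor
  · have h3 := r_i (isOpenIn_clo (Finset.subset_univ A))
      (isClosedIn_clo_of_subset (Finset.subset_univ A'))
      (eq_inter_lc (B'' := ∅) (Finset.inter_eq_left.2 h).symm rfl) (isOpenIn_clo h)
      (isClosedIn_clo_of_subset subset_rfl) j
    rw [r_self, mul_source] at h3
    rw [← h3]
    exact S.mul_mem (h1 A').2 (h1 A).1
  · have h3 := r_i (isOpenIn_clo (Finset.subset_univ A'))
      (isClosedIn_clo_of_subset (Finset.subset_univ A))
      (eq_inter_lc (B'' := ∅) (Finset.inter_eq_right.2 h).symm rfl) (isOpenIn_clo subset_rfl)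
      (isClosedIn_clo_of_subset h) j
    rw [i_self, NT.target_mul] at h3
    rw [← h3]
    exact S.mul_mem (h1 A).2 (h1 A').1

theorem Essential.r_clo_opn_mem (hS : Essential fun g => of g ∈ S) (A : Finset Bool)
    (b : Bool) (j : ZMod 2) : of (Gen.r (isClosedIn_clo A {b}) j) ∈ S := by
  obtain rfl | ⟨x, rfl⟩ | rfl := finset_bool_cases A
  · rw [of_eq_zero_of_target _ (e_eq_zero lc_empty j)]
    exact S.zero_mem
  · have h1 : IsOpenIn (lc {x} {b}) (lc Finset.univ {b}) := isOpenIn_lc.2 (by simp)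
    have h2 : IsClosedIn (lc {x} ∅) (lc Finset.univ {b}) := isClosedIn_lc.2 (by simp)
    have h3 := r_i h1 h2 (eq_inter_lc (A'' := {x}) (B'' := ∅) (Finset.inter_self _).symm rfl)
      (.refl _) (isClosedIn_clo _ _) j
    rw [i_self, NT.target_mul, ← r_comp (isClosedIn_clo _ _)
      (isClosedIn_clo_of_subset (Finset.subset_univ _)) h2] at h3
    rw [← h3]
    exact S.mul_mem (S.mul_mem (hS.r_clo _ _ _) (hS.r_hull _ _ _)) (hS.i_edge _ _ _ _)
  · exact hS.r_hull _ _ _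

theorem isClosedIn_univ (A B : Finset Bool) : IsClosedIn (lc A B) (lc A Finset.univ) :=
  isClosedIn_lc.2 ⟨subset_rfl, Finset.subset_univ _, Or.inr rfl⟩

theorem Essential.r_univ_mem (hS : Essential fun g => of g ∈ S) (he : ∀ a, e a ∈ S)
    (A B : Finset Bool) (j : ZMod 2) : of (Gen.r (isClosedIn_univ A B) j) ∈ S := by
  have h1 : ∀ b, of (Gen.r (isClosedIn_univ A {b}) j) ∈ S := fun b => by
    obtain rfl | ⟨x, rfl⟩ | rfl := finset_bool_cases A
    · exact hS.r_opn _ _ _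
    · exact hS.r_edge _ _ _ _
    · exact hS.r_univ _ _ _
  obtain rfl | ⟨b, rfl⟩ | rfl := finset_bool_cases B
  · rw [← r_comp (isClosedIn_univ A {true}) (isClosedIn_clo A {true})]
    exact S.mul_mem (hS.r_clo_opn_mem A true j) (h1 true)
  · exact h1 b
  · rw [r_self]
    exact he _

theorem Essential.r_mem (hS : Essential fun g => of g ∈ S) (he : ∀ a, e a ∈ S)
    {A B A' B' : Finset Bool} (h : IsClosedIn (lc A B) (lc A' B')) (j : ZMod 2) :
    of (Gen.r h j) ∈ S := by
  have h1 : ∀ {A B B'} (h : IsClosedIn (lc A B) (lc A B')), of (Gen.r h j) ∈ S := by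
    intro A B B' h
    obtain rfl | ⟨b, rfl⟩ | rfl := finset_bool_cases B'
    · obtain rfl := Finset.subset_empty.1 (isClosedIn_lc.1 h).2.1
      rw [r_self]
      exact he _
    · obtain rfl | rfl := Finset.subset_singleton_iff.1 (isClosedIn_lc.1 h).2.1
      · exact hS.r_clo_opn_mem A b j
      · rw [r_self]
        exact he _
    · exact hS.r_univ_mem he A B j
  obtain ⟨hA, hB, rfl | rfl⟩ := isClosedIn_lc.1 h
  · rw [← r_comp (isClosedIn_clo A' B') (isClosedIn_clo_of_subset hA)]
    exact S.mul_mem (hS.clo_mem he hA j).2 (h1 _)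
  · exact h1 h

theorem Essential.i_mem (hS : Essential fun g => of g ∈ S) (he : ∀ a, e a ∈ S)
    {A B A' B' : Finset Bool} (h : IsOpenIn (lc A B) (lc A' B')) (j : ZMod 2) :
    of (Gen.i h j) ∈ S := by
  have h1 : ∀ A, of (Gen.i (isOpenIn_opn A Finset.univ) j) ∈ S := fun A => by
    obtain rfl | ⟨x, rfl⟩ | rfl := finset_bool_cases A
    · rw [i_self]
      exact he _
    · exact hS.i_hull _ _ _
    · have h1 : IsOpenIn (lc {true} Finset.univ) (lc Finset.univ Finset.univ) :=
        isOpenIn_lc.2 (by simp)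
      rw [← i_comp (isOpenIn_opn {true} _) h1]
      exact S.mul_mem (hS.i_univ _ _ _) (hS.i_hull _ _ _)
  have h2 : ∀ A B, of (Gen.i (isOpenIn_opn A B) j) ∈ S := fun A B => by
    have h2 := r_i (isOpenIn_opn A Finset.univ) (isClosedIn_univ A B)
      (eq_inter_lc (Finset.empty_inter _).symm (Finset.univ_inter _).symm) (isOpenIn_opn A B)
      (isClosedIn_univ ∅ B) j
    have h3 := hS.i_opn_mem he (Finset.subset_univ B) j
    rw [← mul_source (Gen.i _ j), ← r_mul_i_opn (Finset.subset_univ B), ← mul_assoc, ← h2]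
    exact S.mul_mem (S.mul_mem (hS.r_univ_mem he A B j) (h1 A)) h3
  obtain ⟨hA, hB, rfl | rfl⟩ := isOpenIn_lc.1 h
  · rw [← i_comp (isOpenIn_opn_of_subset hB) (isOpenIn_opn A' B')]
    exact S.mul_mem (h2 A' B') (hS.i_opn_mem he hB j)
  · obtain rfl | ⟨x, rfl⟩ | rfl := finset_bool_cases A
    · exact h2 A' B
    · obtain rfl | ⟨y, rfl⟩ | rfl := finset_bool_cases A'
      · exact absurd hA (by simp)
      · obtain rfl : x = y := by simpa using hA
        rw [i_self]
        exact he _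
      · obtain rfl | ⟨b, rfl⟩ | rfl := finset_bool_cases B
        · exact hS.i_clo _ _ _
        · exact hS.i_edge _ _ _ _
        · exact hS.i_univ _ _ _
    · obtain rfl := Finset.univ_subset_iff.1 hA
      rw [i_self]
      exact he _

theorem Essential.δ_mem (hS : Essential fun g => of g ∈ S) (he : ∀ a, e a ∈ S)
    {A B A' B' : Finset Bool} (h : IsBoundaryPair (lc A B) (lc A' B')) (j : ZMod 2) :
    of (Gen.δ h j) ∈ S := by
  have hA := Finset.subset_univ A
  have hB := Finset.subset_univ B'
  rw [δ_eq, ← δ_i (isBoundaryPair_clo_opn Finset.univ B') (isOpenIn_clo hA),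
    ← r_δ (isBoundaryPair_clo_opn Finset.univ Finset.univ) (isClosedIn_opn hB)]
  exact S.mul_mem (S.mul_mem (hS.i_mem he _ _) (S.mul_mem (S.mul_mem (hS.r_opn_mem he _ _)
    (hS.δ _ _)) (hS.i_mem he _ _))) (hS.r_mem he _ _)

/-- A subring containing the identities and the morphisms listed in `Essential` is everything. -/
theorem Essential.mem (hS : Essential fun g => of g ∈ S) (he : ∀ a, e a ∈ S)
    (x : NT PseudoCircle) : x ∈ S := by
  refine NT.induction he (fun g => ?_) x
  cases g with
  | @i U Y h j =>
    obtain ⟨A, B, rfl⟩ := exists_lc U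
    obtain ⟨A', B', rfl⟩ := exists_lc Y
    exact hS.i_mem he h j
  | @r Y C h j =>
    obtain ⟨A, B, rfl⟩ := exists_lc C
    obtain ⟨A', B', rfl⟩ := exists_lc Y
    exact hS.r_mem he h j
  | @δ C U h j =>
    obtain ⟨A, B, rfl⟩ := exists_lc C
    obtain ⟨A', B', rfl⟩ := exists_lc U
    exact hS.δ_mem he h j

end

end PseudoCircle

/-! ### Sections at single objects -/

section

variable {X : Type} [TopologicalSpace X] [Finite X]
variable {E K : Type u} [AddCommGroup E] [Module (NT X) E] [AddCommGroup K] [Module (NT X) K]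

theorem e_smul_of_smul {M : Type*} [AddCommGroup M] [Module (NT X) M] {a b : Obj X} (g : Gen a b)
    (m : M) : NT.e b • NT.of g • m = NT.of g • m := by
  rw [← mul_smul, NT.target_mul]

/-- The additive map `s` is a section of `p` on the component at the object `c`, extended by zero to
the other components. -/
structure IsSectionAt (p : E →ₗ[NT X] K) (c : Obj X) (s : K →+ E) : Prop where
  smul : ∀ k, NT.e c • s k = s k
  map_smul : ∀ k, s (NT.e c • k) = s k
  right_inv : ∀ k, p (s k) = NT.e c • k

theorem isSectionAt_zero {p : E →ₗ[NT X] K} {c : Obj X} (hc : NT.e c = 0) :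
    IsSectionAt p c 0 where
  smul _ := smul_zero _
  map_smul _ := rfl
  right_inv k := by rw [hc, zero_smul, AddMonoidHom.zero_apply, map_zero]

/-- A section on the component at `c` exists that extends `f'` and satisfies the constraint
`κ ∘ s = l`, if the constraint is satisfied by `f'` and can be satisfied at every single element.
The sequence formed by `f` and `h` is exact at `c`, so that `h` embeds the quotient by the image of
`f` in a free group. -/
theorem exists_isSectionAt {p : E →ₗ[NT X] K} (hK : EmbedsInFree K) {c : Obj X} {P T : Type*}
    [AddCommGroup P] [AddCommGroup T] (f : P →+ K) (f' : P →+ E) (h : K →+ K) (κ : E →+ T)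
    (l : K →+ T) (hfc : ∀ x, NT.e c • f' x = f' x) (hf : ∀ x, p (f' x) = f x)
    (hker : ∀ x, f x = 0 → f' x = 0) (hhf : ∀ x, h (f x) = 0)
    (hfh : ∀ k, NT.e c • k = k → h k = 0 → ∃ x, f x = k) (hκf : ∀ x, κ (f' x) = l (f x))
    (hκ : ∀ k, NT.e c • k = k → ∃ y, NT.e c • y = y ∧ p y = k ∧ κ y = l k) :
    ∃ s, IsSectionAt p c s ∧ (∀ x, s (f x) = f' x) ∧ ∀ k, κ (s k) = l (NT.e c • k) := by
  let G : AddSubgroup E := comp E c ⊓ (κ - l.comp p.toAddMonoidHom).ker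
  have hG : ∀ y, y ∈ G ↔ NT.e c • y = y ∧ κ y = l (p y) := fun y =>
    and_congr Iff.rfl sub_eq_zero
  have hfc' : ∀ x, NT.e c • f x = f x := fun x => by rw [← hf, ← map_smul, hfc]
  let pG : G →+ comp K c := (p.toAddMonoidHom.comp G.subtype).codRestrict (comp K c) fun y => by
    change NT.e c • p y = p y
    rw [← map_smul, ((hG y).1 y.2).1]
  have hpG : Function.Surjective pG := fun k => by
    obtain ⟨y, hy, hyk, hy'⟩ := hκ k k.2
    exact ⟨⟨y, (hG y).2 ⟨hy, by rw [hyk, hy']⟩⟩, Subtype.ext hyk⟩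
  obtain ⟨s, hs, hsf⟩ := exists_section_extending pG hpG (f.codRestrict (comp K c) hfc')
    (f'.codRestrict G fun x => (hG _).2 ⟨hfc x, by rw [hf, hκf]⟩) (fun x => Subtype.ext (hf x))
    (fun x hx => Subtype.ext (hker x (congrArg Subtype.val hx))) (h.comp (comp K c).subtype)
    (fun k => ⟨fun hk => (hfh k k.2 hk).imp fun x hx => Subtype.ext hx, by
      rintro ⟨x, rfl⟩
      exact hhf x⟩) hK
  let π : K →+ comp K c :=
    (DistribSMul.toAddMonoidHom K (NT.e c)).codRestrict (comp K c) (e_smul_mem_comp K c)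
  have hπ : ∀ {k : K} (hk : NT.e c • k = k), π k = ⟨k, hk⟩ := fun hk => Subtype.ext hk
  refine ⟨G.subtype.comp (s.comp π), ⟨fun k => ((hG _).1 (s (π k)).2).1, fun k => ?_,
    fun k => congrArg Subtype.val (hs (π k))⟩, fun x => ?_, fun k => ?_⟩
  · change (s (π _) : E) = s (π k)
    rw [hπ (e_smul_mem_comp K c k)]
    rfl
  · change (s (π _) : E) = f' x
    rw [hπ (hfc' x)]
    exact congrArg Subtype.val (hsf x)
  · refine ((hG _).1 (s (π k)).2).2.trans (congrArg l ?_)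
    exact congrArg Subtype.val (hs (π k))

theorem exists_lift_comp {p : E →ₗ[NT X] K} (hp : Function.Surjective p) {c : Obj X} {k : K}
    (hk : NT.e c • k = k) : ∃ y, NT.e c • y = y ∧ p y = k := by
  obtain ⟨y, rfl⟩ := hp k
  exact ⟨_, e_smul_mem_comp E c y, by rw [map_smul, hk]⟩

/-- The version of `exists_isSectionAt` without a constraint. -/
theorem exists_isSectionAt_extending {p : E →ₗ[NT X] K} (hp : Function.Surjective p)
    (hK : EmbedsInFree K) {c : Obj X} {P : Type*}
    [AddCommGroup P] (f : P →+ K) (f' : P →+ E) (h : K →+ K)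
    (hfc : ∀ x, NT.e c • f' x = f' x) (hf : ∀ x, p (f' x) = f x)
    (hker : ∀ x, f x = 0 → f' x = 0) (hhf : ∀ x, h (f x) = 0)
    (hfh : ∀ k, NT.e c • k = k → h k = 0 → ∃ x, f x = k) :
    ∃ s, IsSectionAt p c s ∧ ∀ x, s (f x) = f' x := by
  obtain ⟨s, hs, hsf, -⟩ := exists_isSectionAt hK f f' h (0 : E →+ E) 0 hfc hf hker hhf hfh
    (fun _ => rfl) fun k hk => (exists_lift_comp hp hk).imp fun y hy => ⟨hy.1, hy.2, rfl⟩
  exact ⟨s, hs, hsf⟩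

/-- A section of `p` on the component at `c` exists. -/
theorem exists_isSectionAt_free {p : E →ₗ[NT X] K} (hp : Function.Surjective p)
    (hK : EmbedsInFree K) (c : Obj X) : ∃ s, IsSectionAt p c s := by
  obtain ⟨s, hs, -⟩ := exists_isSectionAt_extending hp hK (c := c) (0 : K →+ K) 0
    (AddMonoidHom.id K) (fun _ => smul_zero _) (fun _ => map_zero p) (fun _ _ => rfl)
    (fun _ => rfl) fun k _ hk => ⟨0, hk.symm⟩
  exact ⟨s, hs⟩

/-- The additive maps `s` and `t` on the components at `a` and `b` are compatible with a morphism
from `a` to `b`. -/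
def Compat {a b : Obj X} (g : Gen a b) (s t : K →+ E) : Prop :=
  ∀ k, t (NT.of g • k) = NT.of g • s k

theorem IsSectionAt.p_smul {p : E →ₗ[NT X] K} {a b : Obj X} {s : K →+ E} (hs : IsSectionAt p a s)
    (g : Gen a b) (k : K) : p (NT.of g • s k) = NT.of g • k := by
  rw [p.map_smul, hs.right_inv, ← mul_smul, NT.mul_source]

variable {p : E →ₗ[NT X] K}

/-- Sections at a set `U` open in `Y` can be extended to `Y`, if they are compatible with the kernel
of `i`. -/
theorem exists_isSectionAt_of_i {T : Type*} [AddCommGroup T] (hK : EmbedsInFree K)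
    (hKe : IsExact (X := X) K) {U Y C : LC X} (h : IsExtension U Y C) {j : ZMod 2} {s : K →+ E}
    (hs : IsSectionAt p (U, j) s)
    (hker : ∀ z, NT.of (Gen.i h.1 j) • z = 0 → NT.of (Gen.i h.1 j) • s z = 0)
    (κ : E →+ T) (l : K →+ T)
    (hκf : ∀ z, κ (NT.of (Gen.i h.1 j) • s z) = l (NT.of (Gen.i h.1 j) • z))
    (hκ : ∀ k, NT.e (Y, j) • k = k → ∃ y, NT.e (Y, j) • y = y ∧ p y = k ∧ κ y = l k) :
    ∃ t, IsSectionAt p (Y, j) t ∧ Compat (Gen.i h.1 j) s t ∧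
      ∀ k, κ (t k) = l (NT.e (Y, j) • k) :=
  exists_isSectionAt hK (DistribSMul.toAddMonoidHom K (NT.of (Gen.i h.1 j)))
    ((DistribSMul.toAddMonoidHom E (NT.of (Gen.i h.1 j))).comp s)
    (DistribSMul.toAddMonoidHom K (NT.of (Gen.r h.isClosedIn j))) κ l
    (fun _ => e_smul_of_smul _ _)
    (fun x => hs.p_smul _ x) hker
    (fun x => (mul_smul _ _ x).symm.trans (by rw [NT.r_mul_i h, zero_smul]))
    (fun k hk hk0 => (hKe.exists_i h hk hk0).imp fun _ => And.right) hκf hκ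

/-- Compatible sections at `Y` and an open subset respect the kernel of the restriction to the
closed complement. -/
theorem r_smul_eq_zero (hKe : IsExact (X := X) K) {U Y C : LC X} (h : IsExtension U Y C)
    {j : ZMod 2} {s t : K →+ E} (ht : IsSectionAt p (Y, j) t) (hst : Compat (Gen.i h.1 j) s t)
    {k : K} (hk : NT.of (Gen.r h.isClosedIn j) • k = 0) :
    NT.of (Gen.r h.isClosedIn j) • t k = 0 := by
  obtain ⟨u, -, hu⟩ := hKe.exists_i h (m := NT.e (Y, j) • k) (e_smul_mem_comp K _ k)
    (by rw [← mul_smul, NT.mul_source, hk])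
  rw [← ht.map_smul, ← hu, hst, ← mul_smul, NT.r_mul_i h, zero_smul]

/-- Compatible sections at `Y` and an open subset induce sections at the closed complement. -/
theorem exists_isSectionAt_of_r {T : Type*} [AddCommGroup T] (hK : EmbedsInFree K)
    (hKe : IsExact (X := X) K) {U Y C : LC X} (h : IsExtension U Y C) {j : ZMod 2} {s t : K →+ E}
    (ht : IsSectionAt p (Y, j) t) (hst : Compat (Gen.i h.1 j) s t)
    (κ : E →+ T) (l : K →+ T)
    (hκf : ∀ z, κ (NT.of (Gen.r h.isClosedIn j) • t z) = l (NT.of (Gen.r h.isClosedIn j) • z))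
    (hκ : ∀ k, NT.e (C, j) • k = k → ∃ y, NT.e (C, j) • y = y ∧ p y = k ∧ κ y = l k) :
    ∃ v, IsSectionAt p (C, j) v ∧ Compat (Gen.r h.isClosedIn j) t v ∧
      ∀ k, κ (v k) = l (NT.e (C, j) • k) :=
  exists_isSectionAt hK (DistribSMul.toAddMonoidHom K (NT.of (Gen.r h.isClosedIn j)))
    ((DistribSMul.toAddMonoidHom E (NT.of (Gen.r h.isClosedIn j))).comp t)
    (DistribSMul.toAddMonoidHom K (NT.of (Gen.δ h.isBoundaryPair j))) κ l
    (fun _ => e_smul_of_smul _ _)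
    (fun x => ht.p_smul _ x) (fun x hx => r_smul_eq_zero hKe h ht hst hx)
    (fun x => (mul_smul _ _ x).symm.trans (by rw [NT.δ_mul_r h, zero_smul]))
    (fun k hk hk0 => (hKe.exists_r h hk hk0).imp fun _ => And.right) hκf hκ

/-- Compatible sections at `Y` and a closed subset induce sections in the next degree at the open
complement. -/
theorem exists_isSectionAt_of_δ (hp : Function.Surjective p) (hK : EmbedsInFree K)
    (hKe : IsExact (X := X) K) {U Y C : LC X} (h : IsExtension U Y C) {j : ZMod 2} {t v : K →+ E}
    (hv : IsSectionAt p (C, j) v) (htv : Compat (Gen.r h.isClosedIn j) t v) :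
    ∃ s, IsSectionAt p (U, j + 1) s ∧ Compat (Gen.δ h.isBoundaryPair j) v s :=
  exists_isSectionAt_extending hp hK
    (DistribSMul.toAddMonoidHom K (NT.of (Gen.δ h.isBoundaryPair j)))
    ((DistribSMul.toAddMonoidHom E (NT.of (Gen.δ h.isBoundaryPair j))).comp v)
    (DistribSMul.toAddMonoidHom K (NT.of (Gen.i h.1 (j + 1))))
    (fun _ => e_smul_of_smul _ _)
    (fun x => hv.p_smul _ x)
    (fun k hk => by
      obtain ⟨u, -, hu⟩ := hKe.exists_r h (m := NT.e (C, j) • k) (e_smul_mem_comp K _ k)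
        (by rw [← mul_smul, NT.mul_source]; exact hk)
      change NT.of (Gen.δ h.isBoundaryPair j) • v k = 0
      rw [← hv.map_smul, ← hu, htv, ← mul_smul, NT.δ_mul_r h, zero_smul])
    (fun x => (mul_smul _ _ x).symm.trans (by rw [NT.i_mul_δ h, zero_smul]))
    fun k hk hk0 => (hKe.exists_δ h hk hk0).imp fun _ => And.right

theorem Compat.comp {a b c : Obj X} {g : Gen a b} {g' : Gen b c} {g'' : Gen a c}
    {s t v : K →+ E} (h : Compat g s t) (h' : Compat g' t v)
    (hg : NT.of g' * NT.of g = NT.of g'') : Compat g'' s v := fun k => by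
  rw [← hg, mul_smul, h', h, mul_smul]

/-- Sections at the two pieces of a topologically disjoint union, given in the form of a direct sum
decomposition of the object, induce a compatible section. -/
theorem exists_isSectionAt_of_directSum {c : Bool → Obj X} {d : Obj X}
    (f : ∀ b, Gen (c b) d) (g : ∀ b, Gen d (c b))
    (hfg : NT.of (f false) * NT.of (g false) + NT.of (f true) * NT.of (g true) = NT.e d)
    (hgf : ∀ b, NT.of (g b) * NT.of (f b) = NT.e (c b))
    (hgf' : ∀ b, NT.of (g (!b)) * NT.of (f b) = 0) {s : Bool → K →+ E}
    (hs : ∀ b, IsSectionAt p (c b) (s b)) :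
    ∃ t, IsSectionAt p d t ∧ (∀ b, Compat (f b) (s b) t) ∧ ∀ b, Compat (g b) t (s b) := by
  let t : K →+ E := ∑ b, (DistribSMul.toAddMonoidHom E (NT.of (f b))).comp
    ((s b).comp (DistribSMul.toAddMonoidHom K (NT.of (g b))))
  have ht : ∀ k, t k = NT.of (f false) • s false (NT.of (g false) • k) +
      NT.of (f true) • s true (NT.of (g true) • k) := fun k => by
    rw [add_comm]
    simp [t]
  have h1 : ∀ b, Compat (f b) (s b) t := fun b k => by
    have h2 := hgf b
    have h3 := hgf' b
    cases b
    · rw [ht, ← mul_smul, ← mul_smul, h2, show NT.of (g true) * _ = 0 from h3, zero_smul, map_zero,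
        smul_zero, add_zero, (hs _).map_smul]
    · rw [ht, ← mul_smul, ← mul_smul, h2, show NT.of (g false) * _ = 0 from h3, zero_smul,
        map_zero, smul_zero, zero_add, (hs _).map_smul]
  refine ⟨t, ⟨fun k => ?_, fun k => ?_, fun k => ?_⟩, h1, fun b k => ?_⟩
  · rw [ht, smul_add, ← mul_smul, ← mul_smul, NT.target_mul, NT.target_mul]
  · rw [ht, ht, ← mul_smul, ← mul_smul, NT.mul_source, NT.mul_source]
  · rw [ht, map_add, (hs _).p_smul, (hs _).p_smul, ← mul_smul, ← mul_smul, ← add_smul, hfg]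
  · have h2 := hgf b
    have h3 := hgf' (!b)
    rw [Bool.not_not] at h3
    cases b
    · rw [ht, smul_add, ← mul_smul, ← mul_smul, h2,
        show NT.of (g false) * NT.of (f true) = 0 from h3, zero_smul, add_zero, (hs _).smul]
    · rw [ht, smul_add, ← mul_smul, ← mul_smul, h2,
        show NT.of (g true) * NT.of (f false) = 0 from h3, zero_smul, zero_add, (hs _).smul]

/-- The sum of sections at all objects has the given sections as its components. -/
theorem smul_eq_sum_of_isSectionAt {s : Obj X → K →+ E} (hs : ∀ c, IsSectionAt p c (s c))
    {a : Obj X} (k : K) : NT.e a • (∑ c, s c) k = s a k := by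
  classical
  rw [AddMonoidHom.finsetSum_apply, Finset.smul_sum, Finset.sum_eq_single a]
  · exact (hs a).smul k
  · intro c _ hc
    rw [← (hs c).smul, ← mul_smul, NT.e_mul_e hc.symm, zero_smul]
  · simp

theorem sum_smul_eq_of_isSectionAt {s : Obj X → K →+ E} (hs : ∀ c, IsSectionAt p c (s c))
    {a : Obj X} (k : K) : (∑ c, s c) (NT.e a • k) = s a k := by
  classical
  rw [AddMonoidHom.finsetSum_apply, Finset.sum_eq_single a]
  · exact (hs a).map_smul k
  · intro c _ hc
    rw [← (hs c).map_smul, ← mul_smul, NT.e_mul_e hc, zero_smul, map_zero]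
  · simp

/-- The elements whose actions on the source and the target are intertwined by `σ`. -/
def commutant (σ : K →+ E) : Subring (NT X) where
  carrier := {x | ∀ k, σ (x • k) = x • σ k}
  one_mem' k := by rw [one_smul, one_smul]
  mul_mem' {x y} hx hy k := by
    rw [mul_smul, hx, hy, mul_smul]
  zero_mem' k := by rw [zero_smul, zero_smul, map_zero]
  add_mem' {x y} hx hy k := by rw [add_smul, add_smul, map_add, hx, hy]
  neg_mem' {x} hx k := by rw [neg_smul, neg_smul, map_neg, hx]

end

/-- Sections at all objects that are compatible with the essential generators form a module
homomorphism. -/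
theorem PseudoCircle.exists_section_of_essential {E K : Type u} [AddCommGroup E]
    [Module (NT PseudoCircle) E] [AddCommGroup K] [Module (NT PseudoCircle) K]
    {p : E →ₗ[NT PseudoCircle] K} {s : Obj PseudoCircle → K →+ E}
    (hs : ∀ c, IsSectionAt p c (s c))
    (h : Essential fun {a b} g => Compat g (s a) (s b)) :
    ∃ σ : K →ₗ[NT PseudoCircle] E, p ∘ₗ σ = LinearMap.id := by
  have he : ∀ a, NT.e a ∈ commutant (∑ c, s c) := fun a k => by
    rw [sum_smul_eq_of_isSectionAt hs, smul_eq_sum_of_isSectionAt hs]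
  have hof : ∀ {a b : Obj PseudoCircle} (g : Gen a b), Compat g (s a) (s b) →
      NT.of g ∈ commutant (∑ c, s c) := fun {a b} g hg k => by
    have h1 := hg k
    rw [← sum_smul_eq_of_isSectionAt hs, ← mul_smul, NT.target_mul,
      ← smul_eq_sum_of_isSectionAt hs k, ← mul_smul, NT.mul_source] at h1
    exact h1
  have h' : Essential fun g => NT.of g ∈ commutant (∑ c, s c) :=
    ⟨fun _ _ _ => hof _ (h.i_opn _ _ _), fun _ _ _ => hof _ (h.r_opn _ _ _),
      fun _ _ _ => hof _ (h.i_clo _ _ _), fun _ _ _ => hof _ (h.r_clo _ _ _),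
      fun _ _ _ => hof _ (h.i_hull _ _ _), fun _ _ _ => hof _ (h.i_univ _ _ _),
      fun _ _ _ _ => hof _ (h.i_edge _ _ _ _), fun _ _ _ _ => hof _ (h.r_edge _ _ _ _),
      fun _ _ _ => hof _ (h.r_univ _ _ _), fun _ _ _ => hof _ (h.r_hull _ _ _),
      fun _ _ => hof _ (h.δ _ _)⟩
  refine ⟨{ (∑ c, s c : K →+ E) with map_smul' := fun x k => h'.mem he x k },
    LinearMap.ext fun k => ?_⟩
  change p ((∑ c, s c) k) = k
  rw [AddMonoidHom.finsetSum_apply, map_sum]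
  conv_rhs => rw [← sum_e_smul (X := PseudoCircle) k]
  exact Finset.sum_congr rfl fun c _ => (hs c).right_inv k

namespace PseudoCircle

open NT
open Finset (univ)

/-! ### Relations between the essential generators -/

theorem isOpenIn_univ (A B : Finset Bool) : IsOpenIn (lc A B) (lc univ B) :=
  isOpenIn_lc.2 ⟨Finset.subset_univ _, subset_rfl, Or.inr rfl⟩

theorem isExtension_opn_clo (A B : Finset Bool) : IsExtension (lc ∅ B) (lc A B) (lc A ∅) :=
  isExtension_lc.2 ⟨⟨Finset.empty_subset _, subset_rfl, Or.inl rfl⟩, Finset.sdiff_empty.symm,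
    (Finset.sdiff_self _).symm⟩

theorem univ_sdiff_singleton (x : Bool) : univ \ {x} = ({!x} : Finset Bool) := by
  revert x
  decide

theorem univ_sdiff_singleton_not (x : Bool) : univ \ {!x} = ({x} : Finset Bool) := by
  revert x
  decide

theorem singleton_union_singleton : ({false} ∪ {true} : Finset Bool) = univ := by decide

theorem isExtension_opn (A : Finset Bool) (b : Bool) :
    IsExtension (lc ∅ {!b}) (lc A univ) (lc A {b}) :=
  isExtension_lc.2 ⟨⟨Finset.empty_subset _, Finset.subset_univ _, Or.inl rfl⟩,
    Finset.sdiff_empty.symm, (univ_sdiff_singleton_not b).symm⟩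

theorem isExtension_clo (x : Bool) (B : Finset Bool) :
    IsExtension (lc {x} B) (lc univ B) (lc {!x} ∅) :=
  isExtension_lc.2 ⟨⟨Finset.subset_univ _, subset_rfl, Or.inr rfl⟩,
    (univ_sdiff_singleton x).symm, (Finset.sdiff_self _).symm⟩

theorem i_opn_mul_r_opn (j : ZMod 2) :
    of (Gen.i (isOpenIn_opn_of_subset (Finset.subset_univ {false})) j) *
        of (Gen.r (isClosedIn_opn (Finset.subset_univ {false})) j) +
      of (Gen.i (isOpenIn_opn_of_subset (Finset.subset_univ {true})) j) *
        of (Gen.r (isClosedIn_opn (Finset.subset_univ {true})) j) = e (lc ∅ univ, j) :=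
  disjoint_union (disjoint_lc.2 (by simp))
    (by rw [← lc_union, Finset.empty_union, singleton_union_singleton]) _ _ _ _ j

theorem i_clo_mul_r_clo (j : ZMod 2) :
    of (Gen.i (isOpenIn_clo (Finset.subset_univ {false})) j) *
        of (Gen.r (isClosedIn_clo_of_subset (Finset.subset_univ {false})) j) +
      of (Gen.i (isOpenIn_clo (Finset.subset_univ {true})) j) *
        of (Gen.r (isClosedIn_clo_of_subset (Finset.subset_univ {true})) j) =
          e (lc univ ∅, j) :=
  disjoint_union (disjoint_lc.2 (by simp))
    (by rw [← lc_union, Finset.empty_union, singleton_union_singleton]) _ _ _ _ j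

theorem inter_not (x : Bool) : (∅ : Finset Bool) = {x} ∩ {!x} := by
  revert x
  decide

theorem r_opn_not_mul_i_opn (b : Bool) (j : ZMod 2) :
    of (Gen.r (isClosedIn_opn (Finset.subset_univ {!b})) j) *
      of (Gen.i (isOpenIn_opn_of_subset (Finset.subset_univ {b})) j) = 0 := by
  rw [r_i _ _ (eq_inter_lc (Finset.inter_self ∅).symm (inter_not b))
    (isOpenIn_opn_of_subset (Finset.empty_subset _)) (isClosedIn_opn (Finset.empty_subset _)),
    of_eq_zero_of_source _ (e_eq_zero lc_empty j), zero_mul]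

theorem r_clo_not_mul_i_clo (x : Bool) (j : ZMod 2) :
    of (Gen.r (isClosedIn_clo_of_subset (Finset.subset_univ {!x})) j) *
      of (Gen.i (isOpenIn_clo (Finset.subset_univ {x})) j) = 0 := by
  rw [r_i _ _ (eq_inter_lc (inter_not x) (Finset.inter_self ∅).symm)
    (isOpenIn_clo (Finset.empty_subset _)) (isClosedIn_clo_of_subset (Finset.empty_subset _)),
    of_eq_zero_of_source _ (e_eq_zero lc_empty j), zero_mul]

/-- Restriction from `lc A univ` to `lc A {b}`, followed by extension to `lc univ {b}`. -/
noncomputable def edge (A : Finset Bool) (b : Bool) (j : ZMod 2) : NT PseudoCircle :=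
  of (Gen.i (isOpenIn_univ A {b}) j) * of (Gen.r (isClosedIn_univ A {b}) j)

theorem edge_univ (b : Bool) (j : ZMod 2) :
    edge univ b j = of (Gen.r (isClosedIn_univ univ {b}) j) := by
  rw [edge, i_self, NT.target_mul]

theorem e_mul_edge (A : Finset Bool) (b : Bool) (j : ZMod 2) :
    e (lc univ {b}, j) * edge A b j = edge A b j := by
  rw [edge, ← mul_assoc, NT.target_mul]

theorem edge_mul_e (A : Finset Bool) (b : Bool) (j : ZMod 2) :
    edge A b j * e (lc A univ, j) = edge A b j := by
  rw [edge, mul_assoc, mul_source]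

theorem r_mul_edge (A : Finset Bool) (b : Bool) (j : ZMod 2) :
    of (Gen.r (isClosedIn_clo univ {b}) j) * edge A b j =
      of (Gen.i (isOpenIn_clo (Finset.subset_univ A)) j) *
        of (Gen.r (isClosedIn_clo A univ) j) := by
  rw [edge, ← mul_assoc, r_i (isOpenIn_univ A {b}) _ (eq_inter_lc (A'' := A) (B'' := ∅)
    (Finset.inter_univ A).symm rfl)
    (isOpenIn_univ A ∅) (isClosedIn_clo A {b}), mul_assoc, r_comp _ _ (isClosedIn_clo A univ)]

theorem edge_mul_i (A : Finset Bool) (b : Bool) (j : ZMod 2) :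
    edge A b j * of (Gen.i (isOpenIn_opn A univ) j) =
      of (Gen.i (isOpenIn_opn univ {b}) j) *
        of (Gen.r (isClosedIn_opn (Finset.subset_univ {b})) j) := by
  rw [edge, mul_assoc, r_i (isOpenIn_opn A univ) (isClosedIn_univ A {b})
    (eq_inter_lc (Finset.empty_inter _).symm (Finset.univ_inter _).symm) (isOpenIn_opn A {b})
    (isClosedIn_opn (Finset.subset_univ {b})), ← mul_assoc, i_comp _ _ (isOpenIn_opn univ {b})]

theorem r_univ_mul_i_univ (A : Finset Bool) (b : Bool) (j : ZMod 2) :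
    of (Gen.r (isClosedIn_univ univ {b}) j) * of (Gen.i (isOpenIn_univ A univ) j) =
      edge A b j :=
  r_i _ _ (eq_inter_lc (Finset.inter_univ _).symm (Finset.univ_inter _).symm) _ _ j

theorem r_clo_mul_i_univ (x : Bool) (h : IsClosedIn (lc {x} ∅) (lc univ univ)) (j : ZMod 2) :
    of (Gen.r h j) * of (Gen.i (isOpenIn_univ {x} univ) j) =
      of (Gen.r (isClosedIn_clo {x} univ) j) := by
  rw [r_i (isOpenIn_univ {x} univ) h (eq_inter_lc (A'' := {x}) (B'' := ∅)
    (Finset.inter_self _).symm rfl) (.refl _) (isClosedIn_clo {x} univ), i_self, NT.target_mul]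

/-! ### Extensions and compatible sections -/

section

variable {E K : Type u} [AddCommGroup E] [Module (NT PseudoCircle) E] [AddCommGroup K]
  [Module (NT PseudoCircle) K]

/-- The properties of an extension `p : E → K` from which a splitting is constructed: both `K` and
the kernel of `p` are exact, `K` is a subgroup of a free group, and the boundary maps of `K` in even
degree and those of the kernel in odd degree vanish. -/
structure IsSplittable (p : E →ₗ[NT PseudoCircle] K) : Prop where
  surj : Function.Surjective p
  free : EmbedsInFree K
  exact : IsExact (X := PseudoCircle) K
  δ_zero : ∀ {C U : LC PseudoCircle} (h : IsBoundaryPair C U) (k : K), of (Gen.δ h 0) • k = 0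
  exact_ker : IsExact (X := PseudoCircle) (LinearMap.ker p)
  δ_one : ∀ {C U : LC PseudoCircle} (h : IsBoundaryPair C U) (n : LinearMap.ker p),
    of (Gen.δ h 1) • n = 0

namespace IsSplittable

variable {p : E →ₗ[NT PseudoCircle] K}

/-- Exactness of the kernel of `p` at `Y`, in terms of elements of `E`. -/
theorem exists_i_ker (D : IsSplittable p) {U Y C : LC PseudoCircle} (h : IsExtension U Y C)
    {j : ZMod 2} {y : E} (hy : e (Y, j) • y = y) (hpy : p y = 0)
    (hr : of (Gen.r h.isClosedIn j) • y = 0) :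
    ∃ n, e (U, j) • n = n ∧ p n = 0 ∧ of (Gen.i h.1 j) • n = y := by
  obtain ⟨n, hn, hny⟩ := D.exact_ker.exists_i h (m := ⟨y, hpy⟩) (Subtype.ext hy) (Subtype.ext hr)
  exact ⟨n, congrArg Subtype.val hn, n.2, congrArg Subtype.val hny⟩

/-- In odd degree, elements of `K` at `Y` can be lifted with a prescribed restriction to a closed
subset, because the restriction maps of the kernel are surjective. -/
theorem exists_lift_r (D : IsSplittable p) {U Y C : LC PseudoCircle} (h : IsExtension U Y C)
    {k : K} (hk : e (Y, 1) • k = k) {z : E} (hz : e (C, 1) • z = z)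
    (hpz : p z = of (Gen.r h.isClosedIn 1) • k) :
    ∃ y, e (Y, 1) • y = y ∧ p y = k ∧ of (Gen.r h.isClosedIn 1) • y = z := by
  obtain ⟨y, hy, rfl⟩ := exists_lift_comp D.surj hk
  have h1 : p (z - of (Gen.r h.isClosedIn 1) • y) = 0 := by
    rw [map_sub, hpz, map_smul, sub_self]
  obtain ⟨n, hn, hnz⟩ := D.exact_ker.exists_r h (j := 1) (m := ⟨_, h1⟩)
    (Subtype.ext (by
      change e (C, 1) • (z - of (Gen.r h.isClosedIn 1) • y) = _
      rw [smul_sub, hz, e_smul_of_smul])) (D.δ_one _ _)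
  refine ⟨y + n, ?_, ?_, ?_⟩
  · rw [smul_add, hy, show e (Y, 1) • (n : E) = n from congrArg Subtype.val hn]
  · rw [map_add, n.2, add_zero]
  · have h2 : of (Gen.r h.isClosedIn 1) • (n : E) = z - of (Gen.r h.isClosedIn 1) • y :=
      congrArg Subtype.val hnz
    rw [smul_add, h2, add_sub_cancel]

/-- In odd degree, the extension maps `i` of `K` are injective. -/
theorem e_smul_eq_zero (D : IsSplittable p) {U Y C : LC PseudoCircle} (h : IsExtension U Y C)
    {k : K} (hk : of (Gen.i h.1 1) • k = 0) : e (U, 1) • k = 0 := by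
  have h1 : of (Gen.i h.1 (0 + 1)) • e (U, 0 + 1) • k = 0 := by
    rw [← mul_smul, mul_source]
    exact hk
  obtain ⟨u, -, hu⟩ := D.exact.exists_δ h (e_smul_mem_comp K _ k) h1
  rw [D.δ_zero] at hu
  exact hu.symm

/-- In even degree, the restriction maps of `K` are surjective. -/
theorem exists_r_smul_eq (D : IsSplittable p) {U Y C : LC PseudoCircle} (h : IsExtension U Y C)
    {k : K} (hk : e (C, 0) • k = k) : ∃ u, of (Gen.r h.isClosedIn 0) • u = k :=
  (D.exact.exists_r h hk (D.δ_zero _ _)).imp fun _ => And.right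

end IsSplittable

/-- Sections of degree `j` at all objects that are compatible with the generators of degree `0` in
`Essential`. -/
structure SectionFamily (p : E →ₗ[NT PseudoCircle] K) (j : ZMod 2) where
  /-- The section at `lc A B`. -/
  s : Finset Bool → Finset Bool → K →+ E
  isSectionAt : ∀ A B, IsSectionAt p (lc A B, j) (s A B)
  i_opn : ∀ b, Compat (Gen.i (isOpenIn_opn_of_subset (Finset.subset_univ {b})) j)
    (s ∅ {b}) (s ∅ univ)
  r_opn : ∀ b, Compat (Gen.r (isClosedIn_opn (Finset.subset_univ {b})) j) (s ∅ univ) (s ∅ {b})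
  i_clo : ∀ x, Compat (Gen.i (isOpenIn_clo (Finset.subset_univ {x})) j) (s {x} ∅) (s univ ∅)
  r_clo : ∀ x, Compat (Gen.r (isClosedIn_clo_of_subset (Finset.subset_univ {x})) j)
    (s univ ∅) (s {x} ∅)
  i_hull : ∀ x, Compat (Gen.i (isOpenIn_opn {x} univ) j) (s ∅ univ) (s {x} univ)
  i_univ : ∀ x, Compat (Gen.i (isOpenIn_univ {x} univ) j) (s {x} univ) (s univ univ)
  i_edge : ∀ x b, Compat (Gen.i (isOpenIn_univ {x} {b}) j) (s {x} {b}) (s univ {b})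
  r_edge : ∀ x b, Compat (Gen.r (isClosedIn_univ {x} {b}) j) (s {x} univ) (s {x} {b})
  r_univ : ∀ b, Compat (Gen.r (isClosedIn_univ univ {b}) j) (s univ univ) (s univ {b})
  r_hull : ∀ b, Compat (Gen.r (isClosedIn_clo univ {b}) j) (s univ {b}) (s univ ∅)

/-- Functions on the subsets of a set with two elements are given by the values at the empty set, at
the two singletons, and at the full set. -/
def finsetBoolCases {α : Type*} (z : α) (f : Bool → α) (t : α) (A : Finset Bool) : α :=
  if A = ∅ then z else if A = univ then t else f (decide (true ∈ A))

section

variable {α : Type*} (z : α) (f : Bool → α) (t : α)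

@[simp] theorem finsetBoolCases_empty : finsetBoolCases z f t ∅ = z := rfl

@[simp] theorem finsetBoolCases_univ : finsetBoolCases z f t univ = t := rfl

@[simp] theorem finsetBoolCases_singleton (x : Bool) : finsetBoolCases z f t {x} = f x := by
  cases x <;> rfl

end

/-- A family of compatible sections is determined by the sections at the nonempty subsets. -/
def SectionFamily.mk' {p : E →ₗ[NT PseudoCircle] K} {j : ZMod 2} {sO sC sH sR : Bool → K →+ E}
    {sE : Bool → Bool → K →+ E} {sOO sCC sX : K →+ E}
    (hO : ∀ b, IsSectionAt p (lc ∅ {b}, j) (sO b)) (hC : ∀ x, IsSectionAt p (lc {x} ∅, j) (sC x))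
    (hH : ∀ x, IsSectionAt p (lc {x} univ, j) (sH x))
    (hR : ∀ b, IsSectionAt p (lc univ {b}, j) (sR b))
    (hE : ∀ x b, IsSectionAt p (lc {x} {b}, j) (sE x b))
    (hOO : IsSectionAt p (lc ∅ univ, j) sOO) (hCC : IsSectionAt p (lc univ ∅, j) sCC)
    (hX : IsSectionAt p (lc univ univ, j) sX)
    (i_opn : ∀ b, Compat (Gen.i (isOpenIn_opn_of_subset (Finset.subset_univ {b})) j) (sO b) sOO)
    (r_opn : ∀ b, Compat (Gen.r (isClosedIn_opn (Finset.subset_univ {b})) j) sOO (sO b))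
    (i_clo : ∀ x, Compat (Gen.i (isOpenIn_clo (Finset.subset_univ {x})) j) (sC x) sCC)
    (r_clo : ∀ x, Compat (Gen.r (isClosedIn_clo_of_subset (Finset.subset_univ {x})) j) sCC (sC x))
    (i_hull : ∀ x, Compat (Gen.i (isOpenIn_opn {x} univ) j) sOO (sH x))
    (i_univ : ∀ x, Compat (Gen.i (isOpenIn_univ {x} univ) j) (sH x) sX)
    (i_edge : ∀ x b, Compat (Gen.i (isOpenIn_univ {x} {b}) j) (sE x b) (sR b))
    (r_edge : ∀ x b, Compat (Gen.r (isClosedIn_univ {x} {b}) j) (sH x) (sE x b))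
    (r_univ : ∀ b, Compat (Gen.r (isClosedIn_univ univ {b}) j) sX (sR b))
    (r_hull : ∀ b, Compat (Gen.r (isClosedIn_clo univ {b}) j) (sR b) sCC) :
    SectionFamily p j where
  s A B := finsetBoolCases (finsetBoolCases 0 sO sOO B)
    (fun x => finsetBoolCases (sC x) (sE x) (sH x) B) (finsetBoolCases sCC sR sX B) A
  isSectionAt A B := by
    obtain rfl | ⟨x, rfl⟩ | rfl := finset_bool_cases A <;>
    obtain rfl | ⟨b, rfl⟩ | rfl := finset_bool_cases B <;>
    simp only [finsetBoolCases_empty, finsetBoolCases_univ, finsetBoolCases_singleton]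
    exacts [isSectionAt_zero (e_eq_zero lc_empty j), hO b, hOO, hC x, hE x b, hH x, hCC, hR b, hX]
  i_opn b := by
    simpa only [finsetBoolCases_empty, finsetBoolCases_univ, finsetBoolCases_singleton]
      using i_opn b
  r_opn b := by
    simpa only [finsetBoolCases_empty, finsetBoolCases_univ, finsetBoolCases_singleton]
      using r_opn b
  i_clo x := by
    simpa only [finsetBoolCases_empty, finsetBoolCases_univ, finsetBoolCases_singleton]
      using i_clo x
  r_clo x := by
    simpa only [finsetBoolCases_empty, finsetBoolCases_univ, finsetBoolCases_singleton]
      using r_clo x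
  i_hull x := by
    simpa only [finsetBoolCases_empty, finsetBoolCases_univ, finsetBoolCases_singleton]
      using i_hull x
  i_univ x := by
    simpa only [finsetBoolCases_empty, finsetBoolCases_univ, finsetBoolCases_singleton]
      using i_univ x
  i_edge x b := by
    simpa only [finsetBoolCases_empty, finsetBoolCases_univ, finsetBoolCases_singleton]
      using i_edge x b
  r_edge x b := by
    simpa only [finsetBoolCases_empty, finsetBoolCases_univ, finsetBoolCases_singleton]
      using r_edge x b
  r_univ b := by
    simpa only [finsetBoolCases_empty, finsetBoolCases_univ, finsetBoolCases_singleton]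
      using r_univ b
  r_hull b := by
    simpa only [finsetBoolCases_empty, finsetBoolCases_univ, finsetBoolCases_singleton]
      using r_hull b

end

section

variable {E K : Type u} [AddCommGroup E] [Module (NT PseudoCircle) E] [AddCommGroup K]
  [Module (NT PseudoCircle) K] {p : E →ₗ[NT PseudoCircle] K}

/-! ### Sections at the whole space -/

/-- The elements at the whole space that come from the two open subsets `lc {x} univ` form the
kernel of a restriction map followed by a boundary map. So compatible sections at these induce
sections at the whole space, provided that the sections at `lc ∅ univ` are compatible with the
kernel of `i`. -/
theorem exists_isSectionAt_univ {T : Type*} [AddCommGroup T] (hK : EmbedsInFree K)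
    (hKe : IsExact (X := PseudoCircle) K) {j : ZMod 2} {sOO : K →+ E} {sH : Bool → K →+ E}
    (hH : ∀ x, IsSectionAt p (lc {x} univ, j) (sH x))
    (i_hull : ∀ x, Compat (Gen.i (isOpenIn_opn {x} univ) j) sOO (sH x))
    (hker : ∀ z, of (Gen.i (isOpenIn_opn univ univ) j) • z = 0 →
      of (Gen.i (isOpenIn_opn univ univ) j) • sOO z = 0)
    (κ : E →+ T) (l : K →+ T)
    (hκf : ∀ x z, κ (of (Gen.i (isOpenIn_univ {x} univ) j) • sH x z) =
      l (of (Gen.i (isOpenIn_univ {x} univ) j) • z))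
    (hκ : ∀ k, e (lc univ univ, j) • k = k →
      ∃ y, e (lc univ univ, j) • y = y ∧ p y = k ∧ κ y = l k) :
    ∃ t, IsSectionAt p (lc univ univ, j) t ∧
      (∀ x, Compat (Gen.i (isOpenIn_univ {x} univ) j) (sH x) t) ∧
      ∀ k, κ (t k) = l (e (lc univ univ, j) • k) := by
  -- The exact sequences for `lc {!x} univ` and its complement.
  have hr : ∀ x, IsClosedIn (lc {x} ∅) (lc univ univ) := fun x => isClosedIn_lc.2 (by simp)
  have hri : ∀ x, of (Gen.r (hr (!x)) j) * of (Gen.i (isOpenIn_univ {x} univ) j) = 0 :=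
    fun x => r_mul_i (isExtension_clo x univ) j
  let f : K × K →+ K :=
    (DistribSMul.toAddMonoidHom K (of (Gen.i (isOpenIn_univ {false} univ) j))).coprod
      (DistribSMul.toAddMonoidHom K (of (Gen.i (isOpenIn_univ {true} univ) j)))
  have hf : ∀ k, f k = of (Gen.i (isOpenIn_univ {false} univ) j) • k.1 +
    of (Gen.i (isOpenIn_univ {true} univ) j) • k.2 := fun k => rfl
  let f' : K × K →+ E :=
    ((DistribSMul.toAddMonoidHom E (of (Gen.i (isOpenIn_univ {false} univ) j))).comp
      (sH false)).coprod
      ((DistribSMul.toAddMonoidHom E (of (Gen.i (isOpenIn_univ {true} univ) j))).comp (sH true))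
  have hf' : ∀ k, f' k = of (Gen.i (isOpenIn_univ {false} univ) j) • sH false k.1 +
    of (Gen.i (isOpenIn_univ {true} univ) j) • sH true k.2 := fun k => rfl
  have hδ : IsExtension (lc ∅ univ) (lc {true} univ) (lc {true} ∅) := isExtension_opn_clo _ _
  have hii : ∀ x, of (Gen.i (isOpenIn_univ {x} univ) j) * of (Gen.i (isOpenIn_opn {x} univ) j) =
      of (Gen.i (isOpenIn_opn univ univ) j) := fun x => i_comp _ _ _ j
  obtain ⟨t, ht, htf, htκ⟩ := exists_isSectionAt (c := (lc univ univ, j)) (p := p) hK f f'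
    ((DistribSMul.toAddMonoidHom K (of (Gen.δ hδ.isBoundaryPair j))).comp
      (DistribSMul.toAddMonoidHom K (of (Gen.r (hr true) j)))) κ l
    (fun k => by rw [hf', smul_add, e_smul_of_smul, e_smul_of_smul])
    (fun k => by rw [hf', map_add, (hH _).p_smul, (hH _).p_smul, hf])
    (fun k hk => by
      -- Both components of `k` come from `lc ∅ univ`.
      have key : ∀ x (m m' : K), of (Gen.i (isOpenIn_univ {x} univ) j) • m +
          of (Gen.i (isOpenIn_univ {!x} univ) j) • m' = 0 →
          ∃ z, of (Gen.i (isOpenIn_opn {x} univ) j) • z = e (lc {x} univ, j) • m := by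
        intro x m m' h
        have h1 := congrArg (of (Gen.r (hr x) j) • ·) h
        have h2 := hri (!x)
        rw [Bool.not_not] at h2
        simp only [smul_add, smul_zero] at h1
        rw [← mul_smul, ← mul_smul, h2, zero_smul, add_zero, r_clo_mul_i_univ] at h1
        obtain ⟨z, -, hz⟩ := hKe.exists_i (isExtension_opn_clo {x} univ)
          (e_smul_mem_comp K _ m) (by rw [← mul_smul, mul_source, h1])
        exact ⟨z, hz⟩
      rw [hf] at hk
      obtain ⟨z, hz⟩ := key false k.1 k.2 hk
      obtain ⟨z', hz'⟩ := key true k.2 k.1 (by rw [add_comm]; exact hk)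
      have h1 : of (Gen.i (isOpenIn_opn univ univ) j) • (z + z') = 0 := by
        rw [smul_add]
        nth_rw 1 [← hii false]
        rw [← hii true, mul_smul, mul_smul, hz, hz', ← mul_smul, ← mul_smul, mul_source,
          mul_source, hk]
      have h2 := hker _ h1
      rw [map_add, smul_add] at h2
      nth_rw 1 [← hii false] at h2
      rw [← hii true, mul_smul, mul_smul, ← i_hull, ← i_hull, hz, hz', (hH _).map_smul,
        (hH _).map_smul] at h2
      rw [hf', h2])
    (fun k => by
      have h1 := hri false
      change of (Gen.δ hδ.isBoundaryPair j) • of (Gen.r (hr true) j) • f k = 0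
      rw [hf, smul_add, ← mul_smul (of (Gen.r _ _)), ← mul_smul (of (Gen.r _ _)),
        show of (Gen.r (hr true) j) * of (Gen.i (isOpenIn_univ {false} univ) j) = 0 from h1,
        zero_smul, zero_add, r_clo_mul_i_univ, ← mul_smul, δ_mul_r hδ, zero_smul])
    (fun k hk hk0 => by
      obtain ⟨k₂, -, hk₂⟩ := hKe.exists_r hδ (m := of (Gen.r (hr true) j) • k)
        (e_smul_of_smul _ _) hk0
      obtain ⟨k₁, -, hk₁⟩ := hKe.exists_i (isExtension_clo false univ) (j := j)
        (m := k - of (Gen.i (isOpenIn_univ {true} univ) j) • k₂)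
        (by rw [smul_sub, hk, e_smul_of_smul])
        (by
          change of (Gen.r (hr true) j) • _ = 0
          rw [smul_sub, ← mul_smul _ _ k₂, r_clo_mul_i_univ, hk₂, sub_self])
      exact ⟨(k₁, k₂), by rw [hf]; exact (congrArg (· + _) hk₁).trans (sub_add_cancel _ _)⟩)
    (fun k => by rw [hf', hf, map_add, map_add, hκf, hκf]) hκ
  refine ⟨t, ht, fun x k => ?_, htκ⟩
  cases x
  · have := htf (k, 0)
    rw [hf, hf', smul_zero, map_zero, smul_zero, add_zero, add_zero] at this
    exact this
  · have := htf (0, k)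
    rw [hf, hf', smul_zero, map_zero, smul_zero, zero_add, zero_add] at this
    exact this

/-! ### Sections of odd degree -/

/-- In odd degree, elements of `lc A univ` can be lifted in such a way that their images at both
`lc univ {b}` are the prescribed ones: the obstruction to this lies in the part of the kernel at
`lc ∅ univ`. -/
theorem exists_lift_edge (D : IsSplittable p) {sCC sA : K →+ E} {A : Finset Bool}
    (hA : IsSectionAt p (lc A ∅, 1) sA)
    (i_clo : Compat (Gen.i (isOpenIn_clo (Finset.subset_univ A)) 1) sA sCC)
    {sR : Bool → K →+ E} (hR : ∀ b, IsSectionAt p (lc univ {b}, 1) (sR b))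
    (r_hull : ∀ b, Compat (Gen.r (isClosedIn_clo univ {b}) 1) (sR b) sCC)
    {k : K} (hk : e (lc A univ, 1) • k = k) :
    ∃ y, e (lc A univ, 1) • y = y ∧ p y = k ∧ ∀ b, edge A b 1 • y = sR b (edge A b 1 • k) := by
  have hA' := isExtension_opn_clo A univ
  obtain ⟨y, hy, hyk, hyr⟩ := D.exists_lift_r hA' hk
    (z := sA (of (Gen.r hA'.isClosedIn 1) • k)) (hA.smul _)
    (by rw [hA.right_inv, e_smul_of_smul])
  have h1 : ∀ b, ∃ n, e (lc ∅ {b}, 1) • n = n ∧ p n = 0 ∧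
      of (Gen.i (isOpenIn_opn univ {b}) 1) • n =
        edge A b 1 • y - sR b (edge A b 1 • k) := by
    intro b
    refine D.exists_i_ker (isExtension_opn_clo univ {b}) ?_ ?_ ?_
    · rw [smul_sub, ← mul_smul, e_mul_edge, (hR b).smul]
    · rw [map_sub, map_smul, hyk, (hR b).right_inv, ← mul_smul, e_mul_edge, sub_self]
    · rw [smul_sub, ← mul_smul, r_mul_edge, mul_smul, hyr, ← i_clo, ← r_hull, ← mul_smul _ _ k,
        ← mul_smul _ _ k, r_mul_edge, sub_self]
  choose n hn hpn hni using h1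
  -- The correction term, an element of the kernel at `lc ∅ univ`.
  let m : E := of (Gen.i (isOpenIn_opn_of_subset (Finset.subset_univ {false})) 1) • n false +
    of (Gen.i (isOpenIn_opn_of_subset (Finset.subset_univ {true})) 1) • n true
  have hm : ∀ b, of (Gen.r (isClosedIn_opn (Finset.subset_univ {b})) 1) • m = n b := by
    intro b
    have h2 := r_mul_i_opn (Finset.subset_univ {b}) 1
    have h3 := r_opn_not_mul_i_opn (!b) 1
    cases b
    · rw [smul_add, ← mul_smul, ← mul_smul, h2,
        show of (Gen.r (isClosedIn_opn (Finset.subset_univ {false})) 1) *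
          of (Gen.i (isOpenIn_opn_of_subset (Finset.subset_univ {true})) 1) = 0 from h3, zero_smul,
        add_zero, hn]
    · rw [smul_add, ← mul_smul, ← mul_smul, h2,
        show of (Gen.r (isClosedIn_opn (Finset.subset_univ {true})) 1) *
          of (Gen.i (isOpenIn_opn_of_subset (Finset.subset_univ {false})) 1) = 0 from h3, zero_smul,
        zero_add, hn]
  have hpm : p m = 0 := by
    rw [map_add, map_smul, map_smul, hpn, hpn, smul_zero, smul_zero, add_zero]
  refine ⟨y - of (Gen.i (isOpenIn_opn A univ) 1) • m, ?_, ?_, fun b => ?_⟩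
  · rw [smul_sub, hy, e_smul_of_smul]
  · rw [map_sub, map_smul, hpm, smul_zero, sub_zero, hyk]
  · rw [smul_sub, ← mul_smul _ _ m, edge_mul_i, mul_smul _ _ m, hm, hni, sub_sub_cancel]

/-- Compatible sections of odd degree exist. Those at single points can be chosen arbitrarily, and
the others extend what these prescribe. Compatibility with the maps `i` out of open sets is
unproblematic because these are injective on `K`; the other compatibilities required at the same
time are expressed by the constraint `κ ∘ s = l`, which can be satisfied elementwise because the
restriction maps of the kernel are surjective. -/
theorem exists_sectionFamily_one (D : IsSplittable p) : Nonempty (SectionFamily p 1) := by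
  choose sO hO using fun b => exists_isSectionAt_free D.surj D.free (lc ∅ {b}, (1 : ZMod 2))
  choose sC hC using fun x => exists_isSectionAt_free D.surj D.free (lc {x} ∅, (1 : ZMod 2))
  obtain ⟨sOO, hOO, i_opn, r_opn⟩ := exists_isSectionAt_of_directSum _ _ (i_opn_mul_r_opn 1)
    (fun b => r_mul_i_opn (Finset.subset_univ {b}) 1) (fun b => r_opn_not_mul_i_opn b 1) hO
  obtain ⟨sCC, hCC, i_clo, r_clo⟩ := exists_isSectionAt_of_directSum _ _ (i_clo_mul_r_clo 1)
    (fun b => r_mul_i_clo (Finset.subset_univ {b}) 1) (fun b => r_clo_not_mul_i_clo b 1) hC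
  have hinj : ∀ {U Y C : LC PseudoCircle} (h : IsExtension U Y C) {s : K →+ E}
      (_ : IsSectionAt p (U, 1) s) (z : K), of (Gen.i h.1 1) • z = 0 →
      of (Gen.i h.1 1) • s z = 0 := fun h s hs z hz => by
    rw [← hs.map_smul, D.e_smul_eq_zero h hz, map_zero, smul_zero]
  -- Sections at `lc univ {b}`.
  have h1 : ∀ b, ∃ t, IsSectionAt p (lc univ {b}, 1) t ∧
      Compat (Gen.i (isOpenIn_opn univ {b}) 1) (sO b) t ∧
      ∀ k, of (Gen.r (isClosedIn_clo univ {b}) 1) • t k =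
        sCC (of (Gen.r (isClosedIn_clo univ {b}) 1) • e (lc univ {b}, 1) • k) := fun b => by
    have h := isExtension_opn_clo univ {b}
    refine exists_isSectionAt_of_i D.free D.exact h (hO b) (hinj h (hO b))
      (DistribSMul.toAddMonoidHom E (of (Gen.r h.isClosedIn 1)))
      (sCC.comp (DistribSMul.toAddMonoidHom K (of (Gen.r h.isClosedIn 1)))) (fun z => ?_)
      (fun k hk => D.exists_lift_r h hk (hCC.smul _)
        ((hCC.right_inv _).trans (e_smul_of_smul _ _)))
    change of (Gen.r h.isClosedIn 1) • _ • _ = sCC (of (Gen.r h.isClosedIn 1) • _ • _)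
    rw [← mul_smul, ← mul_smul, r_mul_i h, zero_smul, zero_smul, map_zero]
  choose sR hR i_rim r_hull' using h1
  have r_hull : ∀ b, Compat (Gen.r (isClosedIn_clo univ {b}) 1) (sR b) sCC := fun b k => by
    rw [r_hull', ← mul_smul, mul_source]
  -- Sections at `lc {x} univ`, and at the whole space.
  let κ : Finset Bool → E →+ Bool → E := fun A => AddMonoidHom.pi fun b =>
    DistribSMul.toAddMonoidHom E (edge A b 1)
  let l : Finset Bool → K →+ Bool → E := fun A => AddMonoidHom.pi fun b =>
    (sR b).comp (DistribSMul.toAddMonoidHom K (edge A b 1))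
  have hκl : ∀ {A sA}, IsSectionAt p (lc A ∅, 1) sA →
      Compat (Gen.i (isOpenIn_clo (Finset.subset_univ A)) 1) sA sCC →
      ∀ k, e (lc A univ, 1) • k = k →
        ∃ y, e (lc A univ, 1) • y = y ∧ p y = k ∧ κ A y = l A k := fun hA hi k hk => by
    obtain ⟨y, hy, hyk, hyR⟩ := exists_lift_edge D hA hi hR r_hull hk
    exact ⟨y, hy, hyk, funext hyR⟩
  have h2 : ∀ x, ∃ t, IsSectionAt p (lc {x} univ, 1) t ∧
      Compat (Gen.i (isOpenIn_opn {x} univ) 1) sOO t ∧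
      ∀ k, κ {x} (t k) = l {x} (e (lc {x} univ, 1) • k) := fun x => by
    have h := isExtension_opn_clo {x} univ
    refine exists_isSectionAt_of_i D.free D.exact h hOO (hinj h hOO) _ _
      (fun z => funext fun b => ?_) (hκl (hC x) (i_clo x))
    change edge {x} b 1 • _ • sOO z = sR b (edge {x} b 1 • _ • z)
    rw [← mul_smul, ← mul_smul, edge_mul_i, mul_smul, mul_smul, i_rim, r_opn]
  choose sH hH i_hull hHκ using h2
  have h_edge : ∀ x b k, edge {x} b 1 • sH x k = sR b (edge {x} b 1 • k) := fun x b k => by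
    refine (congrFun (hHκ x k) b).trans ?_
    change sR b (edge {x} b 1 • _ • k) = _
    rw [← mul_smul, edge_mul_e]
  obtain ⟨sX, hX, i_univ, hXκ⟩ := exists_isSectionAt_univ D.free D.exact hH i_hull
    (hinj (isExtension_opn_clo univ univ) hOO) (κ univ) (l univ)
    (fun x z => funext fun b => by
      change edge univ b 1 • _ • sH x z = sR b (edge univ b 1 • _ • z)
      rw [edge_univ, ← mul_smul, ← mul_smul, r_univ_mul_i_univ, h_edge])
    (hκl hCC fun k => by rw [i_self, hCC.map_smul, hCC.smul])
  have r_univ : ∀ b, Compat (Gen.r (isClosedIn_univ univ {b}) 1) sX (sR b) := fun b k => by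
    have h3 : edge univ b 1 • sX k = sR b (edge univ b 1 • e (lc univ univ, 1) • k) :=
      congrFun (hXκ k) b
    rw [← mul_smul, edge_mul_e, edge_univ] at h3
    exact h3.symm
  -- Sections at `lc {x} {b}`.
  have h4 : ∀ x b, ∃ t, IsSectionAt p (lc {x} {b}, 1) t ∧
      Compat (Gen.r (isClosedIn_univ {x} {b}) 1) (sH x) t ∧
      ∀ k, of (Gen.i (isOpenIn_univ {x} {b}) 1) • t k =
        sR b (of (Gen.i (isOpenIn_univ {x} {b}) 1) • e (lc {x} {b}, 1) • k) := fun x b => by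
    have h := isExtension_opn {x} b
    refine exists_isSectionAt_of_r D.free D.exact h (hH x)
      ((i_opn (!b)).comp (i_hull x) (i_comp _ _ h.1 1))
      (DistribSMul.toAddMonoidHom E (of (Gen.i (isOpenIn_univ {x} {b}) 1)))
      ((sR b).comp (DistribSMul.toAddMonoidHom K (of (Gen.i (isOpenIn_univ {x} {b}) 1))))
      (fun z => ?_) (fun k hk => ?_)
    · change of (Gen.i (isOpenIn_univ {x} {b}) 1) • _ • sH x z =
        sR b (of (Gen.i (isOpenIn_univ {x} {b}) 1) • _ • z)
      rw [← mul_smul, ← mul_smul]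
      exact h_edge x b z
    · obtain ⟨y, hy, rfl⟩ := exists_lift_comp D.surj hk
      have h5 := isExtension_clo x {b}
      -- The restriction to the other closed point vanishes.
      have h6 : of (Gen.r h5.isClosedIn 1) • sR b (of (Gen.i h5.1 1) • p y) = 0 := by
        rw [← r_comp (isClosedIn_clo univ {b}) (isClosedIn_clo_of_subset (Finset.subset_univ {!x})),
          mul_smul, ← r_hull, ← r_clo, ← mul_smul _ _ (_ • p y),
          r_comp _ _ h5.isClosedIn, ← mul_smul, r_mul_i h5, zero_smul, map_zero]
      obtain ⟨n, hn, hpn, hni⟩ := D.exists_i_ker h5 (j := 1)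
        (y := of (Gen.i h5.1 1) • y - sR b (of (Gen.i h5.1 1) • p y))
        (by rw [smul_sub, e_smul_of_smul, (hR b).smul])
        (by rw [map_sub, map_smul, (hR b).right_inv, e_smul_of_smul, sub_self])
        (by rw [smul_sub, h6, ← mul_smul, r_mul_i h5, zero_smul, sub_zero])
      refine ⟨y - n, by rw [smul_sub, hy, hn], by rw [map_sub, hpn, sub_zero], ?_⟩
      change of (Gen.i h5.1 1) • (y - n) = sR b (of (Gen.i h5.1 1) • p y)
      rw [smul_sub, hni, sub_sub_cancel]
  choose sE hE r_edge i_edge using h4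
  exact ⟨.mk' hO hC hH hR hE hOO hCC hX i_opn r_opn i_clo r_clo i_hull i_univ
    (fun x b k => by rw [i_edge, ← mul_smul, mul_source]) r_edge r_univ r_hull⟩

end

section

variable {E K : Type u} [AddCommGroup E] [Module (NT PseudoCircle) E] [AddCommGroup K]
  [Module (NT PseudoCircle) K] {p : E →ₗ[NT PseudoCircle] K}

/-! ### Sections of even degree -/

/-- Compatible sections at the closed complement and at `U` respect the kernel of the extension
map `i`, which is the image of the boundary map. -/
theorem i_smul_eq_zero (hKe : IsExact (X := PseudoCircle) K) {U Y C : LC PseudoCircle}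
    (h : IsExtension U Y C) {j : ZMod 2} {s v : K →+ E} (hs : IsSectionAt p (U, j + 1) s)
    (hvs : Compat (Gen.δ h.isBoundaryPair j) v s) {k : K}
    (hk : of (Gen.i h.1 (j + 1)) • k = 0) : of (Gen.i h.1 (j + 1)) • s k = 0 := by
  obtain ⟨u, -, hu⟩ := hKe.exists_δ h (m := e (U, j + 1) • k) (e_smul_mem_comp K _ k)
    (by rw [← mul_smul, mul_source, hk])
  rw [← hs.map_smul, ← hu, hvs, ← mul_smul, i_mul_δ h, zero_smul]

/-- Compatibility with `g` can be checked after composition with a surjection. -/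
theorem compat_of_surjective {a b c : Obj PseudoCircle} {f : Gen a b} {g : Gen b c}
    {s t v : K →+ E} (hf : ∀ k : K, e b • k = k → ∃ u, of f • u = k) (ht : IsSectionAt p b t)
    (hst : Compat f s t) (h : ∀ u, v (of g • of f • u) = of g • of f • s u) : Compat g t v := by
  intro k
  obtain ⟨u, hu⟩ := hf _ (e_smul_mem_comp K b k)
  have h1 : of g • k = of g • e b • k := by rw [← mul_smul, mul_source]
  rw [← ht.map_smul, h1, ← hu, h, hst]

/-- Compatible sections of even degree exist, and they can be chosen to be compatible with sections
of odd degree via the boundary maps. They are prescribed on the images of the boundary maps, then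
extended along `i` to the open sets, which induces sections at their closed subsets. The remaining
compatibilities can be checked at open sets, as the restriction maps of `K` are surjective. -/
theorem exists_sectionFamily_zero (D : IsSplittable p) (F : SectionFamily p 1) :
    ∃ G : SectionFamily p 0,
      Compat (Gen.δ (isBoundaryPair_clo_opn univ univ) 1) (F.s univ ∅) (G.s ∅ univ) := by
  -- Sections at sets of open points.
  have h1 : ∀ b, ∃ s, IsSectionAt p (lc ∅ {b}, 0) s ∧
      Compat (Gen.δ (isBoundaryPair_clo_opn univ {b}) 1) (F.s univ ∅) s := fun b =>
    exists_isSectionAt_of_δ D.surj D.free D.exact (isExtension_opn_clo univ {b})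
      (F.isSectionAt univ ∅) (F.r_hull b)
  choose sO hO δ_opn using h1
  obtain ⟨sOO, hOO, i_opn, r_opn⟩ := exists_isSectionAt_of_directSum _ _ (i_opn_mul_r_opn 0)
    (fun b => r_mul_i_opn (Finset.subset_univ {b}) 0) (fun b => r_opn_not_mul_i_opn b 0) hO
  have hδ : Compat (Gen.δ (isBoundaryPair_clo_opn univ univ) 1) (F.s univ ∅) sOO := fun k => by
    have h2 : ∀ {M : Type u} [AddCommGroup M] [Module (NT PseudoCircle) M] (b : Bool) (m : M),
        of (Gen.r (isClosedIn_opn (Finset.subset_univ {b})) 0) •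
          of (Gen.δ (isBoundaryPair_clo_opn univ univ) 1) • m =
            of (Gen.δ (isBoundaryPair_clo_opn univ {b}) 1) • m := fun b m =>
      (mul_smul _ _ m).symm.trans (congrArg (· • m) (r_δ _ _ _ 1))
    have h3 : ∀ m : E, e (lc ∅ univ, 0) • of (Gen.δ (isBoundaryPair_clo_opn univ univ) 1) • m =
      of (Gen.δ (isBoundaryPair_clo_opn univ univ) 1) • m := fun m => e_smul_of_smul _ _
    rw [← hOO.smul, ← h3, ← i_opn_mul_r_opn 0, add_smul, add_smul, mul_smul, mul_smul, mul_smul,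
      mul_smul, ← r_opn, ← r_opn, h2, h2, h2, h2, δ_opn, δ_opn]
  -- Sections at the sets containing all open points.
  have hker : ∀ x z, of (Gen.i (isOpenIn_opn {x} univ) 0) • z = 0 →
      of (Gen.i (isOpenIn_opn {x} univ) 0) • sOO z = 0 := fun x z hz =>
    i_smul_eq_zero (j := 1) D.exact (isExtension_opn_clo {x} univ) hOO
      ((F.i_clo x).comp hδ (δ_i _ _ _ 1)) hz
  have h2 : ∀ x, ∃ t, IsSectionAt p (lc {x} univ, 0) t ∧
      Compat (Gen.i (isOpenIn_opn {x} univ) 0) sOO t := fun x => by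
    obtain ⟨t, ht, hit, -⟩ := exists_isSectionAt_of_i D.free D.exact
      (isExtension_opn_clo {x} univ) hOO (hker x) (0 : E →+ E) 0 (fun _ => rfl)
      (fun k hk => (exists_lift_comp D.surj hk).imp fun y hy => ⟨hy.1, hy.2, rfl⟩)
    exact ⟨t, ht, hit⟩
  choose sH hH i_hull using h2
  obtain ⟨sX, hX, i_univ, -⟩ := exists_isSectionAt_univ D.free D.exact hH i_hull
    (fun z hz => i_smul_eq_zero (j := 1) D.exact (isExtension_opn_clo univ univ) hOO hδ hz)
    (0 : E →+ E) 0 (fun _ _ => rfl)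
    (fun k hk => (exists_lift_comp D.surj hk).imp fun y hy => ⟨hy.1, hy.2, rfl⟩)
  -- The other sets are closed subsets of these.
  have hr : ∀ {U Y C : LC PseudoCircle} (h : IsExtension U Y C) {s t : K →+ E},
      IsSectionAt p (Y, 0) t → Compat (Gen.i h.1 0) s t →
      ∃ v, IsSectionAt p (C, 0) v ∧ Compat (Gen.r h.isClosedIn 0) t v := by
    intro U Y C h s t ht hst
    obtain ⟨v, hv, htv, -⟩ := exists_isSectionAt_of_r D.free D.exact h ht hst (0 : E →+ E) 0
      (fun _ => rfl) (fun k hk => (exists_lift_comp D.surj hk).imp fun y hy => ⟨hy.1, hy.2, rfl⟩)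
    exact ⟨v, hv, htv⟩
  have h3 : ∀ x b, ∃ v, IsSectionAt p (lc {x} {b}, 0) v ∧
      Compat (Gen.r (isClosedIn_univ {x} {b}) 0) (sH x) v := fun x b =>
    hr (isExtension_opn {x} b) (hH x) ((i_opn (!b)).comp (i_hull x) (i_comp _ _ _ 0))
  choose sE hE r_edge using h3
  have i_top : Compat (Gen.i (isOpenIn_opn univ univ) 0) sOO sX :=
    (i_hull true).comp (i_univ true) (i_comp _ _ _ 0)
  have h4 : ∀ b, ∃ v, IsSectionAt p (lc univ {b}, 0) v ∧
      Compat (Gen.r (isClosedIn_univ univ {b}) 0) sX v := fun b =>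
    hr (isExtension_opn univ b) hX ((i_opn (!b)).comp i_top (i_comp _ _ _ 0))
  choose sR hR r_univ using h4
  have h5 : ∀ x, ∃ v, IsSectionAt p (lc {x} ∅, 0) v ∧
      Compat (Gen.r (isClosedIn_clo {x} univ) 0) (sH x) v := fun x =>
    hr (isExtension_opn_clo {x} univ) (hH x) (i_hull x)
  choose sC hC r_clo_hull using h5
  obtain ⟨sCC, hCC, i_clo, r_clo⟩ := exists_isSectionAt_of_directSum _ _ (i_clo_mul_r_clo 0)
    (fun b => r_mul_i_clo (Finset.subset_univ {b}) 0) (fun b => r_clo_not_mul_i_clo b 0) hC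
  -- The remaining compatibilities.
  have i_edge : ∀ x b, Compat (Gen.i (isOpenIn_univ {x} {b}) 0) (sE x b) (sR b) := by
    intro x b
    have h6 := r_univ_mul_i_univ {x} b 0
    rw [edge] at h6
    refine compat_of_surjective (fun k hk => D.exists_r_smul_eq (isExtension_opn {x} b) hk) (hE x b)
      (r_edge x b) fun u => ?_
    rw [← mul_smul, ← mul_smul, ← h6, mul_smul, mul_smul, r_univ, i_univ]
  have r_top : Compat (Gen.r (isClosedIn_clo univ univ) 0) sX sCC := by
    -- The elements at the whole space are sums of elements at the sets `lc {x} univ`.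
    have h6 : ∀ x u, sCC (of (Gen.r (isClosedIn_clo univ univ) 0) •
        of (Gen.i (isOpenIn_univ {x} univ) 0) • u) =
        of (Gen.r (isClosedIn_clo univ univ) 0) •
          sX (of (Gen.i (isOpenIn_univ {x} univ) 0) • u) := by
      intro x u
      have h7 : of (Gen.r (isClosedIn_clo univ univ) 0) * of (Gen.i (isOpenIn_univ {x} univ) 0) =
          of (Gen.i (isOpenIn_clo (Finset.subset_univ {x})) 0) *
            of (Gen.r (isClosedIn_clo {x} univ) 0) :=
        r_i _ _ (eq_inter_lc (Finset.inter_univ _).symm (Finset.inter_empty _).symm) _ _ 0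
      rw [i_univ, ← mul_smul, ← mul_smul, h7, mul_smul, mul_smul, i_clo, r_clo_hull]
    intro k
    obtain ⟨u, hu⟩ := D.exists_r_smul_eq (isExtension_opn_clo {true} univ)
      (k := of (Gen.r (isExtension_clo false univ).isClosedIn 0) • k) (e_smul_of_smul _ _)
    obtain ⟨w, -, hw⟩ := D.exact.exists_i (isExtension_clo false univ) (j := 0)
      (m := e (lc univ univ, 0) • k - of (Gen.i (isOpenIn_univ {true} univ) 0) • u)
      (by rw [smul_sub, e_smul_of_smul, ← mul_smul, e_mul_self])
      (by
        rw [smul_sub, ← mul_smul, mul_source, ← hu, ← mul_smul _ _ u]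
        exact sub_eq_zero.2 (congrArg (· • u) (r_clo_mul_i_univ true _ 0).symm))
    have h8 : e (lc univ univ, 0) • k = of (Gen.i (isOpenIn_univ {false} univ) 0) • w +
      of (Gen.i (isOpenIn_univ {true} univ) 0) • u := (sub_eq_iff_eq_add.1 hw.symm)
    have h9 : of (Gen.r (isClosedIn_clo univ univ) 0) • k =
        of (Gen.r (isClosedIn_clo univ univ) 0) • e (lc univ univ, 0) • k := by
      rw [← mul_smul, mul_source]
    rw [← hX.map_smul, h9, h8, smul_add, map_add, h6, h6, map_add, smul_add]
  have r_hull : ∀ b, Compat (Gen.r (isClosedIn_clo univ {b}) 0) (sR b) sCC := fun b =>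
    compat_of_surjective (fun k hk => D.exists_r_smul_eq (isExtension_opn univ b) hk) (hR b)
      (r_univ b) fun u => by
        rw [← mul_smul, ← mul_smul, r_comp _ _ (isClosedIn_clo univ univ), r_top]
  exact ⟨.mk' hO hC hH hR hE hOO hCC hX i_opn r_opn i_clo r_clo i_hull i_univ i_edge r_edge r_univ
    r_hull, hδ⟩

/-- The extension `p` splits. -/
theorem IsSplittable.exists_section (D : IsSplittable p) :
    ∃ σ : K →ₗ[NT PseudoCircle] E, p ∘ₗ σ = LinearMap.id := by
  obtain ⟨F⟩ := exists_sectionFamily_one D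
  obtain ⟨G, hG⟩ := exists_sectionFamily_zero D F
  -- In even degree, the boundary maps vanish.
  have hF : Compat (Gen.δ (isBoundaryPair_clo_opn univ univ) 0) (G.s univ ∅) (F.s ∅ univ) := by
    intro k
    obtain ⟨u, hu⟩ := D.exists_r_smul_eq (isExtension_opn_clo univ univ)
      (e_smul_mem_comp K (lc univ ∅, 0) k)
    have h1 : Compat (Gen.r (isClosedIn_clo univ univ) 0) (G.s univ univ) (G.s univ ∅) :=
      (G.r_univ true).comp (G.r_hull true) (r_comp _ _ _ 0)
    rw [D.δ_zero, map_zero, ← (G.isSectionAt _ _).map_smul, ← hu, h1, ← mul_smul,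
      δ_mul_r (isExtension_opn_clo univ univ), zero_smul]
  choose A B hAB using exists_lc
  have hA : ∀ A' B', A (lc A' B') = A' := fun A' B' => (lc_injective (hAB (lc A' B'))).1.symm
  have hB : ∀ A' B', B (lc A' B') = B' := fun A' B' => (lc_injective (hAB (lc A' B'))).2.symm
  let s : Obj PseudoCircle → K →+ E := fun c =>
    if c.2 = 0 then G.s (A c.1) (B c.1) else F.s (A c.1) (B c.1)
  have hG0 : ∀ A' B', s (lc A' B', 0) = G.s A' B' := fun A' B' => by
    change G.s _ _ = _
    rw [hA, hB]
  have hF1 : ∀ A' B', s (lc A' B', 1) = F.s A' B' := fun A' B' => by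
    change F.s _ _ = _
    rw [hA, hB]
  have hj : ∀ j : ZMod 2, j = 0 ∨ j = 1 := by decide
  refine exists_section_of_essential (s := s) (fun c => ?_) ?_
  · obtain ⟨Y, j⟩ := c
    obtain ⟨A', B', rfl⟩ := exists_lc Y
    obtain rfl | rfl := hj j
    · rw [hG0]
      exact G.isSectionAt A' B'
    · rw [hF1]
      exact F.isSectionAt A' B'
  · have key : ∀ {A₁ B₁ A₂ B₂ : Finset Bool}
        {g : ∀ j, Gen ((lc A₁ B₁, j) : Obj PseudoCircle) ((lc A₂ B₂, j) : Obj PseudoCircle)},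
        Compat (g 0) (G.s A₁ B₁) (G.s A₂ B₂) → Compat (g 1) (F.s A₁ B₁) (F.s A₂ B₂) →
        ∀ j, Compat (g j) (s (lc A₁ B₁, j)) (s (lc A₂ B₂, j)) := by
      intro A₁ B₁ A₂ B₂ g h0 h1 j
      obtain rfl | rfl := hj j
      · rw [hG0, hG0]
        exact h0
      · rw [hF1, hF1]
        exact h1
    exact
      { i_opn := fun b j h => key (g := Gen.i h) (G.i_opn b) (F.i_opn b) j
        r_opn := fun b j h => key (g := Gen.r h) (G.r_opn b) (F.r_opn b) j
        i_clo := fun x j h => key (g := Gen.i h) (G.i_clo x) (F.i_clo x) j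
        r_clo := fun x j h => key (g := Gen.r h) (G.r_clo x) (F.r_clo x) j
        i_hull := fun x j h => key (g := Gen.i h) (G.i_hull x) (F.i_hull x) j
        i_univ := fun x j h => key (g := Gen.i h) (G.i_univ x) (F.i_univ x) j
        i_edge := fun x b j h => key (g := Gen.i h) (G.i_edge x b) (F.i_edge x b) j
        r_edge := fun x b j h => key (g := Gen.r h) (G.r_edge x b) (F.r_edge x b) j
        r_univ := fun b j h => key (g := Gen.r h) (G.r_univ b) (F.r_univ b) j
        r_hull := fun b j h => key (g := Gen.r h) (G.r_hull b) (F.r_hull b) j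
        δ := fun j h => by
          obtain rfl | rfl := hj j
          · change Compat _ (s (lc univ ∅, 0)) (s (lc ∅ univ, 1))
            rw [hG0, hF1]
            exact hF
          · change Compat _ (s (lc univ ∅, 1)) (s (lc ∅ univ, 0))
            rw [hG0, hF1]
            exact hG }

end

end PseudoCircle

/-! ### Suspensions -/

section

variable {X : Type} [TopologicalSpace X] [Finite X]

theorem NT.shift_mk (x : Free X) : NT.shift (NT.mk x) = NT.mk (Free.shift x) :=
  RingQuot.lift_mkRingHom_apply _ _ _

theorem NT.shift_e (a : Obj X) : NT.shift (NT.e a) = NT.e a.shift :=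
  (NT.shift_mk _).trans (congrArg NT.mk (Free.shift_e a))

theorem NT.shift_of {a b : Obj X} (g : Gen a b) : NT.shift (NT.of g) = NT.of g.shift :=
  (NT.shift_mk _).trans (congrArg NT.mk (Free.shift_of g))

section

variable {M : ModuleCat.{u} (NT X)}

theorem suspension_smul (x : NT X) (m : (suspension X).obj M) :
    x • m = (NT.shift x • (show M from m) : M) := rfl

theorem suspension_of_smul {a b : Obj X} (g : Gen a b) (m : (suspension X).obj M) :
    NT.of g • m = (NT.of g.shift • (show M from m) : M) := by
  rw [suspension_smul, NT.shift_of]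

theorem suspension_e_smul (a : Obj X) (m : (suspension X).obj M) :
    NT.e a • m = (NT.e a.shift • (show M from m) : M) := by
  rw [suspension_smul, NT.shift_e]

theorem isExact_suspension (hM : IsExact (X := X) M) :
    IsExact (X := X) ((suspension X).obj M) := by
  refine isExact_of_forall (fun U Y C h j m hm h0 => ?_) (fun U Y C h j m hm h0 => ?_)
    fun U Y C h j m hm h0 => ?_
  · rw [suspension_e_smul] at hm
    rw [suspension_of_smul] at h0
    obtain ⟨u, -, hu⟩ := hM.exists_i h hm h0
    exact ⟨u, (suspension_of_smul _ _).trans hu⟩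
  · rw [suspension_e_smul] at hm
    rw [suspension_of_smul] at h0
    obtain ⟨u, -, hu⟩ := hM.exists_r h hm h0
    exact ⟨u, (suspension_of_smul _ _).trans hu⟩
  · rw [suspension_e_smul] at hm
    rw [suspension_of_smul] at h0
    obtain ⟨u, -, hu⟩ := hM.exists_δ h hm h0
    exact ⟨u, (suspension_of_smul _ _).trans hu⟩

theorem δ_smul_suspension (hM : IsRealRankZeroLike (X := X) M) {C U : LC X}
    (h : IsBoundaryPair C U) (m : (suspension X).obj M) : NT.of (Gen.δ h 1) • m = 0 :=
  (suspension_of_smul _ _).trans (hM.δ_smul h _)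

end

theorem IsExact.of_equiv {M N : Type*} [AddCommGroup M] [Module (NT X) M] [AddCommGroup N]
    [Module (NT X) N] (hM : IsExact (X := X) M) (φ : M ≃ₗ[NT X] N) : IsExact (X := X) N := by
  have key : ∀ {a b x : NT X}, (∀ m : M, a • m = m → b • m = 0 → ∃ u : M, x • u = m) →
      ∀ n : N, a • n = n → b • n = 0 → ∃ u : N, x • u = n := fun h n ha hb => by
    obtain ⟨u, hu⟩ := h (φ.symm n) (by rw [← map_smul, ha]) (by rw [← map_smul, hb, map_zero])
    exact ⟨φ u, by rw [← map_smul, hu, LinearEquiv.apply_symm_apply]⟩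
  exact isExact_of_forall
    (fun _ _ _ h _ => key fun m hm h0 => (hM.exists_i h hm h0).imp fun _ => And.right)
    (fun _ _ _ h _ => key fun m hm h0 => (hM.exists_r h hm h0).imp fun _ => And.right)
    (fun _ _ _ h _ => key fun m hm h0 => (hM.exists_δ h hm h0).imp fun _ => And.right)

end

end FilteredK

open FilteredK in
theorem mainTheorem3 (M : ModuleCat.{u} (NT PseudoCircle))
    (hM : IsRealRankZeroLike (X := PseudoCircle) M) :
    Subsingleton (Abelian.Ext M ((suspension PseudoCircle).obj M) 2) := by
  obtain ⟨Q, _, _, q, hQ, hq, hKe, hKf, hKδ⟩ := PseudoCircle.exists_projective_cover hM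
  refine subsingleton_ext_two_of_split q hq fun E _ _ i p hi hp hip => ?_
  let φ : (suspension PseudoCircle).obj M ≃ₗ[NT PseudoCircle] LinearMap.ker p :=
    (LinearEquiv.ofInjective i hi).trans
      (LinearEquiv.ofEq _ _ (LinearMap.exact_iff.1 hip).symm)
  refine PseudoCircle.IsSplittable.exists_section
    { surj := hp
      free := hKf
      exact := hKe
      δ_zero := hKδ
      exact_ker := (isExact_suspension hM.1).of_equiv φ
      δ_one := fun h n => ?_ }
  rw [← φ.apply_symm_apply n, ← map_smul, δ_smul_suspension hM, map_zero]
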